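/- Let $\sigma\ge 1$ and let $\omega,c,\alpha,\beta\in\mathbb R$ be such that either $\omega>c^2/4$, or $\omega=c^2/4$ and $c>0$. Assume that $2\alpha-\beta>0$ and $2\alpha+\beta>0$, and moreover that $\beta c\le 0$ if $\omega>c^2/4$, and $\beta<0$ if $\omega=c^2/4$. Functions on $\mathbb R$ are complex-valued and identified when they agree almost everywhere; derivatives are weak derivatives. Put $X:=H^1(\mathbb R)$ if $\omega>c^2/4$, and $X:=\dot H^1(\mathbb R)\cap L^{2\sigma+2}(\mathbb R)$ if $\omega=c^2/4$ (the functions in $L^{2\sigma+2}$ with weak derivative in $L^2$), regarded as a real Banach space. Let $$N(\varphi):=\operatorname{Re}\int_{\mathbb R} i|\varphi|^{2\sigma}\overline{\varphi}\,\partial_x\varphi\,dx,\qquad E(\varphi):=\tfrac12\|\partial_x\varphi\|_{L^2}^2-\tfrac1{2\sigma+2}N(\varphi),$$ $$M(\varphi):=\|\varphi\|_{L^2}^2,\qquad P(\varphi):=\operatorname{Re}\int_{\mathbb R} i\,\partial_x\varphi\,\overline{\varphi}\,dx,$$ and for $\psi\in X$ $$\widetilde S_{\omega,c}(\psi):=\tfrac12\|\partial_x\psi\|_{L^2}^2+\tfrac12\Bigl(\omega-\tfrac{c^2}4\Bigr)\|\psi\|_{L^2}^2+\tfrac{c}{2(2\sigma+2)}\|\psi\|_{L^{2\sigma+2}}^{2\sigma+2}-\tfrac1{2\sigma+2}N(\psi),$$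 where the second term is absent if $\omega=c^2/4$. For $\varphi$ with $e^{-icx/2}\varphi\in X$ let $S_{\omega,c}(\varphi):=E(\varphi)+\frac{\omega}2M(\varphi)+\frac c2P(\varphi)$ if $\omega>c^2/4$, and $S_{\omega,c}(\varphi):=\widetilde S_{\omega,c}(e^{-icx/2}\varphi)$ if $\omega=c^2/4$; let $$K^{\alpha,\beta}_{\omega,c}(\varphi):=\partial_\lambda \widetilde S_{\omega,c}(\psi_\lambda)\big|_{\lambda=0},\qquad \psi:=e^{-icx/2}\varphi,\quad \psi_\lambda(x):=e^{\alpha\lambda}\psi(e^{-\beta\lambda}x).$$ Define $$\mu^{\alpha,\beta}_{\omega,c}:=\inf\{S_{\omega,c}(\varphi):e^{-icx/2}\varphi\in X\setminus\{0\},\ K^{\alpha,\beta}_{\omega,c}(\varphi)=0\},$$ $$\mathscr M^{\alpha,\beta}_{\omega,c}:=\{\varphi:e^{-icx/2}\varphi\in X\setminus\{0\},\ S_{\omega,c}(\varphi)=\mu^{\alpha,\beta}_{\omega,c},\ K^{\alpha,\beta}_{\omega,c}(\varphi)=0\},$$ $$\mathscr G_{\omega,c}:=\{\varphi:e^{-icx/2}\varphi\in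 X\setminus\{0\},\ S_{\omega,c}'(\varphi)=0\},$$ where $S_{\omega,c}'$ is the Fréchet derivative on the real Banach space $\{h:e^{-icx/2}h\in X\}$ normed by $\|e^{-icx/2}h\|_X$. Finally let $$\phi_{\omega,c}(x):=\Phi_{\omega,c}(x)\exp\Bigl(\tfrac{ic}2x-\tfrac{i}{2\sigma+2}\int_0^x\Phi_{\omega,c}(y)^{2\sigma}\,dy\Bigr),$$ $$\Phi_{\omega,c}(x):=\begin{cases}\Bigl\{\dfrac{(\sigma+1)(4\omega-c^2)}{2\sqrt\omega\cosh(\sigma\sqrt{4\omega-c^2}\,x)-c}\Bigr\}^{1/(2\sigma)},&\omega>c^2/4,\\[3mm]\Bigl\{\dfrac{2(\sigma+1)c}{\sigma^2(cx)^2+1}\Bigr\}^{1/(2\sigma)},&\omega=c^2/4,\ c>0.\end{cases}$$ Then $$\mathscr M^{\alpha,\beta}_{\omega,c}=\mathscr G_{\omega,c}=\{e^{i\theta_0}\phi_{\omega,c}(\cdot-x_0):\theta_0\in[0,2\pi),\ x_0\in\mathbb R\}.$$ -/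

import Mathlib

open MeasureTheory

namespace GDNLS

noncomputable section

/-- Measurable functions `ℝ → ℂ` modulo equality almost everywhere. -/
abbrev Fn : Type := ℝ →ₘ[volume] ℂ

/-- `g` is the weak (distributional) derivative of `f` on the real line. Testing with real-valued
functions is the same as testing with complex-valued ones, by linearity. -/
def IsWeakDeriv (f g : Fn) : Prop :=
  LocallyIntegrable f volume ∧ LocallyIntegrable g volume ∧
    ∀ η : ℝ → ℝ, ContDiff ℝ ((⊤ : ℕ∞) : WithTop ℕ∞) η → HasCompactSupport η →
      ∫ x, deriv η x • f x = -∫ x, η x • g x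

theorem IsWeakDeriv.unique {f g₁ g₂ : Fn} (h₁ : IsWeakDeriv f g₁) (h₂ : IsWeakDeriv f g₂) :
    g₁ = g₂ := by
  apply AEEqFun.ext
  apply ae_eq_of_integral_contDiff_smul_eq h₁.2.1 h₂.2.1
  intro η hη hc
  have e₁ := h₁.2.2 η hη hc
  have e₂ := h₂.2.2 η hη hc
  exact neg_injective (e₁.symm.trans e₂)

open Classical in
/-- The weak derivative `∂ₓ f` (and `0` if `f` has no weak derivative). -/
def weakDeriv (f : Fn) : Fn :=
  if h : ∃ g, IsWeakDeriv f g then h.choose else 0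

theorem IsWeakDeriv.weakDeriv_eq {f g : Fn} (h : IsWeakDeriv f g) : weakDeriv f = g := by
  have h' : ∃ g, IsWeakDeriv f g := ⟨g, h⟩
  rw [weakDeriv, dif_pos h']
  exact h'.choose_spec.unique h

/-- The admissible parameters: `ω > c² / 4`, or `ω = c² / 4` and `c > 0`. -/
def Admissible (ω c : ℝ) : Prop :=
  c ^ 2 / 4 < ω ∨ (ω = c ^ 2 / 4 ∧ 0 < c)

/-- The condition on `(α, β)`. -/
def ScalingCondition (ω c α β : ℝ) : Prop :=
  (c ^ 2 / 4 < ω → 0 < 2 * α - β ∧ 0 < 2 * α + β ∧ β * c ≤ 0) ∧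
  (ω = c ^ 2 / 4 → 0 < 2 * α - β ∧ 0 < 2 * α + β ∧ β < 0)

open Classical in
/-- The Lebesgue exponent occurring in the definition of the space `X`:
`2` if `ω > c² / 4`, and `2σ + 2` in the massless case `ω = c² / 4`. -/
def exponent (σ ω c : ℝ) : ENNReal :=
  if c ^ 2 / 4 < ω then 2 else ENNReal.ofReal (2 * σ + 2)

/-- The space `X`, which is `H¹(ℝ)` if `ω > c² / 4`, and `Ḣ¹(ℝ) ∩ L^{2σ+2}(ℝ)` if `ω = c² / 4`. -/
def X (σ ω c : ℝ) : Set Fn :=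
  {f | MemLp f (exponent σ ω c) volume ∧ ∃ g, IsWeakDeriv f g ∧ MemLp g 2 volume}

/-- The norm of `X`: the sum of the `L²` norm of the weak derivative and of the `L²`, respectively
`L^{2σ+2}`, norm of the function. -/
def normX (σ ω c : ℝ) (f : Fn) : ℝ :=
  (eLpNorm (weakDeriv f) 2 volume).toReal + (eLpNorm f (exponent σ ω c) volume).toReal

/-- The nonlinear term `N(φ) = Re ∫ i |φ|^{2σ} conj(φ) ∂ₓφ`. -/
def nonlin (σ : ℝ) (φ : Fn) : ℝ :=
  (∫ x, Complex.I * ((‖φ x‖ ^ (2 * σ) : ℝ) : ℂ) * (starRingEnd ℂ) (φ x) * weakDeriv φ x).re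

/-- The energy `E`. -/
def energy (σ : ℝ) (φ : Fn) : ℝ :=
  1 / 2 * (∫ x, ‖weakDeriv φ x‖ ^ 2) - 1 / (2 * σ + 2) * nonlin σ φ

/-- The mass `M(φ) = ‖φ‖²` in `L²`. -/
def mass (φ : Fn) : ℝ := ∫ x, ‖φ x‖ ^ 2

/-- The momentum `P(φ) = Re ∫ i ∂ₓφ conj(φ)`. -/
def momentum (φ : Fn) : ℝ :=
  (∫ x, Complex.I * weakDeriv φ x * (starRingEnd ℂ) (φ x)).re

/-- Multiplication by `e^{-icx/2}`. -/
def gauge (c : ℝ) (φ : Fn) : Fn :=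
  AEEqFun.mk (fun x : ℝ => Complex.exp (-(Complex.I * c * x / 2)))
    (by fun_prop : Continuous fun x : ℝ =>
      Complex.exp (-(Complex.I * c * x / 2))).aestronglyMeasurable * φ

/-- The gauged action `S̃` on the space `X`. In the massless case `ω = c² / 4` the `L²` norm, which
may be infinite there, has coefficient `0` and the second summand is `0`. -/
def actionTilde (σ ω c : ℝ) (ψ : Fn) : ℝ :=
  1 / 2 * (∫ x, ‖weakDeriv ψ x‖ ^ 2)
    + 1 / 2 * (ω - c ^ 2 / 4) * (∫ x, ‖ψ x‖ ^ 2)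
    + c / (2 * (2 * σ + 2)) * (∫ x, ‖ψ x‖ ^ (2 * σ + 2))
    - 1 / (2 * σ + 2) * nonlin σ ψ

open Classical in
/-- The action `S = E + (ω/2) M + (c/2) P`. In the massless case, where mass and momentum need not
be finite on the function space used, `S(φ)` is by definition `S̃(e^{-icx/2} φ)`. -/
def action (σ ω c : ℝ) (φ : Fn) : ℝ :=
  if c ^ 2 / 4 < ω then energy σ φ + ω / 2 * mass φ + c / 2 * momentum φ
  else actionTilde σ ω c (gauge c φ)

/-- The scaling `f_λ(x) = e^{αλ} f(e^{-βλ} x)`. -/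
def scale (α β l : ℝ) (f : Fn) : Fn :=
  AEEqFun.mk (fun x : ℝ => (Real.exp (α * l) : ℂ) * f (Real.exp (-(β * l)) * x))
    ((f.stronglyMeasurable.comp_measurable
      (measurable_const_mul (Real.exp (-(β * l))))).const_mul _).aestronglyMeasurable

/-- `K̃(ψ)`, the derivative of `λ ↦ S̃(ψ_λ)` at `λ = 0`. -/
def constraintTilde (σ ω c α β : ℝ) (ψ : Fn) : ℝ :=
  deriv (fun l : ℝ => actionTilde σ ω c (scale α β l ψ)) 0

/-- `K(φ) = K̃(e^{-icx/2} φ)`. -/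
def constraint (σ ω c α β : ℝ) (φ : Fn) : ℝ :=
  constraintTilde σ ω c α β (gauge c φ)

/-- The functions `φ` with `e^{-icx/2} φ ∈ X \ {0}`. -/
def domain (σ ω c : ℝ) : Set Fn :=
  {φ | gauge c φ ∈ X σ ω c \ {0}}

/-- The infimum of `S` under the constraint `K = 0`, as an extended real number. -/
def minValue (σ ω c α β : ℝ) : EReal :=
  sInf ((fun φ : Fn => (action σ ω c φ : EReal)) ''
    {φ | φ ∈ domain σ ω c ∧ constraint σ ω c α β φ = 0})

/-- The set of minimizers of `S` under the constraint `K = 0`. -/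
def minimizers (σ ω c α β : ℝ) : Set Fn :=
  {φ | φ ∈ domain σ ω c ∧ (action σ ω c φ : EReal) = minValue σ ω c α β ∧
    constraint σ ω c α β φ = 0}

/-- `S'(φ) = 0`: the action is Fréchet differentiable at `φ`, with derivative `0`, with respect to
perturbations `h` such that `e^{-icx/2} h ∈ X`, measured in the norm of `X`. -/
def ActionDerivVanishes (σ ω c : ℝ) (φ : Fn) : Prop :=
  ∀ ε > (0 : ℝ), ∃ δ > (0 : ℝ), ∀ h : Fn, gauge c h ∈ X σ ω c → normX σ ω c (gauge c h) < δ →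
    |action σ ω c (φ + h) - action σ ω c φ| ≤ ε * normX σ ω c (gauge c h)

/-- The set of nontrivial critical points of `S`. -/
def criticalPoints (σ ω c : ℝ) : Set Fn :=
  {φ | φ ∈ domain σ ω c ∧ ActionDerivVanishes σ ω c φ}

open Classical in
/-- The profile `Φ`. -/
def profile (σ ω c : ℝ) (x : ℝ) : ℝ :=
  if c ^ 2 / 4 < ω then
    ((σ + 1) * (4 * ω - c ^ 2) /
      (2 * √ω * Real.cosh (σ * √(4 * ω - c ^ 2) * x) - c)) ^ (1 / (2 * σ))
  else
    (2 * (σ + 1) * c / (σ ^ 2 * (c * x) ^ 2 + 1)) ^ (1 / (2 * σ))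

/-- The solitary wave `φ(x) = Φ(x) exp(i c x / 2 - i / (2σ+2) ∫₀ˣ Φ^{2σ})`. -/
def solitaryWave (σ ω c : ℝ) (x : ℝ) : ℂ :=
  (profile σ ω c x : ℂ) *
    Complex.exp (Complex.I * c / 2 * x -
      Complex.I / (2 * σ + 2) * ((∫ y in (0 : ℝ)..x, profile σ ω c y ^ (2 * σ) : ℝ) : ℂ))

/-- The orbit of the solitary wave under phase rotations and translations. -/
def orbit (σ ω c : ℝ) : Set Fn :=
  {φ | ∃ θ₀ ∈ Set.Ico 0 (2 * Real.pi), ∃ x₀ : ℝ,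
    ∀ᵐ x ∂volume, φ x = Complex.exp (Complex.I * (θ₀ : ℂ)) * solitaryWave σ ω c (x - x₀)}

end

end GDNLS

/-!
The proof runs through the cycle of inclusions
minimizers `⊆` critical points `⊆` orbit `⊆` minimizers. Everything is done for the gauged function
`ψ = e^{-icx/2} φ`. Put `k = 1 / (2σ + 2)`, `p = ∂ₓψ + i k |ψ|^{2σ} ψ` (`covD`) and
`q(r) = ω - c² / 4 + c k r^σ - k² r^{2σ}` (`qfun`). Completing the square gives
`S̃(ψ) = ∫ ½ |p|² + ½ |ψ|² q(|ψ|²)` (`actionTilde_eq_integral`), and `∂ₓ|ψ|² = 2 Re(ψ̄ p)`.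

*Lower bound.* The function `q` has a unique positive zero `r₀ = Φ(0)²` and is nonnegative on
`[0, r₀]`. If `max |ψ|² = r₀`, the density of the action is at least `|∂ₓ Θ(|ψ|²)|`, where
`Θ' = ½ √q` (`calib`), so that `S̃(ψ) ≥ 2 Θ(r₀)` (`two_mul_calib_le`). For `ψ` with vanishing
constraint, `λ ↦ S̃(ψ_λ)` has a strict maximum at `λ = 0` (`actionTilde_scale_lt`; this is where the
conditions on `α`, `β` enter), and some `ψ_λ` has maximum `√r₀`; hence `S̃(ψ) ≥ 2 Θ(r₀)` under the
constraint, and no compactness is needed (`calib_le_actionTilde`).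

*Minimizers are critical.* Near a minimizer `ψ`, every function can be scaled to have maximum
`√r₀` by a `λ` comparable to its distance from `ψ`. The scaling derivative vanishes at `ψ`, so this
costs only a second order amount of action, and `S̃(ψ + t h) ≥ S̃(ψ) - C t²`
(`actionTilde_ge_near`). The second order expansion of `S̃` (`actionTilde_expansion`) then makes the
derivative zero.

*Critical points lie in the orbit.* The Euler-Lagrange equation makes `ψ` and `p` continuously
differentiable (`classical_eulerLagrange`). The momentum `Im(ψ̄ p)` and the energy
`|p|² - |ψ|² q(|ψ|²)` are constant, and zero by integrability. Consequently `ψ` has no zeros, and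
`|ψ|^{-2σ}` solves a linear second order equation with constant coefficients, as does `Φ^{-2σ}`;
at the maximum of `|ψ|` the data agree because `q` vanishes there. This gives the modulus up to a
translation, and the phase follows from a first order linear equation (`eq_wave_of_critical`).

*The orbit consists of minimizers.* For the solitary wave the constraint is a combination of the
Pohozaev identity, which holds pointwise, and the Nehari identity, whose density is a derivative.
Its action is `2 Θ(r₀)`, because the estimate in the lower bound is an equality for it
(`IsWave.action_constraint`).
-/

open MeasureTheory
open scoped Topology

namespace GDNLS

/-! ### Weak derivatives on the line -/

section WeakDerivatives

open scoped ContDiff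

/-- `IsWeakDeriv` for functions instead of classes of functions. -/
def HasWeakDeriv (f g : ℝ → ℂ) : Prop :=
  LocallyIntegrable f volume ∧ LocallyIntegrable g volume ∧
    ∀ η : ℝ → ℝ, ContDiff ℝ ∞ η → HasCompactSupport η →
      ∫ x, deriv η x • f x = -∫ x, η x • g x

theorem isWeakDeriv_iff {f g : Fn} : IsWeakDeriv f g ↔ HasWeakDeriv f g := Iff.rfl

variable {f g f' g' u : ℝ → ℂ}

theorem HasWeakDeriv.congr (h : HasWeakDeriv f g) (hf : f =ᵐ[volume] f')
    (hg : g =ᵐ[volume] g') : HasWeakDeriv f' g' := by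
  refine ⟨(locallyIntegrable_congr hf).1 h.1, (locallyIntegrable_congr hg).1 h.2.1,
    fun η hη hc => ?_⟩
  have h1 : ∫ x, deriv η x • f' x = ∫ x, deriv η x • f x :=
    integral_congr_ae (by filter_upwards [hf] with x hx; rw [hx])
  have h2 : ∫ x, η x • g' x = ∫ x, η x • g x :=
    integral_congr_ae (by filter_upwards [hg] with x hx; rw [hx])
  rw [h1, h2]
  exact h.2.2 η hη hc

/-- The defining identity of weak derivatives holds for complex-valued test functions. -/
theorem HasWeakDeriv.integral_complex (h : HasWeakDeriv f g) {η : ℝ → ℂ}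
    (hη : ContDiff ℝ ∞ η) (hc : HasCompactSupport η) :
    ∫ x, deriv η x * f x = -∫ x, η x * g x := by
  have hre : ContDiff ℝ ∞ fun x => (η x).re := Complex.reCLM.contDiff.comp hη
  have him : ContDiff ℝ ∞ fun x => (η x).im := Complex.imCLM.contDiff.comp hη
  have hcre : HasCompactSupport fun x => (η x).re := hc.comp_left (g := Complex.re) rfl
  have hcim : HasCompactSupport fun x => (η x).im := hc.comp_left (g := Complex.im) rfl
  have hd : ∀ x, HasDerivAt η (deriv η x) x := fun x =>
    (hη.differentiable (by simp)).differentiableAt.hasDerivAt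
  have hdre : ∀ x, deriv (fun x => (η x).re) x = (deriv η x).re := fun x =>
    (Complex.reCLM.hasFDerivAt.comp_hasDerivAt x (hd x)).deriv
  have hdim : ∀ x, deriv (fun x => (η x).im) x = (deriv η x).im := fun x =>
    (Complex.imCLM.hasFDerivAt.comp_hasDerivAt x (hd x)).deriv
  have key : ∀ (p : ℝ → ℂ), Continuous p → HasCompactSupport p → ∀ k : ℝ → ℂ,
      LocallyIntegrable k volume →
      ∫ x, p x * k x = (∫ x, (p x).re • k x) + Complex.I * ∫ x, (p x).im • k x := by
    intro p hp hpc k hk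
    rw [← integral_const_mul, ← integral_add]
    · congr 1
      ext x
      conv_lhs => rw [← Complex.re_add_im (p x)]
      simp only [Complex.real_smul]
      ring
    · exact hk.integrable_smul_left_of_hasCompactSupport (Complex.continuous_re.comp hp)
        (hpc.comp_left (g := Complex.re) rfl)
    · exact (hk.integrable_smul_left_of_hasCompactSupport (Complex.continuous_im.comp hp)
        (hpc.comp_left (g := Complex.im) rfl)).const_mul _
  rw [key _ (hη.continuous_deriv (by simp)) hc.deriv _ h.1, key _ hη.continuous hc _ h.2.1]
  have e1 := h.2.2 _ hre hcre
  have e2 := h.2.2 _ him hcim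
  simp only [hdre] at e1
  simp only [hdim] at e2
  rw [e1, e2]
  ring

theorem HasWeakDeriv.add (h : HasWeakDeriv f g) (h' : HasWeakDeriv f' g') :
    HasWeakDeriv (fun x => f x + f' x) (fun x => g x + g' x) := by
  refine ⟨h.1.add h'.1, h.2.1.add h'.2.1, fun η hη hc => ?_⟩
  have c1 := hη.continuous
  have c2 := hη.continuous_deriv (by simp)
  simp only [smul_add]
  rw [integral_add (h.1.integrable_smul_left_of_hasCompactSupport c2 hc.deriv)
      (h'.1.integrable_smul_left_of_hasCompactSupport c2 hc.deriv),
    integral_add (h.2.1.integrable_smul_left_of_hasCompactSupport c1 hc)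
      (h'.2.1.integrable_smul_left_of_hasCompactSupport c1 hc),
    h.2.2 η hη hc, h'.2.2 η hη hc]
  ring

theorem locallyIntegrable_continuous_mul {e : ℝ → ℂ} (he : Continuous e)
    (hf : LocallyIntegrable f volume) : LocallyIntegrable (fun x => e x * f x) volume := by
  have := LocallyIntegrableOn.continuousOn_smul (𝕜 := ℂ) (g := e) (f := f) (s := Set.univ)
    isOpen_univ.isLocallyClosed (locallyIntegrableOn_univ.2 hf) he.continuousOn
  simpa [smul_eq_mul] using locallyIntegrableOn_univ.1 this

/-- The Leibniz rule for multiplication by a smooth function. -/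
theorem HasWeakDeriv.mul_left (h : HasWeakDeriv f g) {e : ℝ → ℂ} (he : ContDiff ℝ ∞ e) :
    HasWeakDeriv (fun x => e x * f x) (fun x => e x * g x + deriv e x * f x) := by
  have ce := he.continuous
  have cde := he.continuous_deriv (by simp)
  refine ⟨locallyIntegrable_continuous_mul ce h.1,
    (locallyIntegrable_continuous_mul ce h.2.1).add
      (locallyIntegrable_continuous_mul cde h.1), fun η hη hc => ?_⟩
  have hη' : ContDiff ℝ ∞ fun x => (η x : ℂ) := Complex.ofRealCLM.contDiff.comp hη
  have hcη' : HasCompactSupport fun x => (η x : ℂ) := hc.comp_left (g := Complex.ofReal) rfl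
  have hζ := h.integral_complex (hη'.mul he) hcη'.mul_right
  have hd : ∀ x, deriv (fun x => (η x : ℂ) * e x) x
      = ((deriv η x : ℝ) : ℂ) * e x + η x * deriv e x := by
    intro x
    have h1 : HasDerivAt η (deriv η x) x :=
      (hη.differentiable (by simp)).differentiableAt.hasDerivAt
    have h2 : HasDerivAt e (deriv e x) x :=
      (he.differentiable (by simp)).differentiableAt.hasDerivAt
    exact (h1.ofReal_comp.mul h2).deriv
  have I1 : Integrable fun x => deriv η x • (e x * f x) :=
    (locallyIntegrable_continuous_mul ce h.1).integrable_smul_left_of_hasCompactSupport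
      (hη.continuous_deriv (by simp)) hc.deriv
  have I2 : Integrable fun x => η x • (deriv e x * f x) :=
    (locallyIntegrable_continuous_mul cde h.1).integrable_smul_left_of_hasCompactSupport
      hη.continuous hc
  have I3 : Integrable fun x => η x • (e x * g x) :=
    (locallyIntegrable_continuous_mul ce h.2.1).integrable_smul_left_of_hasCompactSupport
      hη.continuous hc
  have e1 : ∫ x, deriv (fun x => (η x : ℂ) * e x) x * f x
      = (∫ x, deriv η x • (e x * f x)) + ∫ x, η x • (deriv e x * f x) := by
    rw [← integral_add I1 I2]
    congr 1
    ext x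
    rw [hd]
    simp only [Complex.real_smul]
    ring
  have e2 : ∫ x, (fun x => (η x : ℂ) * e x) x * g x = ∫ x, η x • (e x * g x) := by
    congr 1
    ext x
    simp only [Complex.real_smul]
    ring
  rw [e1] at hζ
  have e3 : ∫ x, η x • (e x * g x + deriv e x * f x)
      = (∫ x, η x • (e x * g x)) + ∫ x, η x • (deriv e x * f x) := by
    rw [← integral_add I3 I2]
    simp only [smul_add]
  rw [e3]
  have hζ' : (∫ x, deriv η x • (e x * f x)) + ∫ x, η x • (deriv e x * f x)
      = -∫ x, η x • (e x * g x) := by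
    rw [hζ]
    congr 1
  linear_combination hζ'

theorem HasWeakDeriv.const_mul (h : HasWeakDeriv f g) (z : ℂ) :
    HasWeakDeriv (fun x => z * f x) (fun x => z * g x) := by
  have := h.mul_left (e := fun _ => z) contDiff_const
  simpa using this

/-- Composition with a dilation. -/
theorem HasWeakDeriv.comp_mul_left (h : HasWeakDeriv f g) {b : ℝ} (hb : 0 < b) :
    HasWeakDeriv (fun x => f (b * x)) (fun x => b * g (b * x)) := by
  have loc : ∀ k : ℝ → ℂ, LocallyIntegrable k volume →
      LocallyIntegrable (fun x => k (b * x)) volume := by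
    intro k hk
    rw [locallyIntegrable_iff]
    intro K hK
    have h2 : IntegrableOn k ((fun x => b * x) '' K) volume :=
      hk.integrableOn_isCompact (hK.image (continuous_const_mul b))
    have hemb : MeasurableEmbedding (fun x : ℝ => b * x) :=
      (Homeomorph.mulLeft₀ b hb.ne').measurableEmbedding
    have h1 := (hemb.integrableOn_map_iff (μ := volume) (f := k) (s := (fun x => b * x) '' K)).1 (by
      rw [Real.map_volume_mul_left hb.ne']
      rw [IntegrableOn, Measure.restrict_smul]
      exact Integrable.smul_measure h2 ENNReal.ofReal_ne_top)
    rwa [Set.preimage_image_eq _ hemb.injective] at h1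
  refine ⟨loc f h.1, locallyIntegrable_continuous_mul continuous_const (loc g h.2.1),
    fun η hη hc => ?_⟩
  have hb' : b⁻¹ ≠ 0 := (inv_pos.2 hb).ne'
  have hη2 : ContDiff ℝ ∞ fun x => η (b⁻¹ * x) := hη.comp (contDiff_const.mul contDiff_id)
  have hc2 : HasCompactSupport fun x => η (b⁻¹ * x) :=
    hc.comp_homeomorph (Homeomorph.mulLeft₀ b⁻¹ hb')
  have hk := h.2.2 _ hη2 hc2
  have hd : ∀ x, deriv (fun x => η (b⁻¹ * x)) x = b⁻¹ * deriv η (b⁻¹ * x) := by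
    intro x
    have h1 : HasDerivAt η (deriv η (b⁻¹ * x)) (b⁻¹ * x) :=
      (hη.differentiable (by simp)).differentiableAt.hasDerivAt
    have h2 : HasDerivAt (fun x : ℝ => b⁻¹ * x) b⁻¹ x := by
      simpa using (hasDerivAt_id x).const_mul b⁻¹
    have := (h1.comp x h2).deriv
    rw [mul_comm]
    exact this
  have s1 := Measure.integral_comp_mul_left
    (fun x => deriv (fun x => η (b⁻¹ * x)) x • f x) b
  have s2 := Measure.integral_comp_mul_left (fun x => η (b⁻¹ * x) • g x) b
  simp only [hd, inv_mul_cancel_left₀ hb.ne'] at s1 s2 hk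
  have s1' : ∫ x, (b⁻¹ * deriv η x) • f (b * x) = (b⁻¹ : ℂ) * ∫ x, deriv η x • f (b * x) := by
    rw [← integral_const_mul]
    congr 1; ext x; simp only [Complex.real_smul]; push_cast; ring
  have s2' : ∫ x, η x • ((b : ℂ) * g (b * x)) = (b : ℂ) * ∫ x, η x • g (b * x) := by
    rw [← integral_const_mul]
    congr 1; ext x; simp only [Complex.real_smul]; ring
  change ∫ x, deriv η x • f (b * x) = -∫ x, η x • ((b : ℂ) * g (b * x))
  rw [s2', s2]
  rw [s1', hk] at s1
  have hbc : (b : ℂ) ≠ 0 := by exact_mod_cast hb.ne'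
  rw [inv_mul_eq_iff_eq_mul₀ hbc] at s1
  rw [s1, smul_neg]
  ring

theorem intervalIntegrable_of_locallyIntegrable
    (hg : LocallyIntegrable g volume) (a b : ℝ) : IntervalIntegrable g volume a b :=
  (hg.integrableOn_isCompact isCompact_uIcc).intervalIntegrable

/-- A primitive of a locally integrable complex function is absolutely continuous. -/
theorem absolutelyContinuous_of_primitive (hg : LocallyIntegrable g volume)
    (hu : ∀ x, u x = u 0 + ∫ t in (0:ℝ)..x, g t) (a b : ℝ) :
    AbsolutelyContinuousOnInterval (fun x => (u x).re) a b ∧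
      AbsolutelyContinuousOnInterval (fun x => (u x).im) a b := by
  have hsplit : ∀ x, u x = u a + ∫ t in a..x, g t := by
    intro x
    rw [hu x, hu a, add_assoc, intervalIntegral.integral_add_adjacent_intervals
      (intervalIntegrable_of_locallyIntegrable hg _ _)
      (intervalIntegrable_of_locallyIntegrable hg _ _)]
  have cst : ∀ z : ℝ, AbsolutelyContinuousOnInterval (fun _ : ℝ => z) a b := fun z =>
    (LipschitzWith.const (α := ℝ) z).lipschitzOnWith.absolutelyContinuousOnInterval
  have hre : IntervalIntegrable (fun x => (g x).re) volume a b :=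
    ⟨(intervalIntegrable_of_locallyIntegrable hg a b).1.re,
      (intervalIntegrable_of_locallyIntegrable hg a b).2.re⟩
  have him : IntervalIntegrable (fun x => (g x).im) volume a b :=
    ⟨(intervalIntegrable_of_locallyIntegrable hg a b).1.im,
      (intervalIntegrable_of_locallyIntegrable hg a b).2.im⟩
  constructor
  · have h1 := (cst (u a).re).add
      (hre.absolutelyContinuousOnInterval_intervalIntegral Set.left_mem_uIcc)
    have e : (fun x => (u x).re) = (fun _ => (u a).re) + fun x => ∫ v in a..x, (g v).re := by
      ext x
      rw [hsplit x]
      simp only [Complex.add_re, Pi.add_apply]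
      congr 1
      exact (Complex.reCLM.intervalIntegral_comp_comm
        (intervalIntegrable_of_locallyIntegrable hg a x)).symm
    rw [e]
    exact h1
  · have h1 := (cst (u a).im).add
      (him.absolutelyContinuousOnInterval_intervalIntegral Set.left_mem_uIcc)
    have e : (fun x => (u x).im) = (fun _ => (u a).im) + fun x => ∫ v in a..x, (g v).im := by
      ext x
      rw [hsplit x]
      simp only [Complex.add_im, Pi.add_apply]
      congr 1
      exact (Complex.imCLM.intervalIntegral_comp_comm
        (intervalIntegrable_of_locallyIntegrable hg a x)).symm
    rw [e]
    exact h1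

theorem ae_hasDerivAt_of_primitive (hg : LocallyIntegrable g volume)
    (hu : ∀ x, u x = u 0 + ∫ t in (0:ℝ)..x, g t) : ∀ᵐ x, HasDerivAt u (g x) x := by
  filter_upwards [LocallyIntegrable.ae_hasDerivAt_integral hg] with x hx
  have := (hx 0).const_add (u 0)
  have e : u = fun x => u 0 + ∫ t in (0:ℝ)..x, g t := funext hu
  rw [e]
  simpa using this

theorem continuous_of_primitive (hg : LocallyIntegrable g volume)
    (hu : ∀ x, u x = u 0 + ∫ t in (0:ℝ)..x, g t) : Continuous u := by
  have e : u = fun x => u 0 + ∫ t in (0:ℝ)..x, g t := funext hu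
  rw [e]
  exact continuous_const.add
    (intervalIntegral.continuous_primitive
      (fun a b => intervalIntegrable_of_locallyIntegrable hg a b) 0)

theorem HasWeakDeriv.of_primitive (hg : LocallyIntegrable g volume)
    (hu : ∀ x, u x = u 0 + ∫ t in (0:ℝ)..x, g t) : HasWeakDeriv u g := by
  have hcu := continuous_of_primitive hg hu
  refine ⟨hcu.locallyIntegrable, hg, fun η hη hc => ?_⟩
  obtain ⟨R, hR⟩ := hc.isCompact.isBounded.subset_ball_lt 0 0
  have hsupp : ∀ x, x ∉ Set.Ioc (-R) R → η x = 0 := by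
    intro x hx
    apply image_eq_zero_of_notMem_tsupport
    intro hx'
    have := hR.2 hx'
    rw [Real.ball_eq_Ioo] at this
    exact hx ⟨by linarith [this.1], by linarith [this.2]⟩
  have hsupp' : ∀ x, x ∉ Set.Ioc (-R) R → deriv η x = 0 := by
    intro x hx
    by_contra hne
    have hx' := hR.2 (subset_tsupport _ |>.trans (tsupport_deriv_subset (𝕜 := ℝ) (f := η)) hne)
    rw [Real.ball_eq_Ioo] at hx'
    exact hx ⟨by linarith [hx'.1], by linarith [hx'.2]⟩
  have hηac : AbsolutelyContinuousOnInterval η (-R) R :=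
    (hη.of_le (by simp)).contDiffOn.absolutelyContinuousOnInterval
  have hηR : η R = 0 := by
    by_contra hne
    have := hR.2 (subset_tsupport _ hne)
    rw [Real.ball_eq_Ioo] at this
    linarith [this.2]
  have hηR' : η (-R) = 0 := hsupp _ (by simp)
  have key : ∀ (v k : ℝ → ℝ), AbsolutelyContinuousOnInterval v (-R) R →
      (∀ᵐ x, HasDerivAt v (k x) x) →
      ∫ x in (-R)..R, deriv η x * v x = -∫ x in (-R)..R, η x * k x := by
    intro v k hv hk
    have h1 := hηac.integral_mul_deriv_eq_deriv_mul hv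
    rw [hηR, hηR'] at h1
    have h2 : ∫ x in (-R)..R, η x * deriv v x = ∫ x in (-R)..R, η x * k x :=
      intervalIntegral.integral_congr_ae (by
        filter_upwards [hk] with x hx _
        rw [hx.deriv])
    rw [← h2, h1]
    ring
  have e1 : ∫ x, deriv η x • u x = ∫ x in (-R)..R, deriv η x • u x :=
    (intervalIntegral.integral_eq_integral_of_support_subset (fun x hx => by
      by_contra hx'
      exact hx (by simp [hsupp' x hx']))).symm
  have e2 : ∫ x, η x • g x = ∫ x in (-R)..R, η x • g x :=
    (intervalIntegral.integral_eq_integral_of_support_subset (fun x hx => by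
      by_contra hx'
      exact hx (by simp [hsupp x hx']))).symm
  have I1 : IntervalIntegrable (fun x => deriv η x • u x) volume (-R) R :=
    (((hη.continuous_deriv (by simp)).smul hcu)).intervalIntegrable _ _
  have I2 : IntervalIntegrable (fun x => η x • g x) volume (-R) R :=
    (hg.integrable_smul_left_of_hasCompactSupport hη.continuous hc).intervalIntegrable
  have hac := absolutelyContinuous_of_primitive hg hu (-R) R
  have hae := ae_hasDerivAt_of_primitive hg hu
  have kre := key _ (fun x => (g x).re) hac.1 (by
    filter_upwards [hae] with x hx
    exact Complex.reCLM.hasFDerivAt.comp_hasDerivAt x hx)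
  have kim := key _ (fun x => (g x).im) hac.2 (by
    filter_upwards [hae] with x hx
    exact Complex.imCLM.hasFDerivAt.comp_hasDerivAt x hx)
  rw [e1, e2]
  apply Complex.ext
  · have r1 := Complex.reCLM.intervalIntegral_comp_comm I1
    have r2 := Complex.reCLM.intervalIntegral_comp_comm I2
    simp only [Complex.reCLM_apply, Complex.real_smul, Complex.re_ofReal_mul] at r1 r2
    rw [Complex.neg_re]
    simp only [Complex.real_smul]
    rw [← r1, ← r2]
    exact kre
  · have r1 := Complex.imCLM.intervalIntegral_comp_comm I1
    have r2 := Complex.imCLM.intervalIntegral_comp_comm I2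
    simp only [Complex.imCLM_apply, Complex.real_smul, Complex.im_ofReal_mul] at r1 r2
    rw [Complex.neg_im]
    simp only [Complex.real_smul]
    rw [← r1, ← r2]
    exact kim

/-- A function whose weak derivative vanishes is constant. -/
theorem HasWeakDeriv.ae_const (h : HasWeakDeriv f fun _ => 0) :
    ∃ z : ℂ, f =ᵐ[volume] fun _ => z := by
  let b : ContDiffBump (0 : ℝ) := ⟨1, 2, one_pos, one_lt_two⟩
  let η₀ : ℝ → ℝ := b.normed volume
  have h0 : ContDiff ℝ ∞ η₀ := b.contDiff_normed
  have h0c : HasCompactSupport η₀ := b.hasCompactSupport_normed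
  have h0i : ∫ x, η₀ x = 1 := b.integral_normed
  refine ⟨∫ x, η₀ x • f x, ae_eq_of_integral_contDiff_smul_eq h.1
    (locallyIntegrable_const _) fun η hη hc => ?_⟩
  set m := ∫ x, η x with hm
  -- the difference of `η` and `m η₀` has integral zero, hence a compactly supported primitive
  let φ : ℝ → ℝ := fun x => η x - m * η₀ x
  have hφ : ContDiff ℝ ∞ φ := hη.sub (contDiff_const.mul h0)
  have hφc : HasCompactSupport φ := hc.sub h0c.mul_left
  have iη : Integrable η := hη.continuous.integrable_of_hasCompactSupport hc
  have i0 : Integrable η₀ := h0.continuous.integrable_of_hasCompactSupport h0c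
  have hφi : ∫ x, φ x = 0 := by
    change ∫ x, (η x - m * η₀ x) = 0
    rw [integral_sub iη (i0.const_mul m), integral_const_mul, h0i]
    simp [hm]
  obtain ⟨R, hR⟩ := hφc.isCompact.isBounded.subset_ball_lt 0 0
  have hφz : ∀ x, x ∉ Set.Ioo (-R) R → φ x = 0 := by
    intro x hx
    apply image_eq_zero_of_notMem_tsupport
    intro hx'
    have := hR.2 hx'
    rw [Real.ball_eq_Ioo] at this
    exact hx ⟨by linarith [this.1], by linarith [this.2]⟩
  let ζ : ℝ → ℝ := fun x => ∫ t in (-R)..x, φ t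
  have hζd : ∀ x, HasDerivAt ζ (φ x) x := fun x =>
    intervalIntegral.integral_hasDerivAt_right (hφ.continuous.intervalIntegrable _ _)
      (hφ.continuous.stronglyMeasurableAtFilter _ _) hφ.continuous.continuousAt
  have hζ' : deriv ζ = φ := funext fun x => (hζd x).deriv
  have hζ : ContDiff ℝ ∞ ζ := by
    rw [contDiff_infty_iff_deriv]
    exact ⟨fun x => (hζd x).differentiableAt, hζ' ▸ hφ⟩
  have hζc : HasCompactSupport ζ := by
    refine HasCompactSupport.intro (isCompact_Icc (a := -R) (b := R)) fun x hx => ?_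
    rcases lt_or_ge x (-R) with hlt | hge
    · change ∫ t in (-R)..x, φ t = 0
      rw [intervalIntegral.integral_symm, neg_eq_zero]
      apply intervalIntegral.integral_zero_ae
      refine Filter.Eventually.of_forall fun t ht => hφz t fun ht' => ?_
      rw [Set.uIoc_of_le hlt.le] at ht
      exact absurd ht'.1 (not_lt.2 ht.2)
    · have hx' : R < x := by
        by_contra hcon
        exact hx ⟨hge, not_lt.1 hcon⟩
      change ∫ t in (-R)..x, φ t = 0
      rw [← hφi]
      apply intervalIntegral.integral_eq_integral_of_support_subset
      intro t ht
      by_contra ht'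
      exact ht (hφz t fun ht'' => ht' ⟨ht''.1, by linarith [ht''.2]⟩)
  have key := h.2.2 ζ hζ hζc
  rw [hζ'] at key
  simp only [smul_zero, integral_zero, neg_zero] at key
  have I1 : Integrable fun x => η x • f x :=
    h.1.integrable_smul_left_of_hasCompactSupport hη.continuous hc
  have I2 : Integrable fun x => η₀ x • f x :=
    h.1.integrable_smul_left_of_hasCompactSupport h0.continuous h0c
  have e : ∫ x, φ x • f x = (∫ x, η x • f x) - m • ∫ x, η₀ x • f x := by
    rw [← integral_smul]
    refine Eq.trans ?_ (integral_sub I1 (I2.smul m))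
    congr 1
    ext x
    simp only [φ, sub_smul, mul_smul]
  rw [e, sub_eq_zero] at key
  rw [key, integral_smul_const]

/-- A function with a weak derivative `g` agrees almost everywhere with a primitive of `g`. -/
theorem HasWeakDeriv.exists_primitive (h : HasWeakDeriv f g) :
    ∃ u : ℝ → ℂ, f =ᵐ[volume] u ∧ ∀ x, u x = u 0 + ∫ t in (0:ℝ)..x, g t := by
  have hF : HasWeakDeriv (fun x => ∫ t in (0:ℝ)..x, g t) g :=
    HasWeakDeriv.of_primitive h.2.1 (by simp)
  have hd := h.add (hF.const_mul (-1))
  obtain ⟨z, hz⟩ := HasWeakDeriv.ae_const (hd.congr (f' := _) (g' := fun _ => 0)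
    Filter.EventuallyEq.rfl (Filter.Eventually.of_forall fun x => by simp))
  refine ⟨fun x => z + ∫ t in (0:ℝ)..x, g t, ?_, by simp⟩
  filter_upwards [hz] with x hx
  rw [← hx]
  ring

theorem HasWeakDeriv.of_hasDerivAt (hu : ∀ x, HasDerivAt u (g x) x) (hg : Continuous g) :
    HasWeakDeriv u g :=
  HasWeakDeriv.of_primitive hg.locallyIntegrable fun x => by
    rw [intervalIntegral.integral_eq_sub_of_hasDerivAt (fun x _ => hu x)
      (hg.intervalIntegrable _ _)]
    ring

end WeakDerivatives

/-! ### The space `X` and continuous representatives -/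

section SpaceX

open Filter Set

variable {σ ω c : ℝ} {ψ χ h : Fn} {u f : ℝ → ℂ}

theorem Admissible.nonneg (hωc : Admissible ω c) : 0 ≤ ω - c ^ 2 / 4 := by
  rcases hωc with h | h <;> linarith [h]

theorem two_le_exponent (hσ : 1 ≤ σ) : 2 ≤ exponent σ ω c := by
  unfold exponent
  split_ifs
  · exact le_rfl
  · rw [show (2 : ENNReal) = ENNReal.ofReal 2 by simp]
    exact ENNReal.ofReal_le_ofReal (by linarith)

theorem one_le_exponent (hσ : 1 ≤ σ) : 1 ≤ exponent σ ω c :=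
  le_trans one_le_two (two_le_exponent hσ)

theorem exponent_ne_zero (hσ : 1 ≤ σ) : exponent σ ω c ≠ 0 :=
  (lt_of_lt_of_le zero_lt_one (one_le_exponent hσ)).ne'

theorem exponent_ne_top : exponent σ ω c ≠ ⊤ := by
  unfold exponent
  split_ifs <;> simp

theorem exponent_toReal_le (hσ : 1 ≤ σ) : (exponent σ ω c).toReal ≤ 2 * σ + 2 := by
  unfold exponent
  split_ifs
  · simp; linarith
  · rw [ENNReal.toReal_ofReal (by linarith)]

theorem exponent_toReal_pos (hσ : 1 ≤ σ) : 0 < (exponent σ ω c).toReal :=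
  ENNReal.toReal_pos (exponent_ne_zero hσ) exponent_ne_top

theorem X_memLp (hψ : ψ ∈ X σ ω c) : MemLp ψ (exponent σ ω c) volume := hψ.1

theorem X_hasWeakDeriv (hψ : ψ ∈ X σ ω c) : HasWeakDeriv ψ (weakDeriv ψ) := by
  obtain ⟨_, g, hg, _⟩ := hψ
  rw [hg.weakDeriv_eq]
  exact hg

theorem X_memLp_weakDeriv (hψ : ψ ∈ X σ ω c) : MemLp (weakDeriv ψ) 2 volume := by
  obtain ⟨_, g, hg, h2⟩ := hψ
  rwa [hg.weakDeriv_eq]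

theorem normX_nonneg : 0 ≤ normX σ ω c ψ := by
  unfold normX; positivity

/-- `u` is the continuous representative of `ψ`, recovered from the weak derivative. -/
structure IsRep (ψ : Fn) (u : ℝ → ℂ) : Prop where
  ae_eq : ψ =ᵐ[volume] u
  loc : LocallyIntegrable (weakDeriv ψ) volume
  primitive : ∀ x, u x = u 0 + ∫ t in (0:ℝ)..x, weakDeriv ψ t

theorem X_exists_rep (hψ : ψ ∈ X σ ω c) : ∃ u, IsRep ψ u := by
  obtain ⟨u, hu, hp⟩ := (X_hasWeakDeriv hψ).exists_primitive
  exact ⟨u, hu, (X_hasWeakDeriv hψ).2.1, hp⟩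

theorem IsRep.continuous (hu : IsRep ψ u) : Continuous u :=
  continuous_of_primitive hu.loc hu.primitive

theorem IsRep.sub_eq (hu : IsRep ψ u) (a b : ℝ) :
    u b - u a = ∫ t in a..b, weakDeriv ψ t := by
  rw [hu.primitive b, hu.primitive a, add_sub_add_left_eq_sub,
    intervalIntegral.integral_interval_sub_left
      (intervalIntegrable_of_locallyIntegrable hu.loc _ _)
      (intervalIntegrable_of_locallyIntegrable hu.loc _ _)]

theorem eq_of_weakDeriv {g : ℝ → ℂ} {G : Fn} (h : HasWeakDeriv ψ g) (hG : G =ᵐ[volume] g) :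
    weakDeriv ψ = G :=
  IsWeakDeriv.weakDeriv_eq (h.congr EventuallyEq.rfl hG.symm)

/-- On an interval of unit length the mean is controlled by any `L^p` norm. -/
theorem integral_norm_le_eLpNorm {p : ENNReal} (hp : 1 ≤ p) (hf : MemLp f p volume) (x : ℝ) :
    ∫ t in x..(x + 1), ‖f t‖ ≤ (eLpNorm f p (volume.restrict (Ioc x (x + 1)))).toReal := by
  have : IsProbabilityMeasure (volume.restrict (Ioc x (x + 1))) := ⟨by simp⟩
  rw [intervalIntegral.integral_of_le (by linarith),
    integral_norm_eq_lintegral_enorm hf.1.restrict, ← eLpNorm_one_eq_lintegral_enorm]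
  exact ENNReal.toReal_mono (hf.restrict _).eLpNorm_ne_top
    (eLpNorm_le_eLpNorm_of_exponent_le hp hf.1.restrict)

theorem IsRep.norm_le_add (hu : IsRep ψ u) (x : ℝ) :
    ‖u x‖ ≤ (∫ t in x..(x + 1), ‖ψ t‖) + ∫ t in x..(x + 1), ‖weakDeriv ψ t‖ := by
  have hx : x ≤ x + 1 := by linarith
  have hint : ∀ a b, IntervalIntegrable (fun t => ‖weakDeriv ψ t‖) volume a b := fun a b =>
    (intervalIntegrable_of_locallyIntegrable hu.loc a b).norm
  have e : ∫ t in x..(x + 1), ‖ψ t‖ = ∫ t in x..(x + 1), ‖u t‖ :=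
    intervalIntegral.integral_congr_ae (by
      filter_upwards [hu.ae_eq] with t ht _
      rw [ht])
  set D := ∫ t in x..(x + 1), ‖weakDeriv ψ t‖ with hD
  have hb : ∀ y ∈ Icc x (x + 1), ‖u x‖ - D ≤ ‖u y‖ := by
    intro y hy
    have h1 : ‖u y - u x‖ ≤ D := by
      rw [hu.sub_eq]
      refine (intervalIntegral.norm_integral_le_integral_norm hy.1).trans ?_
      rw [hD]
      exact intervalIntegral.integral_mono_interval le_rfl hy.1 hy.2
        (Eventually.of_forall fun t => norm_nonneg _) (hint _ _)
    have h2 : ‖u x‖ ≤ ‖u y‖ + ‖u y - u x‖ := by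
      have := norm_sub_le (u y) (u y - u x)
      rwa [sub_sub_cancel] at this
    linarith
  have h3 : ∫ _ in x..(x + 1), (‖u x‖ - D) ≤ ∫ t in x..(x + 1), ‖u t‖ :=
    intervalIntegral.integral_mono_on hx intervalIntegrable_const
      (hu.continuous.norm.intervalIntegrable _ _) hb
  rw [intervalIntegral.integral_const, smul_eq_mul] at h3
  rw [e]
  linarith

/-- The embedding of `X` in the bounded functions, with constant `1`. -/
theorem norm_le_normX (hσ : 1 ≤ σ) (hψ : ψ ∈ X σ ω c) (hu : IsRep ψ u) (x : ℝ) :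
    ‖u x‖ ≤ normX σ ω c ψ := by
  have key : ∀ {p : ENNReal} {f : ℝ → ℂ}, 1 ≤ p → MemLp f p volume →
      ∫ t in x..(x + 1), ‖f t‖ ≤ (eLpNorm f p volume).toReal := fun hp hf =>
    (integral_norm_le_eLpNorm hp hf x).trans
      (ENNReal.toReal_mono hf.eLpNorm_ne_top (eLpNorm_mono_measure _ Measure.restrict_le_self))
  have h1 := key (one_le_exponent hσ) (X_memLp hψ)
  have h2 := key one_le_two (X_memLp_weakDeriv hψ)
  have h3 := hu.norm_le_add x
  unfold normX
  linarith

theorem tendsto_integral_Ioc_cocompact {k : ℝ → ℝ} (hk : Integrable k) :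
    Tendsto (fun x => ∫ t in Ioc x (x + 1), k t) (cocompact ℝ) (𝓝 0) := by
  have e : ∀ x, ∫ t in Ioc x (x + 1), k t
      = (∫ t in (0:ℝ)..(x + 1), k t) - ∫ t in (0:ℝ)..x, k t := by
    intro x
    rw [← intervalIntegral.integral_of_le (by linarith),
      intervalIntegral.integral_interval_sub_left hk.intervalIntegrable hk.intervalIntegrable]
  simp only [e]
  rw [cocompact_eq_atBot_atTop, tendsto_sup]
  constructor
  · have h1 : Tendsto (fun x => ∫ t in (0:ℝ)..x, k t) atBot (𝓝 (-∫ t in Iic 0, k t)) := by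
      have := (intervalIntegral_tendsto_integral_Iic 0 hk.integrableOn
        (tendsto_id (α := ℝ) (x := atBot))).neg
      refine this.congr fun x => ?_
      rw [intervalIntegral.integral_symm]
      simp
    simpa using (h1.comp (tendsto_atBot_add_const_right _ 1 tendsto_id)).sub h1
  · have h1 := intervalIntegral_tendsto_integral_Ioi 0 hk.integrableOn
      (tendsto_id (α := ℝ) (x := atTop))
    simpa using (h1.comp (tendsto_atTop_add_const_right _ 1 tendsto_id)).sub h1

theorem tendsto_integral_norm_cocompact {p : ENNReal} (hp : 1 ≤ p) (hp' : p ≠ ⊤)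
    (hf : MemLp f p volume) :
    Tendsto (fun x => ∫ t in x..(x + 1), ‖f t‖) (cocompact ℝ) (𝓝 0) := by
  have hp0 : p ≠ 0 := (lt_of_lt_of_le zero_lt_one hp).ne'
  have hpos : 0 < p.toReal := ENNReal.toReal_pos hp0 hp'
  have h1 := tendsto_integral_Ioc_cocompact (hf.integrable_norm_rpow hp0 hp')
  have h2 : Tendsto (fun x => (∫ t in Ioc x (x + 1), ‖f t‖ ^ p.toReal) ^ p.toReal⁻¹)
      (cocompact ℝ) (𝓝 0) := by
    have := h1.rpow_const (p := p.toReal⁻¹) (Or.inr (by positivity))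
    rwa [Real.zero_rpow (by positivity)] at this
  refine squeeze_zero (fun x => ?_) (fun x => ?_) h2
  · exact intervalIntegral.integral_nonneg (by linarith) fun t _ => norm_nonneg _
  · refine (integral_norm_le_eLpNorm hp hf x).trans (le_of_eq ?_)
    rw [(hf.restrict _).eLpNorm_eq_integral_rpow_norm hp0 hp', ENNReal.toReal_ofReal]
    positivity

/-- Functions in `X` vanish at infinity: the mean of `‖ψ‖` and the integral of `‖∂ₓψ‖` over an
interval of unit length do, and bound the function. -/
theorem IsRep.tendsto_zero (hσ : 1 ≤ σ) (hψ : ψ ∈ X σ ω c) (hu : IsRep ψ u) :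
    Tendsto u (cocompact ℝ) (𝓝 0) := by
  rw [tendsto_zero_iff_norm_tendsto_zero]
  have h1 := tendsto_integral_norm_cocompact (one_le_exponent hσ) exponent_ne_top (X_memLp hψ)
  have h2 := tendsto_integral_norm_cocompact one_le_two (by simp) (X_memLp_weakDeriv hψ)
  exact squeeze_zero (fun x => norm_nonneg _) hu.norm_le_add (by simpa using h1.add h2)

theorem IsRep.exists_ne_zero (hu : IsRep ψ u) (h0 : ψ ≠ 0) : ∃ x, u x ≠ 0 := by
  by_contra hcon
  push Not at hcon
  apply h0
  apply AEEqFun.ext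
  filter_upwards [hu.ae_eq, AEEqFun.coeFn_zero (α := ℝ) (β := ℂ) (μ := volume)] with x h1 h2
  rw [h1, h2, hcon]
  rfl

theorem IsRep.exists_max (hσ : 1 ≤ σ) (hψ : ψ ∈ X σ ω c) (h0 : ψ ≠ 0) (hu : IsRep ψ u) :
    ∃ x₀, 0 < ‖u x₀‖ ∧ ∀ x, ‖u x‖ ≤ ‖u x₀‖ := by
  obtain ⟨y, hy⟩ := hu.exists_ne_zero h0
  have hy' : 0 < ‖u y‖ := norm_pos_iff.2 hy
  have ht := (hu.tendsto_zero hσ hψ).norm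
  rw [norm_zero] at ht
  obtain ⟨x₀, hx₀⟩ := hu.continuous.norm.exists_forall_ge' y
    ((ht.eventually (gt_mem_nhds hy')).mono fun x hx => hx.le)
  exact ⟨x₀, hy'.trans_le (hx₀ y), hx₀⟩

theorem ae_norm_le_normX (hσ : 1 ≤ σ) (hψ : ψ ∈ X σ ω c) :
    ∀ᵐ x, ‖ψ x‖ ≤ normX σ ω c ψ := by
  obtain ⟨u, hu⟩ := X_exists_rep hψ
  filter_upwards [hu.ae_eq] with x hx
  rw [hx]
  exact norm_le_normX hσ hψ hu x

theorem integral_rpow_eq_eLpNorm {p : ENNReal} (hp0 : p ≠ 0) (hp' : p ≠ ⊤)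
    (hf : MemLp f p volume) :
    ∫ x, ‖f x‖ ^ p.toReal = (eLpNorm f p volume).toReal ^ p.toReal := by
  have hpos : 0 < p.toReal := ENNReal.toReal_pos hp0 hp'
  rw [hf.eLpNorm_eq_integral_rpow_norm hp0 hp', ENNReal.toReal_ofReal (by positivity),
    ← Real.rpow_mul (by positivity), inv_mul_cancel₀ hpos.ne', Real.rpow_one]

/-- Functions in `X` are `s`-integrable for all `s ≥ 2σ + 2`, with norm controlled by that
of `X`. -/
theorem X_rpow (hσ : 1 ≤ σ) (hψ : ψ ∈ X σ ω c) {s : ℝ} (hs : 2 * σ + 2 ≤ s) :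
    Integrable (fun x => ‖ψ x‖ ^ s) ∧ ∫ x, ‖ψ x‖ ^ s ≤ normX σ ω c ψ ^ s := by
  set q := (exponent σ ω c).toReal with hq
  have hq0 : 0 < q := exponent_toReal_pos hσ
  have hqs : q ≤ s := (exponent_toReal_le hσ).trans hs
  set N := normX σ ω c ψ with hN
  have hN0 : 0 ≤ N := normX_nonneg
  have hI := (X_memLp hψ).integrable_norm_rpow (exponent_ne_zero hσ) exponent_ne_top
  have hb : ∀ᵐ x, ‖ψ x‖ ^ s ≤ N ^ (s - q) * ‖ψ x‖ ^ q := by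
    filter_upwards [ae_norm_le_normX hσ hψ] with x hx
    have e : ‖ψ x‖ ^ s = ‖ψ x‖ ^ (s - q) * ‖ψ x‖ ^ q := by
      rw [← Real.rpow_add_of_nonneg (norm_nonneg _) (by linarith) hq0.le, sub_add_cancel]
    rw [e]
    have := Real.rpow_le_rpow (norm_nonneg _) hx (sub_nonneg.2 hqs)
    gcongr
  have hm : AEStronglyMeasurable (fun x => ‖ψ x‖ ^ s) volume :=
    (Real.continuous_rpow_const (by linarith)).comp_aestronglyMeasurable
      (X_memLp hψ).1.norm
  have hI2 : Integrable (fun x => ‖ψ x‖ ^ s) :=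
    (hI.const_mul (N ^ (s - q))).mono' hm (by
      filter_upwards [hb] with x hx
      rwa [Real.norm_of_nonneg (by positivity)])
  refine ⟨hI2, ?_⟩
  calc ∫ x, ‖ψ x‖ ^ s ≤ ∫ x, N ^ (s - q) * ‖ψ x‖ ^ q :=
        integral_mono_ae hI2 (hI.const_mul _) hb
    _ = N ^ (s - q) * (eLpNorm ψ (exponent σ ω c) volume).toReal ^ q := by
        rw [integral_const_mul, hq,
          integral_rpow_eq_eLpNorm (exponent_ne_zero hσ) exponent_ne_top (X_memLp hψ)]
    _ ≤ N ^ (s - q) * N ^ q := by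
        have : (eLpNorm ψ (exponent σ ω c) volume).toReal ≤ N := by
          rw [hN]; unfold normX
          linarith [ENNReal.toReal_nonneg (a := eLpNorm (weakDeriv ψ) 2 volume)]
        gcongr
    _ = N ^ s := by
        rw [← Real.rpow_add_of_nonneg hN0 (by linarith) hq0.le, sub_add_cancel]

theorem sq_integrable_of_memLp (hf : MemLp f 2 volume) :
    Integrable (fun x => ‖f x‖ ^ 2) ∧
      ∫ x, ‖f x‖ ^ 2 = (eLpNorm f 2 volume).toReal ^ 2 := by
  have h1 := hf.integrable_norm_rpow (by simp) (by simp)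
  have h2 := integral_rpow_eq_eLpNorm (by simp) (by simp) hf
  simpa using And.intro h1 h2

theorem X_grad (hψ : ψ ∈ X σ ω c) :
    Integrable (fun x => ‖weakDeriv ψ x‖ ^ 2) ∧
      ∫ x, ‖weakDeriv ψ x‖ ^ 2 ≤ normX σ ω c ψ ^ 2 := by
  obtain ⟨h1, h2⟩ := sq_integrable_of_memLp (X_memLp_weakDeriv hψ)
  refine ⟨h1, h2.le.trans ?_⟩
  unfold normX
  gcongr
  linarith [ENNReal.toReal_nonneg (a := eLpNorm ψ (exponent σ ω c) volume)]

/-- In the massless case the coefficient vanishes, and the claim holds although `‖ψ‖²` need not be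
integrable. -/
theorem X_mass (hωc : Admissible ω c) (hψ : ψ ∈ X σ ω c) :
    Integrable (fun x => (ω - c ^ 2 / 4) * ‖ψ x‖ ^ 2) ∧
      ∫ x, (ω - c ^ 2 / 4) * ‖ψ x‖ ^ 2 ≤ (ω - c ^ 2 / 4) * normX σ ω c ψ ^ 2 := by
  rcases hωc with hlt | ⟨heq, -⟩
  · have hm := X_memLp hψ
    have he : exponent σ ω c = 2 := if_pos hlt
    rw [he] at hm
    obtain ⟨h1, h2⟩ := sq_integrable_of_memLp hm
    refine ⟨h1.const_mul _, ?_⟩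
    rw [integral_const_mul, h2]
    have : (eLpNorm ψ 2 volume).toReal ≤ normX σ ω c ψ := by
      unfold normX
      rw [he]
      linarith [ENNReal.toReal_nonneg (a := eLpNorm (weakDeriv ψ) 2 volume)]
    have h0 : 0 ≤ ω - c ^ 2 / 4 := by linarith
    gcongr
  · simp [heq]

theorem X_add (hψ : ψ ∈ X σ ω c) (hχ : χ ∈ X σ ω c) :
    ψ + χ ∈ X σ ω c ∧ weakDeriv (ψ + χ) = weakDeriv ψ + weakDeriv χ := by
  have hw : HasWeakDeriv (ψ + χ : Fn) (weakDeriv ψ + weakDeriv χ : Fn) :=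
    ((X_hasWeakDeriv hψ).add (X_hasWeakDeriv hχ)).congr
      (AEEqFun.coeFn_add ψ χ).symm (AEEqFun.coeFn_add _ _).symm
  refine ⟨⟨?_, _, hw, ?_⟩, IsWeakDeriv.weakDeriv_eq hw⟩
  · exact ((X_memLp hψ).add (X_memLp hχ)).ae_eq (AEEqFun.coeFn_add ψ χ).symm
  · exact ((X_memLp_weakDeriv hψ).add (X_memLp_weakDeriv hχ)).ae_eq
      (AEEqFun.coeFn_add _ _).symm

theorem X_smul (hψ : ψ ∈ X σ ω c) (t : ℝ) :
    t • ψ ∈ X σ ω c ∧ weakDeriv (t • ψ) = t • weakDeriv ψ := by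
  have hw : HasWeakDeriv (t • ψ : Fn) (t • weakDeriv ψ : Fn) :=
    ((X_hasWeakDeriv hψ).const_mul t).congr
      (by filter_upwards [AEEqFun.coeFn_smul t ψ] with x hx; rw [hx]; simp)
      (by filter_upwards [AEEqFun.coeFn_smul t (weakDeriv ψ)] with x hx; rw [hx]; simp)
  refine ⟨⟨?_, _, hw, ?_⟩, IsWeakDeriv.weakDeriv_eq hw⟩
  · exact ((X_memLp hψ).const_smul t).ae_eq (AEEqFun.coeFn_smul t ψ).symm
  · exact ((X_memLp_weakDeriv hψ).const_smul t).ae_eq (AEEqFun.coeFn_smul t _).symm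

theorem normX_smul (hψ : ψ ∈ X σ ω c) (t : ℝ) :
    normX σ ω c (t • ψ) = |t| * normX σ ω c ψ := by
  unfold normX
  rw [(X_smul hψ t).2, eLpNorm_congr_ae (AEEqFun.coeFn_smul t ψ),
    eLpNorm_congr_ae (AEEqFun.coeFn_smul t (weakDeriv ψ)), eLpNorm_const_smul,
    eLpNorm_const_smul, ENNReal.toReal_mul, ENNReal.toReal_mul]
  simp
  ring

theorem eq_zero_of_normX (hσ : 1 ≤ σ) (hψ : ψ ∈ X σ ω c) (h0 : normX σ ω c ψ = 0) : ψ = 0 := by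
  apply AEEqFun.ext
  filter_upwards [ae_norm_le_normX hσ hψ, AEEqFun.coeFn_zero (α := ℝ) (β := ℂ) (μ := volume)]
    with x h1 h2
  rw [h2, Pi.zero_apply, ← norm_le_zero_iff]
  simpa [h0] using h1

end SpaceX

/-! ### The functionals, their scaling, and the gauge transformation -/

section Functionals

open Filter Set

variable {σ ω c α β l : ℝ} {ψ χ φ : Fn} {u : ℝ → ℂ}

/-- Minus the density of the nonlinear term. -/
noncomputable def nlDens (σ : ℝ) (z w : ℂ) : ℝ := ‖z‖ ^ (2 * σ) * ((starRingEnd ℂ) z * w).im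

/-- The Dirichlet integral `‖∂ₓψ‖²` in `L²`. -/
noncomputable def gradI (ψ : Fn) : ℝ := ∫ x, ‖weakDeriv ψ x‖ ^ 2

/-- The mass term of the action. The coefficient stands inside the integral so that the integrand
is integrable in the massless case as well. -/
noncomputable def massI (ω c : ℝ) (ψ : Fn) : ℝ := ∫ x, (ω - c ^ 2 / 4) * ‖ψ x‖ ^ 2

/-- The integral of `‖ψ‖ ^ (2σ + 2)`. -/
noncomputable def powI (σ : ℝ) (ψ : Fn) : ℝ := ∫ x, ‖ψ x‖ ^ (2 * σ + 2)

theorem actionTilde_eq (σ ω c : ℝ) (ψ : Fn) : actionTilde σ ω c ψ =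
    1 / 2 * gradI ψ + 1 / 2 * massI ω c ψ + c / (2 * (2 * σ + 2)) * powI σ ψ
      - 1 / (2 * σ + 2) * nonlin σ ψ := by
  unfold actionTilde gradI massI powI
  rw [integral_const_mul]
  ring

theorem abs_nlDens_le (hσ : 1 ≤ σ) (z w : ℂ) : |nlDens σ z w| ≤ ‖z‖ ^ (4 * σ + 2) + ‖w‖ ^ 2 := by
  unfold nlDens
  have h1 : |((starRingEnd ℂ) z * w).im| ≤ ‖z‖ * ‖w‖ := by
    refine (Complex.abs_im_le_norm _).trans ?_
    simp
  have e1 : ‖z‖ ^ (4 * σ + 2) = (‖z‖ ^ (2 * σ) * ‖z‖) ^ 2 := by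
    rw [mul_pow, ← Real.rpow_mul_natCast (norm_nonneg z), ← Real.rpow_natCast ‖z‖ 2,
      ← Real.rpow_add_of_nonneg (norm_nonneg z) (by positivity) (by positivity)]
    congr 1
    push_cast
    ring
  have h2 : 0 ≤ ‖z‖ ^ (2 * σ) := by positivity
  rw [abs_mul, abs_of_nonneg h2, e1]
  calc ‖z‖ ^ (2 * σ) * |((starRingEnd ℂ) z * w).im| ≤ ‖z‖ ^ (2 * σ) * (‖z‖ * ‖w‖) := by gcongr
    _ ≤ _ := by nlinarith [sq_nonneg (‖z‖ ^ (2 * σ) * ‖z‖ - ‖w‖), sq_nonneg (‖z‖ ^ (2 * σ) * ‖z‖),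
        sq_nonneg ‖w‖]

theorem re_density (σ : ℝ) (z w : ℂ) :
    (Complex.I * ((‖z‖ ^ (2 * σ) : ℝ) : ℂ) * (starRingEnd ℂ) z * w).re = -nlDens σ z w := by
  unfold nlDens
  rw [mul_assoc, mul_assoc, Complex.I_mul_re, Complex.im_ofReal_mul]

theorem aestronglyMeasurable_nl (hσ : 1 ≤ σ) {f g : ℝ → ℂ} (hf : AEStronglyMeasurable f volume)
    (hg : AEStronglyMeasurable g volume) : AEStronglyMeasurable (fun x =>
      Complex.I * ((‖f x‖ ^ (2 * σ) : ℝ) : ℂ) * (starRingEnd ℂ) (f x) * g x) volume := by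
  have h1 : AEStronglyMeasurable (fun x => ((‖f x‖ ^ (2 * σ) : ℝ) : ℂ)) volume :=
    (Complex.continuous_ofReal.comp
      (Real.continuous_rpow_const (by linarith))).comp_aestronglyMeasurable hf.norm
  have h2 : AEStronglyMeasurable (fun x => (starRingEnd ℂ) (f x)) volume :=
    Complex.continuous_conj.comp_aestronglyMeasurable hf
  exact ((h1.const_mul Complex.I).mul h2).mul hg

theorem X_nl_integrable (hσ : 1 ≤ σ) (hψ : ψ ∈ X σ ω c) :
    Integrable fun x =>
      Complex.I * ((‖ψ x‖ ^ (2 * σ) : ℝ) : ℂ) * (starRingEnd ℂ) (ψ x) * weakDeriv ψ x := by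
  refine ((X_rpow hσ hψ (s := 4 * σ + 2) (by linarith)).1.add (X_grad hψ).1).mono'
    (aestronglyMeasurable_nl hσ (X_memLp hψ).1 (X_memLp_weakDeriv hψ).1)
    (Eventually.of_forall fun x => ?_)
  -- multiply the derivative by a phase so that the modulus becomes an imaginary part
  have e1 : ‖ψ x‖ ^ (4 * σ + 2) = (‖ψ x‖ ^ (2 * σ) * ‖ψ x‖) ^ 2 := by
    rw [mul_pow, ← Real.rpow_mul_natCast (norm_nonneg _), ← Real.rpow_natCast ‖ψ x‖ 2,
      ← Real.rpow_add_of_nonneg (norm_nonneg _) (by positivity) (by positivity)]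
    congr 1
    push_cast
    ring
  simp only [norm_mul, Complex.norm_I, one_mul, Pi.add_apply, RCLike.norm_conj, Complex.norm_real]
  rw [e1, Real.norm_of_nonneg (by positivity)]
  nlinarith [sq_nonneg (‖ψ x‖ ^ (2 * σ) * ‖ψ x‖ - ‖weakDeriv ψ x‖),
    sq_nonneg (‖ψ x‖ ^ (2 * σ) * ‖ψ x‖), sq_nonneg ‖weakDeriv ψ x‖]

theorem X_nlDens (hσ : 1 ≤ σ) (hψ : ψ ∈ X σ ω c) :
    Integrable (fun x => nlDens σ (ψ x) (weakDeriv ψ x)) ∧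
      nonlin σ ψ = -∫ x, nlDens σ (ψ x) (weakDeriv ψ x) := by
  have h := X_nl_integrable hσ hψ
  have h1 := h.re
  have h2 := integral_re h
  simp only [RCLike.re_eq_complex_re, re_density] at h1 h2
  refine ⟨by simpa using h1.neg, ?_⟩
  unfold nonlin
  rw [← h2, integral_neg]

/-! Scaling -/

theorem coeFn_scale (α β l : ℝ) (ψ : Fn) :
    scale α β l ψ =ᵐ[volume]
      fun x => (Real.exp (α * l) : ℂ) * ψ (Real.exp (-(β * l)) * x) :=
  AEEqFun.coeFn_mk _ _

theorem ae_comp_mul_left {b : ℝ} (hb : b ≠ 0) {p : ℝ → Prop} (h : ∀ᵐ x, p x) :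
    ∀ᵐ x, p (b * x) := by
  have hq : Measure.QuasiMeasurePreserving (fun x : ℝ => b * x) volume volume := by
    refine ⟨measurable_const_mul b, ?_⟩
    rw [Real.map_volume_mul_left hb]
    exact Measure.smul_absolutelyContinuous
  exact hq.ae h

theorem memLp_comp_mul_left {f : ℝ → ℂ} {p : ENNReal} (hf : MemLp f p volume) {b : ℝ}
    (hb : b ≠ 0) : MemLp (fun x => f (b * x)) p volume := by
  have h1 : MemLp f p (Measure.map (fun x : ℝ => b * x) volume) := by
    rw [Real.map_volume_mul_left hb]
    exact hf.smul_measure ENNReal.ofReal_ne_top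
  exact h1.comp_of_map (measurable_const_mul b).aemeasurable

theorem scale_hasWeakDeriv (hψ : HasWeakDeriv ψ (weakDeriv ψ)) :
    HasWeakDeriv (scale α β l ψ) fun x =>
      (Real.exp (α * l) : ℂ) * (Real.exp (-(β * l)) * weakDeriv ψ (Real.exp (-(β * l)) * x)) :=
  ((hψ.comp_mul_left (Real.exp_pos (-(β * l)))).const_mul _).congr (coeFn_scale α β l ψ).symm
    EventuallyEq.rfl

theorem weakDeriv_scale (hψ : HasWeakDeriv ψ (weakDeriv ψ)) :
    weakDeriv (scale α β l ψ) =ᵐ[volume] fun x =>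
      (Real.exp (α * l) : ℂ) *
        (Real.exp (-(β * l)) * weakDeriv ψ (Real.exp (-(β * l)) * x)) := by
  have h := scale_hasWeakDeriv (α := α) (β := β) (l := l) hψ
  have hm := h.2.1.aestronglyMeasurable
  rw [eq_of_weakDeriv h (AEEqFun.coeFn_mk _ hm)]
  exact AEEqFun.coeFn_mk _ hm

theorem scale_mem_X (hψ : ψ ∈ X σ ω c) : scale α β l ψ ∈ X σ ω c := by
  have h := scale_hasWeakDeriv (α := α) (β := β) (l := l) (X_hasWeakDeriv hψ)
  have hb := (Real.exp_pos (-(β * l))).ne'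
  refine ⟨((memLp_comp_mul_left (X_memLp hψ) hb).const_mul _).ae_eq (coeFn_scale α β l ψ).symm,
    weakDeriv (scale α β l ψ), ?_, ?_⟩
  · exact h.congr EventuallyEq.rfl (weakDeriv_scale (X_hasWeakDeriv hψ)).symm
  · exact (((memLp_comp_mul_left (X_memLp_weakDeriv hψ) hb).const_mul _).const_mul _).ae_eq
      (weakDeriv_scale (X_hasWeakDeriv hψ)).symm

theorem IsRep.scale (hψ : ψ ∈ X σ ω c) (hu : IsRep ψ u) : ∃ v, IsRep (scale α β l ψ) v ∧
    ∀ x, v x = (Real.exp (α * l) : ℂ) * u (Real.exp (-(β * l)) * x) := by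
  obtain ⟨v, hv⟩ := X_exists_rep (scale_mem_X (α := α) (β := β) (l := l) hψ)
  refine ⟨v, hv, fun x => ?_⟩
  have hc : Continuous fun x => (Real.exp (α * l) : ℂ) * u (Real.exp (-(β * l)) * x) :=
    continuous_const.mul (hu.continuous.comp (continuous_const_mul _))
  refine congrFun (Measure.eq_of_ae_eq (μ := volume) ?_ hv.continuous hc) x
  filter_upwards [hv.ae_eq, coeFn_scale α β l ψ,
    ae_comp_mul_left (Real.exp_pos (-(β * l))).ne' hu.ae_eq] with x h1 h2 h3
  rw [← h1, h2, h3]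

theorem gradI_scale (hψ : HasWeakDeriv ψ (weakDeriv ψ)) :
    gradI (scale α β l ψ) = Real.exp ((2 * α - β) * l) * gradI ψ := by
  unfold gradI
  have e : ∫ x, ‖weakDeriv (scale α β l ψ) x‖ ^ 2 = ∫ x, (fun y => (Real.exp (α * l) *
      Real.exp (-(β * l))) ^ 2 * ‖weakDeriv ψ y‖ ^ 2) (Real.exp (-(β * l)) * x) := by
    refine integral_congr_ae ?_
    filter_upwards [weakDeriv_scale (α := α) (β := β) (l := l) hψ] with x hx
    rw [hx]
    simp only [norm_mul, Complex.norm_real, Real.norm_eq_abs, Real.abs_exp]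
    ring
  refine (e.trans (Measure.integral_comp_mul_left (fun y => (Real.exp (α * l) *
      Real.exp (-(β * l))) ^ 2 * ‖weakDeriv ψ y‖ ^ 2) _)).trans ?_
  rw [integral_const_mul, abs_of_pos (by positivity),
    smul_eq_mul, ← Real.exp_neg, ← Real.exp_add, ← Real.exp_nat_mul, ← mul_assoc, ← Real.exp_add]
  congr 2
  push_cast
  ring

theorem massI_scale : massI ω c (scale α β l ψ) = Real.exp ((2 * α + β) * l) * massI ω c ψ := by
  unfold massI
  have e : ∫ x, (ω - c ^ 2 / 4) * ‖scale α β l ψ x‖ ^ 2 = ∫ x, (fun y => (Real.exp (α * l)) ^ 2 *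
      ((ω - c ^ 2 / 4) * ‖ψ y‖ ^ 2)) (Real.exp (-(β * l)) * x) := by
    refine integral_congr_ae ?_
    filter_upwards [coeFn_scale α β l ψ] with x hx
    rw [hx]
    simp only [norm_mul, Complex.norm_real, Real.norm_eq_abs, Real.abs_exp]
    ring
  refine (e.trans (Measure.integral_comp_mul_left (fun y => (Real.exp (α * l)) ^ 2 *
      ((ω - c ^ 2 / 4) * ‖ψ y‖ ^ 2)) _)).trans ?_
  rw [integral_const_mul, abs_of_pos (by positivity),
    smul_eq_mul, ← Real.exp_neg, ← Real.exp_nat_mul, ← mul_assoc, ← Real.exp_add]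
  congr 2
  push_cast
  ring

theorem powI_scale :
    powI σ (scale α β l ψ) = Real.exp (((2 * σ + 2) * α + β) * l) * powI σ ψ := by
  unfold powI
  have e : ∫ x, ‖scale α β l ψ x‖ ^ (2 * σ + 2) = ∫ x, (fun y => Real.exp (α * l * (2 * σ + 2)) *
      ‖ψ y‖ ^ (2 * σ + 2)) (Real.exp (-(β * l)) * x) := by
    refine integral_congr_ae ?_
    filter_upwards [coeFn_scale α β l ψ] with x hx
    rw [hx]
    simp only [norm_mul, Complex.norm_real, Real.norm_eq_abs, Real.abs_exp]
    rw [Real.mul_rpow (Real.exp_pos _).le (norm_nonneg _), ← Real.exp_mul]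
  refine (e.trans (Measure.integral_comp_mul_left (fun y => Real.exp (α * l * (2 * σ + 2)) *
      ‖ψ y‖ ^ (2 * σ + 2)) _)).trans ?_
  rw [integral_const_mul, abs_of_pos (by positivity),
    smul_eq_mul, ← Real.exp_neg, ← mul_assoc, ← Real.exp_add]
  congr 2
  ring

theorem nonlin_scale (hψ : HasWeakDeriv ψ (weakDeriv ψ)) :
    nonlin σ (scale α β l ψ) = Real.exp ((2 * σ + 2) * α * l) * nonlin σ ψ := by
  unfold nonlin
  have e : ∫ x, Complex.I * ((‖scale α β l ψ x‖ ^ (2 * σ) : ℝ) : ℂ) *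
        (starRingEnd ℂ) (scale α β l ψ x) * weakDeriv (scale α β l ψ) x
      = ∫ x, (fun y => ((Real.exp (α * l * (2 * σ)) * Real.exp (α * l) * Real.exp (α * l) *
          Real.exp (-(β * l)) : ℝ) : ℂ) * (Complex.I * ((‖ψ y‖ ^ (2 * σ) : ℝ) : ℂ) *
          (starRingEnd ℂ) (ψ y) * weakDeriv ψ y)) (Real.exp (-(β * l)) * x) := by
    refine integral_congr_ae ?_
    filter_upwards [coeFn_scale α β l ψ, weakDeriv_scale (α := α) (β := β) (l := l) hψ]
      with x hx hx'
    rw [hx, hx']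
    simp only [norm_mul, Complex.norm_real, Real.norm_eq_abs, Real.abs_exp, map_mul,
      Complex.conj_ofReal]
    rw [Real.mul_rpow (Real.exp_pos _).le (norm_nonneg _), ← Real.exp_mul]
    push_cast
    ring
  refine (congrArg Complex.re (e.trans (Measure.integral_comp_mul_left (fun y =>
    ((Real.exp (α * l * (2 * σ)) * Real.exp (α * l) * Real.exp (α * l) *
          Real.exp (-(β * l)) : ℝ) : ℂ) * (Complex.I * ((‖ψ y‖ ^ (2 * σ) : ℝ) : ℂ) *
          (starRingEnd ℂ) (ψ y) * weakDeriv ψ y)) _))).trans ?_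
  rw [integral_const_mul, abs_of_pos (by positivity),
    Complex.real_smul, ← mul_assoc, ← Complex.ofReal_mul, Complex.re_ofReal_mul]
  congr 1
  rw [← Real.exp_neg, ← Real.exp_add, ← Real.exp_add, ← Real.exp_add, ← Real.exp_add]
  congr 1
  ring

theorem actionTilde_scale (hψ : HasWeakDeriv ψ (weakDeriv ψ)) (l : ℝ) :
    actionTilde σ ω c (scale α β l ψ) =
      Real.exp ((2 * α - β) * l) * (1 / 2 * gradI ψ)
        + Real.exp ((2 * α + β) * l) * (1 / 2 * massI ω c ψ)
        + Real.exp (((2 * σ + 2) * α + β) * l) * (c / (2 * (2 * σ + 2)) * powI σ ψ)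
        - Real.exp ((2 * σ + 2) * α * l) * (1 / (2 * σ + 2) * nonlin σ ψ) := by
  rw [actionTilde_eq, gradI_scale hψ, massI_scale, powI_scale, nonlin_scale hψ]
  ring

theorem hasDerivAt_actionTilde_scale (hψ : HasWeakDeriv ψ (weakDeriv ψ)) (l : ℝ) :
    HasDerivAt (fun l => actionTilde σ ω c (scale α β l ψ))
      (Real.exp ((2 * α - β) * l) * (2 * α - β) * (1 / 2 * gradI ψ)
        + Real.exp ((2 * α + β) * l) * (2 * α + β) * (1 / 2 * massI ω c ψ)
        + Real.exp (((2 * σ + 2) * α + β) * l) * ((2 * σ + 2) * α + β) *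
          (c / (2 * (2 * σ + 2)) * powI σ ψ)
        - Real.exp ((2 * σ + 2) * α * l) * ((2 * σ + 2) * α) *
          (1 / (2 * σ + 2) * nonlin σ ψ)) l := by
  simp only [actionTilde_scale hψ]
  have h : ∀ a : ℝ, HasDerivAt (fun l => Real.exp (a * l)) (Real.exp (a * l) * a) l := fun a => by
    simpa using ((hasDerivAt_id l).const_mul a).exp
  exact ((((h _).mul_const _).add ((h _).mul_const _)).add ((h _).mul_const _)).sub
    ((h _).mul_const _)

theorem constraintTilde_eq (hψ : HasWeakDeriv ψ (weakDeriv ψ)) :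
    constraintTilde σ ω c α β ψ =
      (2 * α - β) * (1 / 2 * gradI ψ) + (2 * α + β) * (1 / 2 * massI ω c ψ)
        + ((2 * σ + 2) * α + β) * (c / (2 * (2 * σ + 2)) * powI σ ψ)
        - ((2 * σ + 2) * α) * (1 / (2 * σ + 2) * nonlin σ ψ) := by
  unfold constraintTilde
  rw [(hasDerivAt_actionTilde_scale hψ 0).deriv]
  simp

/-! The gauge transformation -/

theorem coeFn_gauge (c : ℝ) (φ : Fn) : gauge c φ =ᵐ[volume]
    fun x => Complex.exp (-(Complex.I * c * x / 2)) * φ x := by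
  unfold gauge
  filter_upwards [AEEqFun.coeFn_mul (AEEqFun.mk (fun x : ℝ =>
      Complex.exp (-(Complex.I * c * x / 2))) (by fun_prop : Continuous fun x : ℝ =>
      Complex.exp (-(Complex.I * c * x / 2))).aestronglyMeasurable) φ,
    AEEqFun.coeFn_mk (μ := volume) (fun x : ℝ =>
      Complex.exp (-(Complex.I * c * x / 2))) (by fun_prop : Continuous fun x : ℝ =>
      Complex.exp (-(Complex.I * c * x / 2))).aestronglyMeasurable] with x h1 h2
  rw [h1, Pi.mul_apply, h2]

theorem coeFn_eq_of_gauge (c : ℝ) (φ : Fn) : φ =ᵐ[volume]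
    fun x => Complex.exp (Complex.I * c * x / 2) * gauge c φ x := by
  filter_upwards [coeFn_gauge c φ] with x hx
  rw [hx, ← mul_assoc, ← Complex.exp_add]
  simp

theorem gauge_add (c : ℝ) (φ χ : Fn) : gauge c (φ + χ) = gauge c φ + gauge c χ := by
  apply AEEqFun.ext
  filter_upwards [coeFn_gauge c (φ + χ), coeFn_gauge c φ, coeFn_gauge c χ,
    AEEqFun.coeFn_add φ χ, AEEqFun.coeFn_add (gauge c φ) (gauge c χ)] with x h1 h2 h3 h4 h5
  rw [h1, h4, h5, Pi.add_apply, Pi.add_apply, h2, h3, mul_add]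

theorem gauge_surjective (c : ℝ) (ψ : Fn) : ∃ φ, gauge c φ = ψ := by
  have hc : Continuous fun x : ℝ => Complex.exp (Complex.I * c * x / 2) := by fun_prop
  refine ⟨AEEqFun.mk _ hc.aestronglyMeasurable * ψ, AEEqFun.ext ?_⟩
  filter_upwards [coeFn_gauge c (AEEqFun.mk _ hc.aestronglyMeasurable * ψ),
    AEEqFun.coeFn_mul (AEEqFun.mk _ hc.aestronglyMeasurable) ψ,
    AEEqFun.coeFn_mk (μ := volume) _ hc.aestronglyMeasurable] with x h1 h2 h3
  rw [h1, h2, Pi.mul_apply, h3, ← mul_assoc, ← Complex.exp_add]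
  simp

theorem norm_exp_gauge (c x : ℝ) : ‖Complex.exp (Complex.I * c * x / 2)‖ = 1 := by
  rw [show Complex.I * c * x / 2 = ((c * x / 2 : ℝ) : ℂ) * Complex.I by push_cast; ring]
  exact Complex.norm_exp_ofReal_mul_I _

theorem weakDeriv_of_gauge (hψ : HasWeakDeriv (gauge c φ) (weakDeriv (gauge c φ))) :
    weakDeriv φ =ᵐ[volume] fun x => Complex.exp (Complex.I * c * x / 2) *
      (weakDeriv (gauge c φ) x + Complex.I * c / 2 * gauge c φ x) := by
  have he : ContDiff ℝ ((⊤ : ℕ∞) : WithTop ℕ∞) fun x : ℝ =>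
      Complex.exp (Complex.I * c * x / 2) := by
    have : ContDiff ℝ ((⊤ : ℕ∞) : WithTop ℕ∞) fun x : ℝ => (x : ℂ) := Complex.ofRealCLM.contDiff
    fun_prop
  have hd : ∀ x : ℝ, deriv (fun x : ℝ => Complex.exp (Complex.I * c * x / 2)) x
      = Complex.exp (Complex.I * c * x / 2) * (Complex.I * c / 2) := by
    intro x
    have h1 : HasDerivAt (fun x : ℝ => Complex.I * c * (x : ℂ) / 2) (Complex.I * c / 2) x := by
      simpa using (((hasDerivAt_id x).ofReal_comp).const_mul (Complex.I * c)).div_const 2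
    exact h1.cexp.deriv
  have h := (hψ.mul_left he).congr (coeFn_eq_of_gauge c φ).symm (g' := fun x =>
    Complex.exp (Complex.I * c * x / 2) *
      (weakDeriv (gauge c φ) x + Complex.I * c / 2 * gauge c φ x))
    (Eventually.of_forall fun x => by simp only [hd]; ring)
  have hm := h.2.1.aestronglyMeasurable
  rw [eq_of_weakDeriv h (AEEqFun.coeFn_mk _ hm)]
  exact AEEqFun.coeFn_mk _ hm

/-- In the massive case, where `S` is defined by energy, mass and momentum, this is a computation
with the product rule; in the massless case it is the definition. -/
theorem action_eq (hσ : 1 ≤ σ) (hψ : gauge c φ ∈ X σ ω c) :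
    action σ ω c φ = actionTilde σ ω c (gauge c φ) := by
  unfold action
  split_ifs with hlt
  swap
  · rfl
  set ψ := gauge c φ with hψdef
  have hφ := coeFn_eq_of_gauge c φ
  have hw := weakDeriv_of_gauge (X_hasWeakDeriv hψ)
  rw [← hψdef] at hφ hw
  have hL2 : MemLp ψ 2 volume := by
    have := X_memLp hψ
    rwa [show exponent σ ω c = 2 from if_pos hlt] at this
  have IM := (sq_integrable_of_memLp hL2).1
  have IG := (X_grad hψ).1
  have IP := (X_rpow hσ hψ le_rfl).1
  have hN := X_nlDens hσ hψ
  have IJ : Integrable fun x => ((starRingEnd ℂ) (ψ x) * weakDeriv ψ x).im := by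
    refine (IM.add IG).mono' ?_ (Eventually.of_forall fun x => ?_)
    · exact Complex.continuous_im.comp_aestronglyMeasurable
        ((Complex.continuous_conj.comp_aestronglyMeasurable (X_memLp hψ).1).mul
          (X_memLp_weakDeriv hψ).1)
    · refine (Complex.abs_im_le_norm _).trans ?_
      simp only [norm_mul, RCLike.norm_conj, Pi.add_apply]
      nlinarith [sq_nonneg (‖ψ x‖ - ‖weakDeriv ψ x‖), sq_nonneg ‖ψ x‖, sq_nonneg ‖weakDeriv ψ x‖]
  have hE : ∀ x : ℝ, (starRingEnd ℂ) (Complex.exp (Complex.I * c * x / 2)) *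
      Complex.exp (Complex.I * c * x / 2) = 1 := by
    intro x
    rw [mul_comm, Complex.mul_conj, Complex.normSq_eq_norm_sq, norm_exp_gauge]
    simp
  have eM : mass φ = ∫ x, ‖ψ x‖ ^ 2 := by
    unfold mass
    refine integral_congr_ae ?_
    filter_upwards [hφ] with x hx
    rw [hx, norm_mul, norm_exp_gauge, one_mul]
  have eG : ∫ x, ‖weakDeriv φ x‖ ^ 2 = gradI ψ + c ^ 2 / 4 * (∫ x, ‖ψ x‖ ^ 2)
      + c * ∫ x, ((starRingEnd ℂ) (ψ x) * weakDeriv ψ x).im := by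
    unfold gradI
    rw [← integral_const_mul, ← integral_const_mul, ← integral_add IG (IM.const_mul _),
      ← integral_add (IG.fun_add (IM.const_mul _)) (IJ.const_mul _)]
    refine integral_congr_ae ?_
    filter_upwards [hw] with x hx
    rw [hx, norm_mul, norm_exp_gauge, one_mul]
    simp only [← Complex.normSq_eq_norm_sq, Complex.normSq_apply]
    simp
    ring
  have eP : momentum φ = -(∫ x, ((starRingEnd ℂ) (ψ x) * weakDeriv ψ x).im)
      - c / 2 * ∫ x, ‖ψ x‖ ^ 2 := by
    unfold momentum
    have hI : Integrable fun x => Complex.I * (weakDeriv ψ x + Complex.I * c / 2 * ψ x) *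
        (starRingEnd ℂ) (ψ x) := by
      refine (((IM.add IG).const_mul (1 + |c|))).mono' ?_ (Eventually.of_forall fun x => ?_)
      · exact (((X_memLp_weakDeriv hψ).1.add ((X_memLp hψ).1.const_mul _)).const_mul _).mul
          (Complex.continuous_conj.comp_aestronglyMeasurable (X_memLp hψ).1)
      · simp only [norm_mul, RCLike.norm_conj, Complex.norm_I, one_mul, Pi.add_apply]
        have h1 : ‖weakDeriv ψ x + Complex.I * c / 2 * ψ x‖
            ≤ ‖weakDeriv ψ x‖ + |c| / 2 * ‖ψ x‖ := by
          refine (norm_add_le _ _).trans ?_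
          simp
        have h2 := norm_nonneg (ψ x)
        have h3 := abs_nonneg c
        calc _ ≤ (‖weakDeriv ψ x‖ + |c| / 2 * ‖ψ x‖) * ‖ψ x‖ := by gcongr
          _ ≤ _ := by
            nlinarith [sq_nonneg (‖ψ x‖ - ‖weakDeriv ψ x‖), sq_nonneg ‖ψ x‖,
              sq_nonneg ‖weakDeriv ψ x‖, mul_nonneg h3 (sq_nonneg ‖ψ x‖),
              mul_nonneg h3 (sq_nonneg ‖weakDeriv ψ x‖)]
    have e : ∫ x, Complex.I * weakDeriv φ x * (starRingEnd ℂ) (φ x) =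
        ∫ x, Complex.I * (weakDeriv ψ x + Complex.I * c / 2 * ψ x) * (starRingEnd ℂ) (ψ x) := by
      refine integral_congr_ae ?_
      filter_upwards [hw, hφ] with x hx hx'
      rw [hx, hx', map_mul]
      linear_combination (Complex.I * (weakDeriv ψ x + Complex.I * c / 2 * ψ x) *
        (starRingEnd ℂ) (ψ x)) * hE x
    rw [e]
    have h2 := integral_re hI
    simp only [RCLike.re_eq_complex_re] at h2
    rw [← h2, ← integral_const_mul, ← integral_neg, ← integral_sub IJ.fun_neg (IM.const_mul _)]
    congr 1
    ext x
    simp only [← Complex.normSq_eq_norm_sq, Complex.normSq_apply]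
    simp
    ring
  have eN : nonlin σ φ = nonlin σ ψ - c / 2 * powI σ ψ := by
    have hI := (hN.1.neg.sub (IP.const_mul (c / 2)))
    rw [hN.2]
    unfold powI
    rw [← integral_const_mul, ← integral_neg, ← integral_sub hN.1.fun_neg (IP.const_mul _)]
    unfold nonlin
    have hI2 : Integrable fun x => Complex.I * ((‖φ x‖ ^ (2 * σ) : ℝ) : ℂ) *
        (starRingEnd ℂ) (φ x) * weakDeriv φ x := by
      have hJ := (X_nl_integrable hσ hψ).sub ((IP.ofReal (𝕜 := ℂ)).const_mul (c / 2 : ℂ))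
      refine hJ.congr ?_
      filter_upwards [hw, hφ] with x hx hx'
      rw [hx, hx', map_mul, norm_mul, norm_exp_gauge, one_mul, Pi.sub_apply]
      have e2 : ((‖ψ x‖ ^ (2 * σ + 2) : ℝ) : ℂ) =
          ((‖ψ x‖ ^ (2 * σ) : ℝ) : ℂ) * ((starRingEnd ℂ) (ψ x) * ψ x) := by
        rw [mul_comm ((starRingEnd ℂ) (ψ x)), Complex.mul_conj, Complex.normSq_eq_norm_sq,
          ← Complex.ofReal_mul, Real.rpow_add_of_nonneg (norm_nonneg _) (by linarith) (by norm_num)]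
        norm_num
      change _ - (c / 2 : ℂ) * ((‖ψ x‖ ^ (2 * σ + 2) : ℝ) : ℂ) = _
      rw [e2]
      linear_combination (-(Complex.I * ((‖ψ x‖ ^ (2 * σ) : ℝ) : ℂ) * (starRingEnd ℂ) (ψ x) *
        (weakDeriv ψ x + Complex.I * c / 2 * ψ x))) * hE x - (c / 2) *
        ((‖ψ x‖ ^ (2 * σ) : ℝ) : ℂ) * ((starRingEnd ℂ) (ψ x) * ψ x) * Complex.I_mul_I
    have h2 := integral_re hI2
    simp only [RCLike.re_eq_complex_re] at h2
    rw [← h2]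
    refine integral_congr_ae ?_
    filter_upwards [hw, hφ] with x hx hx'
    rw [re_density, hx, hx']
    unfold nlDens
    rw [map_mul, norm_mul, norm_exp_gauge, one_mul]
    have e3 : (starRingEnd ℂ) (Complex.exp (Complex.I * c * x / 2)) * (starRingEnd ℂ) (ψ x) *
        (Complex.exp (Complex.I * c * x / 2) * (weakDeriv ψ x + Complex.I * c / 2 * ψ x)) =
        (starRingEnd ℂ) (ψ x) * (weakDeriv ψ x + Complex.I * c / 2 * ψ x) := by
      linear_combination ((starRingEnd ℂ) (ψ x) *
        (weakDeriv ψ x + Complex.I * c / 2 * ψ x)) * hE x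
    rw [e3, Real.rpow_add_of_nonneg (norm_nonneg _) (by linarith) (by norm_num)]
    simp only [Real.rpow_two, ← Complex.normSq_eq_norm_sq, Complex.normSq_apply]
    simp
    ring
  unfold energy
  rw [eM, eG, eP, eN, actionTilde_eq]
  unfold massI
  rw [integral_const_mul]
  have : 2 * σ + 2 ≠ 0 := by linarith
  field_simp
  ring

end Functionals

/-! ### First order expansions of integral functionals -/

section Expansions

open Filter Set

variable {σ ω c : ℝ} {ψ h : Fn}

theorem rpow_tangent_le {a b p : ℝ} (ha : 0 ≤ a) (hb : 0 ≤ b) (hp : 1 ≤ p) :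
    a ^ p + p * a ^ (p - 1) * (b - a) ≤ b ^ p := by
  rcases ha.eq_or_lt with rfl | ha'
  · rw [Real.zero_rpow (by linarith)]
    rcases hp.eq_or_lt with rfl | hp'
    · simp
    · rw [Real.zero_rpow (by linarith)]
      simp only [mul_zero, zero_mul, add_zero]
      positivity
  · have h1 := one_add_mul_self_le_rpow_one_add (s := b / a - 1) (by
      have : 0 ≤ b / a := by positivity
      linarith) hp
    have h2 : (1 + (b / a - 1)) ^ p = b ^ p / a ^ p := by
      rw [add_sub_cancel, Real.div_rpow hb ha]
    have h3 : 0 < a ^ p := by positivity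
    rw [h2, le_div_iff₀ h3] at h1
    have h4 : a ^ p = a ^ (p - 1) * a := by
      rw [← Real.rpow_add_one ha'.ne', sub_add_cancel]
    calc a ^ p + p * a ^ (p - 1) * (b - a) = (1 + p * (b / a - 1)) * a ^ p := by
          rw [h4]; field_simp
      _ ≤ b ^ p := h1

/-- Increments of `x ↦ x ^ q` for `0 ≤ q ≤ p`, measured against the larger of the two points. This
avoids the singularity at the origin of the derivative when `q < 1`. -/
theorem rpow_sub_rpow_le {m M q p : ℝ} (hm : 0 ≤ m) (hmM : m ≤ M) (hM : 0 < M) (hq : 0 ≤ q)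
    (hp : 1 ≤ p) (hqp : q ≤ p) : M ^ q - m ^ q ≤ p * M ^ (q - 1) * (M - m) := by
  set r := m / M with hr
  have hr0 : 0 ≤ r := by positivity
  have hr1 : r ≤ 1 := by rw [hr, div_le_one hM]; exact hmM
  have hmr : m = r * M := by rw [hr]; field_simp
  have key : 1 - r ^ q ≤ p * (1 - r) := by
    rcases le_total q 1 with h | h
    · have h1 : r ≤ r ^ q := by
        rcases hr0.eq_or_lt with h0 | h0
        · rw [← h0]; positivity
        · calc r = r ^ (1 : ℝ) := (Real.rpow_one r).symm
            _ ≤ r ^ q := Real.rpow_le_rpow_of_exponent_ge h0 hr1 h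
      nlinarith
    · have h1 := one_add_mul_self_le_rpow_one_add (s := r - 1) (by linarith) h
      rw [add_sub_cancel] at h1
      nlinarith
  have hMq : 0 < M ^ (q - 1) := by positivity
  have h2 : M ^ q = M ^ (q - 1) * M := by
    rw [← Real.rpow_add_one hM.ne', sub_add_cancel]
  rw [hmr, Real.mul_rpow hr0 hM.le]
  calc M ^ q - r ^ q * M ^ q = (M ^ (q - 1) * M) * (1 - r ^ q) := by rw [h2]; ring
    _ ≤ (M ^ (q - 1) * M) * (p * (1 - r)) := by gcongr
    _ = _ := by ring

/-- Second-order Taylor bound for `x ↦ x ^ p` with `p ≥ 1`; the remainder stays bounded when `p < 2`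
as long as it is measured against the larger of the two points. -/
theorem abs_rpow_taylor_le {a b p M : ℝ} (ha : 0 ≤ a) (hb : 0 ≤ b) (hp : 1 ≤ p) (hM : 0 < M)
    (hmax : max a b = M) :
    |b ^ p - a ^ p - p * a ^ (p - 1) * (b - a)| ≤ p * p * M ^ (p - 2) * (b - a) ^ 2 := by
  have h1 := rpow_tangent_le ha hb hp
  have h2 := rpow_tangent_le hb ha hp
  rw [abs_of_nonneg (by linarith)]
  have h3 : b ^ p - a ^ p - p * a ^ (p - 1) * (b - a)
      ≤ p * ((b ^ (p - 1) - a ^ (p - 1)) * (b - a)) := by linarith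
  have h4 : (b ^ (p - 1) - a ^ (p - 1)) * (b - a) ≤ p * M ^ (p - 2) * (b - a) ^ 2 := by
    have e : p - 2 = (p - 1) - 1 := by ring
    rcases le_total a b with hab | hab
    · rw [max_eq_right hab] at hmax
      subst hmax
      have := rpow_sub_rpow_le ha hab hM (q := p - 1) (p := p) (by linarith) hp (by linarith)
      rw [e]
      nlinarith
    · rw [max_eq_left hab] at hmax
      subst hmax
      have := rpow_sub_rpow_le hb hab hM (q := p - 1) (p := p) (by linarith) hp (by linarith)
      rw [e]
      nlinarith
  calc _ ≤ _ := h3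
    _ ≤ p * (p * M ^ (p - 2) * (b - a) ^ 2) := by gcongr
    _ = _ := by ring

theorem norm_sq_rpow (z : ℂ) (p : ℝ) : (‖z‖ ^ 2) ^ p = ‖z‖ ^ (2 * p) := by
  rw [← Real.rpow_natCast, ← Real.rpow_mul (norm_nonneg z)]
  norm_num

theorem norm_add_smul_sq (z h : ℂ) (t : ℝ) : ‖z + t • h‖ ^ 2
    = ‖z‖ ^ 2 + 2 * t * ((starRingEnd ℂ) z * h).re + t ^ 2 * ‖h‖ ^ 2 := by
  simp only [← Complex.normSq_eq_norm_sq, Complex.normSq_apply]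
  simp
  ring

theorem norm_add_smul_le (z h : ℂ) {t : ℝ} (ht : |t| ≤ 1) : ‖z + t • h‖ ≤ ‖z‖ + ‖h‖ := by
  refine (norm_add_le _ _).trans ?_
  rw [norm_smul, Real.norm_eq_abs]
  gcongr
  exact mul_le_of_le_one_left (norm_nonneg h) ht

theorem abs_re_conj_mul_le (z h : ℂ) : |((starRingEnd ℂ) z * h).re| ≤ ‖z‖ * ‖h‖ := by
  refine (Complex.abs_re_le_norm _).trans ?_
  simp

theorem abs_im_conj_mul_le (z h : ℂ) : |((starRingEnd ℂ) z * h).im| ≤ ‖z‖ * ‖h‖ := by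
  refine (Complex.abs_im_le_norm _).trans ?_
  simp

/-- Second-order expansion of `z ↦ ‖z‖ ^ (2p)`, uniform near `z = 0`. -/
theorem abs_norm_rpow_expansion_le {p : ℝ} (hp : 1 ≤ p) (z h : ℂ) {t : ℝ} (ht : |t| ≤ 1) :
    |‖z + t • h‖ ^ (2 * p) - ‖z‖ ^ (2 * p)
        - t * (2 * p * ‖z‖ ^ (2 * p - 2) * ((starRingEnd ℂ) z * h).re)|
      ≤ 5 * p ^ 2 * (t ^ 2 * (‖z‖ + ‖h‖) ^ (2 * p)) := by
  set a := ‖z‖ ^ 2 with ha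
  set b := ‖z + t • h‖ ^ 2 with hb
  set S := ‖z‖ + ‖h‖ with hS
  have hz := norm_nonneg z
  have hh := norm_nonneg h
  have hS0 : 0 ≤ S := by positivity
  have ha0 : 0 ≤ a := by positivity
  have hb0 : 0 ≤ b := by positivity
  have hzt : ‖z + t • h‖ ≤ S := norm_add_smul_le z h ht
  have haS : a ≤ S ^ 2 := by rw [ha]; gcongr; linarith
  have hbS : b ≤ S ^ 2 := by rw [hb]; gcongr
  have hba : b - a = 2 * t * ((starRingEnd ℂ) z * h).re + t ^ 2 * ‖h‖ ^ 2 := by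
    rw [hb, ha, norm_add_smul_sq]; ring
  have e1 : ‖z + t • h‖ ^ (2 * p) = b ^ p := (norm_sq_rpow _ _).symm
  have e2 : ‖z‖ ^ (2 * p) = a ^ p := (norm_sq_rpow _ _).symm
  have e3 : ‖z‖ ^ (2 * p - 2) = a ^ (p - 1) := by
    rw [ha, norm_sq_rpow]; congr 1; ring
  have e4 : S ^ (2 * p) = (S ^ 2) ^ (p - 1) * S ^ 2 := by
    rcases hS0.eq_or_lt with h0 | h0
    · rw [← h0, Real.zero_rpow (by linarith)]; simp
    · rw [← Real.rpow_add_one (by positivity), sub_add_cancel, ← Real.rpow_natCast,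
        ← Real.rpow_mul hS0]
      norm_num
  rw [e1, e2, e3]
  have hap : a ^ (p - 1) ≤ (S ^ 2) ^ (p - 1) := Real.rpow_le_rpow ha0 haS (by linarith)
  have hSp : 0 ≤ (S ^ 2) ^ (p - 1) := by positivity
  have hR : |b ^ p - a ^ p - p * a ^ (p - 1) * (b - a)| ≤ 4 * p ^ 2 * (t ^ 2 * S ^ (2 * p)) := by
    rcases (le_max_of_le_left ha0 : 0 ≤ max a b).eq_or_lt with h0 | h0
    · have h1 : a = 0 := le_antisymm (h0 ▸ le_max_left a b) ha0
      have h2 : b = 0 := le_antisymm (h0 ▸ le_max_right a b) hb0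
      rw [h1, h2]
      simp only [sub_self, mul_zero, abs_zero]
      positivity
    · set M := max a b with hM
      have hMS : M ≤ S ^ 2 := max_le haS hbS
      have h1 := abs_rpow_taylor_le ha0 hb0 hp h0 rfl
      have hd : (b - a) ^ 2 ≤ 4 * (t ^ 2 * ‖h‖ ^ 2) * M := by
        have h2 : |‖z + t • h‖ - ‖z‖| ≤ |t| * ‖h‖ := by
          have := abs_norm_sub_norm_le (z + t • h) z
          rwa [add_sub_cancel_left, norm_smul, Real.norm_eq_abs] at this
        have h3 : (‖z + t • h‖ - ‖z‖) ^ 2 ≤ t ^ 2 * ‖h‖ ^ 2 := by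
          rw [← sq_abs (‖z + t • h‖ - ‖z‖), ← sq_abs t, ← mul_pow]
          gcongr
        have h4 : (‖z + t • h‖ + ‖z‖) ^ 2 ≤ 4 * M := by
          have h5 : a ≤ M := le_max_left _ _
          have h6 : b ≤ M := le_max_right _ _
          nlinarith [sq_nonneg (‖z + t • h‖ - ‖z‖)]
        have e : b - a = (‖z + t • h‖ - ‖z‖) * (‖z + t • h‖ + ‖z‖) := by rw [hb, ha]; ring
        rw [e, mul_pow]
        calc _ ≤ (t ^ 2 * ‖h‖ ^ 2) * (4 * M) := by gcongr
          _ = _ := by ring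
      have hMp : M ^ (p - 2) * M = M ^ (p - 1) := by
        rw [← Real.rpow_add_one h0.ne']; congr 1; ring
      have hMp' : M ^ (p - 1) ≤ (S ^ 2) ^ (p - 1) := Real.rpow_le_rpow h0.le hMS (by linarith)
      have hhS : ‖h‖ ^ 2 ≤ S ^ 2 := by gcongr; linarith
      calc _ ≤ _ := h1
        _ ≤ p * p * M ^ (p - 2) * (4 * (t ^ 2 * ‖h‖ ^ 2) * M) := by gcongr
        _ = 4 * p ^ 2 * (t ^ 2 * (M ^ (p - 1) * ‖h‖ ^ 2)) := by rw [← hMp]; ring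
        _ ≤ 4 * p ^ 2 * (t ^ 2 * ((S ^ 2) ^ (p - 1) * S ^ 2)) := by gcongr
        _ = _ := by rw [e4]
  have hsplit : b ^ p - a ^ p - t * (2 * p * a ^ (p - 1) * ((starRingEnd ℂ) z * h).re)
      = (b ^ p - a ^ p - p * a ^ (p - 1) * (b - a)) + p * (t ^ 2 * (a ^ (p - 1) * ‖h‖ ^ 2)) := by
    rw [hba]; ring
  rw [hsplit]
  refine (abs_add_le _ _).trans ?_
  have h7 : |p * (t ^ 2 * (a ^ (p - 1) * ‖h‖ ^ 2))| ≤ p ^ 2 * (t ^ 2 * S ^ (2 * p)) := by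
    rw [abs_of_nonneg (by positivity), e4]
    have hhS : ‖h‖ ^ 2 ≤ S ^ 2 := by gcongr; linarith
    have hpp : p ≤ p ^ 2 := by nlinarith
    gcongr
  linarith

/-- The quantity which dominates all densities at a pair `p` of values of a function and of its
derivative. It is integrable for functions in `X` when `A = ω - c² / 4`. -/
noncomputable def dom (A σ : ℝ) (p : ℂ × ℂ) : ℝ :=
  ‖p.2‖ ^ 2 + A * ‖p.1‖ ^ 2 + ‖p.1‖ ^ (2 * σ + 2) + ‖p.1‖ ^ (4 * σ + 2)

theorem add_rpow_le_two {x y s : ℝ} (hx : 0 ≤ x) (hy : 0 ≤ y) (hs : 0 ≤ s) :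
    (x + y) ^ s ≤ 2 ^ s * (x ^ s + y ^ s) := by
  have h1 : (x + y) ^ s ≤ (2 * max x y) ^ s := by
    apply Real.rpow_le_rpow (by positivity) _ hs
    linarith [le_max_left x y, le_max_right x y]
  have h2 : (max x y) ^ s ≤ x ^ s + y ^ s := by
    have h3 : 0 ≤ x ^ s := by positivity
    have h4 : 0 ≤ y ^ s := by positivity
    rcases le_total x y with h | h
    · rw [max_eq_right h]; linarith
    · rw [max_eq_left h]; linarith
  rw [Real.mul_rpow (by norm_num) (le_max_of_le_left hx)] at h1
  exact h1.trans (by gcongr)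

/-- A density `F` of the function and its derivative which has the first variation `L`, with a
remainder that is quadratic in the size of the variation. -/
structure HasExpansion (A σ : ℝ) (F : ℂ × ℂ → ℝ) (L : ℂ × ℂ → ℂ × ℂ → ℝ) : Prop where
  cont : Continuous F
  contL : Continuous fun q : (ℂ × ℂ) × (ℂ × ℂ) => L q.1 q.2
  bound : ∃ C, 0 ≤ C ∧ ∀ p, |F p| ≤ C * dom A σ p
  exp : ∃ C, 0 ≤ C ∧ ∀ p v, |L p v| ≤ C * (dom A σ p + dom A σ v) ∧ ∀ t : ℝ, |t| ≤ 1 →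
    |F (p + t • v) - F p - t * L p v| ≤ C * (t ^ 2 * (dom A σ p + dom A σ v))

theorem dom_nonneg {A : ℝ} (hA : 0 ≤ A) (p : ℂ × ℂ) : 0 ≤ dom A σ p := by
  unfold dom; positivity

theorem hasExpansion_grad {A : ℝ} (hA : 0 ≤ A) (σ : ℝ) :
    HasExpansion A σ (fun p => ‖p.2‖ ^ 2) (fun p v => 2 * ((starRingEnd ℂ) p.2 * v.2).re) where
  cont := by fun_prop
  contL := by fun_prop
  bound := ⟨1, zero_le_one, fun p => by
    rw [abs_of_nonneg (by positivity)]
    unfold dom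
    have : 0 ≤ A * ‖p.1‖ ^ 2 + ‖p.1‖ ^ (2 * σ + 2) + ‖p.1‖ ^ (4 * σ + 2) := by positivity
    linarith⟩
  exp := ⟨1, zero_le_one, fun p v => by
    have hle : ∀ p : ℂ × ℂ, ‖p.2‖ ^ 2 ≤ dom A σ p := fun p => by
      unfold dom
      have : 0 ≤ A * ‖p.1‖ ^ 2 + ‖p.1‖ ^ (2 * σ + 2) + ‖p.1‖ ^ (4 * σ + 2) := by positivity
      linarith
    have h1 := hle p
    have h2 := hle v
    constructor
    · rw [abs_mul, abs_two]
      have := abs_re_conj_mul_le p.2 v.2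
      nlinarith [sq_nonneg (‖p.2‖ - ‖v.2‖)]
    · intro t _
      have e : ‖(p + t • v).2‖ ^ 2 - ‖p.2‖ ^ 2 - t * (2 * ((starRingEnd ℂ) p.2 * v.2).re)
          = t ^ 2 * ‖v.2‖ ^ 2 := by
        rw [Prod.snd_add, Prod.smul_snd, norm_add_smul_sq]
        ring
      rw [e, abs_of_nonneg (by positivity), one_mul]
      have := dom_nonneg (σ := σ) hA p
      gcongr
      linarith⟩

theorem hasExpansion_mass {A : ℝ} (hA : 0 ≤ A) (σ : ℝ) :
    HasExpansion A σ (fun p => A * ‖p.1‖ ^ 2)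
      (fun p v => A * (2 * ((starRingEnd ℂ) p.1 * v.1).re)) where
  cont := by fun_prop
  contL := by fun_prop
  bound := ⟨1, zero_le_one, fun p => by
    rw [abs_of_nonneg (by positivity)]
    unfold dom
    have : 0 ≤ ‖p.2‖ ^ 2 + ‖p.1‖ ^ (2 * σ + 2) + ‖p.1‖ ^ (4 * σ + 2) := by positivity
    linarith⟩
  exp := ⟨1, zero_le_one, fun p v => by
    have hle : ∀ p : ℂ × ℂ, A * ‖p.1‖ ^ 2 ≤ dom A σ p := fun p => by
      unfold dom
      have : 0 ≤ ‖p.2‖ ^ 2 + ‖p.1‖ ^ (2 * σ + 2) + ‖p.1‖ ^ (4 * σ + 2) := by positivity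
      linarith
    have h1 := hle p
    have h2 := hle v
    constructor
    · rw [abs_mul, abs_mul, abs_two, abs_of_nonneg hA]
      have := abs_re_conj_mul_le p.1 v.1
      calc A * (2 * |((starRingEnd ℂ) p.1 * v.1).re|) ≤ A * (2 * (‖p.1‖ * ‖v.1‖)) := by gcongr
        _ ≤ A * (‖p.1‖ ^ 2 + ‖v.1‖ ^ 2) := by
          gcongr
          nlinarith [sq_nonneg (‖p.1‖ - ‖v.1‖)]
        _ ≤ _ := by linarith
    · intro t _
      have e : A * ‖(p + t • v).1‖ ^ 2 - A * ‖p.1‖ ^ 2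
          - t * (A * (2 * ((starRingEnd ℂ) p.1 * v.1).re)) = t ^ 2 * (A * ‖v.1‖ ^ 2) := by
        rw [Prod.fst_add, Prod.smul_fst, norm_add_smul_sq]
        ring
      rw [e, abs_of_nonneg (by positivity), one_mul]
      have := dom_nonneg (σ := σ) hA p
      gcongr
      linarith⟩

theorem hasExpansion_pow {A : ℝ} (hA : 0 ≤ A) (hσ : 1 ≤ σ) :
    HasExpansion A σ (fun p => ‖p.1‖ ^ (2 * σ + 2))
      (fun p v => (2 * σ + 2) * (‖p.1‖ ^ (2 * σ) * ((starRingEnd ℂ) p.1 * v.1).re)) where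
  cont := continuous_fst.norm.rpow_const fun _ => Or.inr (by linarith)
  contL := by
    have : Continuous fun q : (ℂ × ℂ) × (ℂ × ℂ) => ‖q.1.1‖ ^ (2 * σ) :=
      continuous_fst.fst.norm.rpow_const fun _ => Or.inr (by linarith)
    fun_prop
  bound := ⟨1, zero_le_one, fun p => by
    rw [abs_of_nonneg (by positivity)]
    unfold dom
    have : 0 ≤ ‖p.2‖ ^ 2 + A * ‖p.1‖ ^ 2 + ‖p.1‖ ^ (4 * σ + 2) := by positivity
    linarith⟩
  exp := by
    refine ⟨5 * (σ + 1) ^ 2 * 2 ^ (2 * σ + 2), by positivity, fun p v => ?_⟩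
    set S := ‖p.1‖ + ‖v.1‖ with hS
    have hz := norm_nonneg p.1
    have hh := norm_nonneg v.1
    have hle : S ^ (2 * σ + 2) ≤ 2 ^ (2 * σ + 2) * (dom A σ p + dom A σ v) := by
      refine (add_rpow_le_two hz hh (by linarith)).trans ?_
      have hle : ∀ p : ℂ × ℂ, ‖p.1‖ ^ (2 * σ + 2) ≤ dom A σ p := fun p => by
        unfold dom
        have : 0 ≤ ‖p.2‖ ^ 2 + A * ‖p.1‖ ^ 2 + ‖p.1‖ ^ (4 * σ + 2) := by positivity
        linarith
      gcongr
      · exact hle p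
      · exact hle v
    constructor
    · have h1 : ‖p.1‖ ^ (2 * σ) * (‖p.1‖ * ‖v.1‖) ≤ S ^ (2 * σ + 2) := by
        have hS0 : 0 ≤ S := by positivity
        rw [Real.rpow_add_of_nonneg hS0 (by linarith) (by norm_num), Real.rpow_two, sq]
        gcongr
        · linarith
        · linarith
        · linarith
      have h2 : |(2 * σ + 2) * (‖p.1‖ ^ (2 * σ) * ((starRingEnd ℂ) p.1 * v.1).re)|
          ≤ (2 * σ + 2) * S ^ (2 * σ + 2) := by
        rw [abs_mul, abs_mul, abs_of_nonneg (by linarith : (0:ℝ) ≤ 2 * σ + 2),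
          abs_of_nonneg (by positivity : 0 ≤ ‖p.1‖ ^ (2 * σ))]
        have := abs_re_conj_mul_le p.1 v.1
        gcongr
        exact (by gcongr : _ ≤ ‖p.1‖ ^ (2 * σ) * (‖p.1‖ * ‖v.1‖)).trans h1
      have h3 : 2 * σ + 2 ≤ 5 * (σ + 1) ^ 2 := by nlinarith
      calc _ ≤ _ := h2
        _ ≤ 5 * (σ + 1) ^ 2 * (2 ^ (2 * σ + 2) * (dom A σ p + dom A σ v)) := by gcongr
        _ = _ := by ring
    · intro t ht
      have h1 := abs_norm_rpow_expansion_le (p := σ + 1) (by linarith) p.1 v.1 ht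
      rw [show 2 * (σ + 1) - 2 = 2 * σ by ring, show 2 * (σ + 1) = 2 * σ + 2 by ring,
        ← hS] at h1
      have h2 : t * ((2 * σ + 2) * (‖p.1‖ ^ (2 * σ) * ((starRingEnd ℂ) p.1 * v.1).re))
          = t * ((2 * σ + 2) * ‖p.1‖ ^ (2 * σ) * ((starRingEnd ℂ) p.1 * v.1).re) := by ring
      rw [Prod.fst_add, Prod.smul_fst, h2]
      calc _ ≤ _ := h1
        _ ≤ 5 * (σ + 1) ^ 2 * (t ^ 2 * (2 ^ (2 * σ + 2) * (dom A σ p + dom A σ v))) := by gcongr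
        _ = _ := by ring

/-- The growth of the nonlinear density is controlled by Young's inequality. -/
theorem rpow_mul_le_dom {A : ℝ} (hA : 0 ≤ A) (hσ : 1 ≤ σ) (z w h η : ℂ) :
    (‖z‖ + ‖h‖) ^ (2 * σ) * ((‖z‖ + ‖h‖) * (‖w‖ + ‖η‖))
      ≤ (2 ^ (4 * σ + 2) + 2) * (dom A σ (z, w) + dom A σ (h, η)) := by
  set S := ‖z‖ + ‖h‖ with hS
  set W := ‖w‖ + ‖η‖ with hW
  have hz := norm_nonneg z
  have hh := norm_nonneg h
  have hS0 : 0 ≤ S := by positivity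
  set D := dom A σ (z, w) + dom A σ (h, η) with hD
  have e1 : S ^ (4 * σ + 2) = (S ^ (2 * σ) * S) ^ 2 := by
    rw [mul_pow, ← Real.rpow_mul_natCast hS0, ← Real.rpow_natCast S 2,
      ← Real.rpow_add_of_nonneg hS0 (by positivity) (by positivity)]
    congr 1
    push_cast
    ring
  have h1 : S ^ (2 * σ) * (S * W) ≤ S ^ (4 * σ + 2) + W ^ 2 := by
    rw [e1]
    nlinarith [sq_nonneg (S ^ (2 * σ) * S - W), sq_nonneg (S ^ (2 * σ) * S), sq_nonneg W]
  have h2 : S ^ (4 * σ + 2) ≤ 2 ^ (4 * σ + 2) * D := by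
    refine (add_rpow_le_two hz hh (by linarith)).trans ?_
    rw [hD]
    unfold dom
    have h2 : 0 ≤ ‖w‖ ^ 2 + A * ‖z‖ ^ 2 + ‖z‖ ^ (2 * σ + 2) := by positivity
    have h3 : 0 ≤ ‖η‖ ^ 2 + A * ‖h‖ ^ 2 + ‖h‖ ^ (2 * σ + 2) := by positivity
    exact mul_le_mul_of_nonneg_left (by linarith) (by positivity)
  have h3 : W ^ 2 ≤ 2 * D := by
    rw [hD, hW]
    unfold dom
    have h2 : 0 ≤ A * ‖z‖ ^ 2 + ‖z‖ ^ (2 * σ + 2) + ‖z‖ ^ (4 * σ + 2) := by positivity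
    have h3 : 0 ≤ A * ‖h‖ ^ 2 + ‖h‖ ^ (2 * σ + 2) + ‖h‖ ^ (4 * σ + 2) := by positivity
    have h4 : (‖w‖ + ‖η‖) ^ 2 ≤ 2 * (‖w‖ ^ 2 + ‖η‖ ^ 2) := add_sq_le
    simp only
    linarith
  linarith

theorem abs_mul_expansion_le {u₀ u₁ r m₀ m₁ m₂ t P Q s : ℝ} (hs : 0 ≤ s) (hP : 0 ≤ P)
    (ht : |t| ≤ 1) (b₀ : |u₀| ≤ P) (b₁ : |u₁| ≤ 2 * s * P) (br : |r| ≤ 5 * s ^ 2 * (t ^ 2 * P))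
    (c₁ : |m₁| ≤ Q) (c₂ : |m₂| ≤ Q) (cm : |m₀ + t * m₁ + t ^ 2 * m₂| ≤ Q) :
    |(u₀ + t * u₁ + r) * (m₀ + t * m₁ + t ^ 2 * m₂) - u₀ * m₀ - t * (u₀ * m₁ + u₁ * m₀)|
      ≤ (5 * s ^ 2 + 4 * s + 1) * (t ^ 2 * (P * Q)) := by
  have ht2 : 0 ≤ t ^ 2 := sq_nonneg t
  have e5 : (u₀ + t * u₁ + r) * (m₀ + t * m₁ + t ^ 2 * m₂) - u₀ * m₀ - t * (u₀ * m₁ + u₁ * m₀)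
      = t ^ 2 * (u₀ * m₂) + t ^ 2 * (u₁ * (m₁ + t * m₂)) + r * (m₀ + t * m₁ + t ^ 2 * m₂) := by
    ring
  have d1 : |t ^ 2 * (u₀ * m₂)| ≤ t ^ 2 * (P * Q) := by
    rw [abs_mul, abs_mul, abs_of_nonneg ht2]
    gcongr
  have d2 : |t ^ 2 * (u₁ * (m₁ + t * m₂))| ≤ t ^ 2 * (2 * s * P * (Q + Q)) := by
    rw [abs_mul, abs_mul, abs_of_nonneg ht2]
    have : |m₁ + t * m₂| ≤ Q + Q := by
      refine (abs_add_le _ _).trans ?_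
      rw [abs_mul]
      have : |t| * |m₂| ≤ 1 * Q := by gcongr
      linarith
    gcongr
  have d3 : |r * (m₀ + t * m₁ + t ^ 2 * m₂)| ≤ 5 * s ^ 2 * (t ^ 2 * P) * Q := by
    rw [abs_mul]
    gcongr
  rw [e5]
  refine (abs_add_three _ _ _).trans ((add_le_add (add_le_add d1 d2) d3).trans (le_of_eq ?_))
  ring

theorem hasExpansion_nl {A : ℝ} (hA : 0 ≤ A) (hσ : 1 ≤ σ) :
    HasExpansion A σ (fun p => nlDens σ p.1 p.2)
      (fun p v => ‖p.1‖ ^ (2 * σ) * (((starRingEnd ℂ) v.1 * p.2).im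
          + ((starRingEnd ℂ) p.1 * v.2).im)
        + 2 * σ * ‖p.1‖ ^ (2 * σ - 2) * ((starRingEnd ℂ) p.1 * v.1).re *
          ((starRingEnd ℂ) p.1 * p.2).im) where
  cont := by
    have : Continuous fun q : ℂ × ℂ => ‖q.1‖ ^ (2 * σ) :=
      continuous_fst.norm.rpow_const fun _ => Or.inr (by linarith)
    unfold nlDens
    fun_prop
  contL := by
    have h1 : Continuous fun q : (ℂ × ℂ) × (ℂ × ℂ) => ‖q.1.1‖ ^ (2 * σ) :=
      continuous_fst.fst.norm.rpow_const fun _ => Or.inr (by linarith)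
    have h2 : Continuous fun q : (ℂ × ℂ) × (ℂ × ℂ) => ‖q.1.1‖ ^ (2 * σ - 2) :=
      continuous_fst.fst.norm.rpow_const fun _ => Or.inr (by linarith)
    fun_prop
  bound := ⟨1, zero_le_one, fun p => by
    have := abs_nlDens_le hσ p.1 p.2
    unfold dom
    have h2 : 0 ≤ A * ‖p.1‖ ^ 2 + ‖p.1‖ ^ (2 * σ + 2) := by positivity
    linarith⟩
  exp := by
    refine ⟨(20 * σ ^ 2 + 6 * σ + 1) * (2 ^ (4 * σ + 2) + 2), by positivity, fun p v => ?_⟩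
    have hc1 : 2 * σ + 1 ≤ 20 * σ ^ 2 + 6 * σ + 1 := by nlinarith
    have hc2 : 5 * σ ^ 2 + 4 * σ + 1 ≤ 20 * σ ^ 2 + 6 * σ + 1 := by nlinarith
    obtain ⟨z, w⟩ := p
    obtain ⟨h, η⟩ := v
    simp only
    set S := ‖z‖ + ‖h‖ with hS
    set W := ‖w‖ + ‖η‖ with hW
    have hz := norm_nonneg z
    have hh := norm_nonneg h
    have hw := norm_nonneg w
    have hη := norm_nonneg η
    have hS0 : 0 ≤ S := by positivity
    have hW0 : 0 ≤ W := by positivity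
    set D := dom A σ (z, w) + dom A σ (h, η) with hD
    have hT : S ^ (2 * σ) * (S * W) ≤ (2 ^ (4 * σ + 2) + 2) * D := rpow_mul_le_dom hA hσ z w h η
    have hS2 : 0 ≤ S ^ (2 * σ) := by positivity
    set m0 := ((starRingEnd ℂ) z * w).im with hm0
    set m1 := ((starRingEnd ℂ) h * w).im + ((starRingEnd ℂ) z * η).im with hm1
    set m2 := ((starRingEnd ℂ) h * η).im with hm2
    set u0 := ‖z‖ ^ (2 * σ) with hu0
    set u1 := 2 * σ * ‖z‖ ^ (2 * σ - 2) * ((starRingEnd ℂ) z * h).re with hu1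
    have hzw : ‖z‖ * ‖w‖ + ‖h‖ * ‖w‖ + ‖z‖ * ‖η‖ + ‖h‖ * ‖η‖ = S * W := by rw [hS, hW]; ring
    have p1 := mul_nonneg hz hw
    have p2 := mul_nonneg hh hw
    have p3 := mul_nonneg hz hη
    have p4 := mul_nonneg hh hη
    have bm0 : |m0| ≤ S * W := (abs_im_conj_mul_le z w).trans (by linarith)
    have bm1 : |m1| ≤ S * W := (abs_add_le _ _).trans (by
      linarith [abs_im_conj_mul_le h w, abs_im_conj_mul_le z η])
    have bm2 : |m2| ≤ S * W := (abs_im_conj_mul_le h η).trans (by linarith)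
    have bu0 : |u0| ≤ S ^ (2 * σ) := by
      rw [abs_of_nonneg (by positivity)]
      exact Real.rpow_le_rpow hz (by linarith) (by linarith)
    have bu1 : |u1| ≤ 2 * σ * S ^ (2 * σ) := by
      have e : S ^ (2 * σ) = S ^ (2 * σ - 2) * (S * S) := by
        have := Real.rpow_add_of_nonneg hS0 (by linarith : (0:ℝ) ≤ 2 * σ - 2)
          (by norm_num : (0:ℝ) ≤ 2)
        rw [sub_add_cancel, Real.rpow_two] at this
        rw [this]; ring
      rw [hu1, abs_mul, abs_of_nonneg (by positivity), e, mul_assoc]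
      have h1 := abs_re_conj_mul_le z h
      have h2 : ‖z‖ ^ (2 * σ - 2) ≤ S ^ (2 * σ - 2) :=
        Real.rpow_le_rpow hz (by linarith) (by linarith)
      have h3 : ‖z‖ * ‖h‖ ≤ S * S := by gcongr <;> linarith
      have := h1.trans h3
      gcongr
    have hSW : 0 ≤ S * W := by positivity
    constructor
    · calc |u0 * m1 + u1 * m0| ≤ |u0| * |m1| + |u1| * |m0| := by
            refine (abs_add_le _ _).trans ?_
            rw [abs_mul, abs_mul]
        _ ≤ S ^ (2 * σ) * (S * W) + 2 * σ * S ^ (2 * σ) * (S * W) := by gcongr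
        _ = (2 * σ + 1) * (S ^ (2 * σ) * (S * W)) := by ring
        _ ≤ (20 * σ ^ 2 + 6 * σ + 1) * ((2 ^ (4 * σ + 2) + 2) * D) := by
            gcongr
        _ = _ := by ring
    · intro t ht
      have hr := abs_norm_rpow_expansion_le hσ z h ht
      set r := ‖z + t • h‖ ^ (2 * σ) - ‖z‖ ^ (2 * σ) - t * u1 with hrdef
      have eN : nlDens σ (z + t • h) (w + t • η)
          = (u0 + t * u1 + r) * (m0 + t * m1 + t ^ 2 * m2) := by
        unfold nlDens
        have e1 : u0 + t * u1 + r = ‖z + t • h‖ ^ (2 * σ) := by rw [hrdef, hu0]; ring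
        have e2 : ((starRingEnd ℂ) (z + t • h) * (w + t • η)).im = m0 + t * m1 + t ^ 2 * m2 := by
          rw [hm0, hm1, hm2]
          simp
          ring
        rw [e1, e2]
      have e0 : nlDens σ z w = u0 * m0 := rfl
      have ePair : ((z, w) : ℂ × ℂ) + t • (h, η) = (z + t • h, w + t • η) := rfl
      rw [ePair, eN, e0]
      have bm : |m0 + t * m1 + t ^ 2 * m2| ≤ S * W := by
        have e2 : m0 + t * m1 + t ^ 2 * m2 = ((starRingEnd ℂ) (z + t • h) * (w + t • η)).im := by
          rw [hm0, hm1, hm2]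
          simp
          ring
        rw [e2]
        refine (abs_im_conj_mul_le _ _).trans ?_
        have h1 : ‖z + t • h‖ ≤ S := norm_add_smul_le _ _ ht
        have h2 : ‖w + t • η‖ ≤ W := norm_add_smul_le _ _ ht
        gcongr
      refine (abs_mul_expansion_le (by linarith) hS2 ht bu0 bu1 hr bm1 bm2 bm).trans ?_
      calc _ ≤ (20 * σ ^ 2 + 6 * σ + 1) * (t ^ 2 * ((2 ^ (4 * σ + 2) + 2) * D)) := by
            gcongr
        _ = _ := by ring

/-- The pair of a function and its weak derivative. -/
noncomputable def jet (ψ : Fn) (x : ℝ) : ℂ × ℂ := (ψ x, weakDeriv ψ x)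

theorem aestronglyMeasurable_jet (ψ : Fn) : AEStronglyMeasurable (jet ψ) volume :=
  ψ.aestronglyMeasurable.prodMk (weakDeriv ψ).aestronglyMeasurable

theorem dom_jet (hσ : 1 ≤ σ) (hωc : Admissible ω c) (hψ : ψ ∈ X σ ω c) :
    Integrable (fun x => dom (ω - c ^ 2 / 4) σ (jet ψ x)) ∧
      (normX σ ω c ψ ≤ 1 → ∫ x, dom (ω - c ^ 2 / 4) σ (jet ψ x) ≤ 3 + (ω - c ^ 2 / 4)) := by
  obtain ⟨i1, b1⟩ := X_grad hψ
  obtain ⟨i2, b2⟩ := X_mass hωc hψ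
  obtain ⟨i3, b3⟩ := X_rpow hσ hψ (s := 2 * σ + 2) le_rfl
  obtain ⟨i4, b4⟩ := X_rpow hσ hψ (s := 4 * σ + 2) (by linarith)
  unfold dom jet
  refine ⟨((i1.add i2).add i3).add i4, fun h1 => ?_⟩
  have h0 : 0 ≤ normX σ ω c ψ := normX_nonneg
  have hA := hωc.nonneg
  rw [integral_add ((i1.fun_add i2).fun_add i3) i4, integral_add (i1.fun_add i2) i3,
    integral_add i1 i2]
  have c1 : normX σ ω c ψ ^ 2 ≤ 1 := pow_le_one₀ h0 h1
  have c3 : normX σ ω c ψ ^ (2 * σ + 2) ≤ 1 := Real.rpow_le_one h0 h1 (by linarith)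
  have c4 : normX σ ω c ψ ^ (4 * σ + 2) ≤ 1 := Real.rpow_le_one h0 h1 (by linarith)
  have c2 := mul_le_mul_of_nonneg_left c1 hA
  linarith

theorem jet_add_smul (hψ : ψ ∈ X σ ω c) (hh : h ∈ X σ ω c) (t : ℝ) :
    jet (ψ + t • h) =ᵐ[volume] fun x => jet ψ x + t • jet h x := by
  have e := (X_add hψ (X_smul hh t).1).2
  rw [(X_smul hh t).2] at e
  unfold jet
  rw [e]
  filter_upwards [AEEqFun.coeFn_add ψ (t • h), AEEqFun.coeFn_smul t h,
    AEEqFun.coeFn_add (weakDeriv ψ) (t • weakDeriv h), AEEqFun.coeFn_smul t (weakDeriv h)]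
    with x h1 h2 h3 h4
  rw [h1, h3, Pi.add_apply, Pi.add_apply, h2, h4]
  rfl

theorem HasExpansion.integrable {F : ℂ × ℂ → ℝ} {L : ℂ × ℂ → ℂ × ℂ → ℝ} (hσ : 1 ≤ σ)
    (hωc : Admissible ω c) (hF : HasExpansion (ω - c ^ 2 / 4) σ F L) (hψ : ψ ∈ X σ ω c) :
    Integrable fun x => F (jet ψ x) := by
  obtain ⟨C, hC, hb⟩ := hF.bound
  exact ((dom_jet hσ hωc hψ).1.const_mul C).mono'
    (hF.cont.comp_aestronglyMeasurable (aestronglyMeasurable_jet ψ))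
    (Eventually.of_forall fun x => hb _)

theorem HasExpansion.integrable_first {F : ℂ × ℂ → ℝ} {L : ℂ × ℂ → ℂ × ℂ → ℝ} (hσ : 1 ≤ σ)
    (hωc : Admissible ω c) (hF : HasExpansion (ω - c ^ 2 / 4) σ F L) (hψ : ψ ∈ X σ ω c)
    (hh : h ∈ X σ ω c) : Integrable fun x => L (jet ψ x) (jet h x) := by
  obtain ⟨C, hC, hb⟩ := hF.exp
  refine (((dom_jet hσ hωc hψ).1.add (dom_jet hσ hωc hh).1).const_mul C).mono' ?_
    (Eventually.of_forall fun x => (hb _ _).1)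
  exact hF.contL.comp_aestronglyMeasurable
    ((aestronglyMeasurable_jet ψ).prodMk (aestronglyMeasurable_jet h))

/-- Expansion of the integral of a density, uniformly for variations in the unit ball of `X`. -/
theorem HasExpansion.integral {F : ℂ × ℂ → ℝ} {L : ℂ × ℂ → ℂ × ℂ → ℝ} (hσ : 1 ≤ σ)
    (hωc : Admissible ω c) (hF : HasExpansion (ω - c ^ 2 / 4) σ F L) (hψ : ψ ∈ X σ ω c) :
    ∃ C, 0 ≤ C ∧ ∀ h ∈ X σ ω c, normX σ ω c h ≤ 1 →
      |∫ x, L (jet ψ x) (jet h x)| ≤ C ∧ ∀ t : ℝ, |t| ≤ 1 →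
        |(∫ x, F (jet (ψ + t • h) x)) - (∫ x, F (jet ψ x))
          - t * ∫ x, L (jet ψ x) (jet h x)| ≤ C * t ^ 2 := by
  obtain ⟨C, hC, hb⟩ := hF.exp
  set A := ω - c ^ 2 / 4 with hA
  have hA0 : 0 ≤ A := hωc.nonneg
  have iψ := (dom_jet hσ hωc hψ).1
  have pψ : 0 ≤ ∫ x, dom A σ (jet ψ x) := integral_nonneg fun x => dom_nonneg hA0 _
  refine ⟨C * ((∫ x, dom A σ (jet ψ x)) + (3 + A)), by positivity, fun h hh hn => ?_⟩
  obtain ⟨ih, bh⟩ := dom_jet hσ hωc hh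
  have bh' := bh hn
  have iL := hF.integrable_first hσ hωc hψ hh
  have eD : ∫ x, C * (dom A σ (jet ψ x) + dom A σ (jet h x)) ≤
      C * ((∫ x, dom A σ (jet ψ x)) + (3 + A)) := by
    rw [integral_const_mul, integral_add iψ ih]
    gcongr
  constructor
  · refine le_trans ?_ eD
    rw [← Real.norm_eq_abs]
    exact norm_integral_le_of_norm_le ((iψ.fun_add ih).const_mul C)
      (Eventually.of_forall fun x => (hb _ _).1)
  · intro t ht
    have i1 := hF.integrable hσ hωc (X_add hψ (X_smul hh t).1).1
    have i0 := hF.integrable hσ hωc hψ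
    have i10 : Integrable (fun x => F (jet (ψ + t • h) x) - F (jet ψ x)) := i1.sub i0
    rw [← integral_const_mul, ← integral_sub i1 i0, ← integral_sub i10 (iL.const_mul t)]
    have h2 : ∫ x, t ^ 2 * (C * (dom A σ (jet ψ x) + dom A σ (jet h x))) ≤
        C * ((∫ x, dom A σ (jet ψ x)) + (3 + A)) * t ^ 2 := by
      rw [integral_const_mul, mul_comm]
      gcongr
    refine le_trans ?_ h2
    rw [← Real.norm_eq_abs]
    refine (norm_integral_le_of_norm_le (((iψ.fun_add ih).const_mul C).const_mul _) ?_)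
    filter_upwards [jet_add_smul hψ hh t] with x hx
    rw [hx, Real.norm_eq_abs]
    refine ((hb _ _).2 t ht).trans (le_of_eq ?_)
    ring

end Expansions

/-! ### The lower bound on the action -/

section Bogomolny

open Filter Set

variable {σ ω c α β : ℝ} {ψ : Fn} {u : ℝ → ℂ}

/-- Along a scaling orbit the action is maximal, strictly, where its derivative vanishes. -/
theorem scaling_lt {a b d n : ℝ} (hσ : 1 ≤ σ) (ha : 0 < a) (hb : 0 ≤ b) (hd : d * β ≤ 0)
    (h1 : 0 < 2 * α - β) (h2 : 0 < 2 * α + β)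
    (hK : (2 * α - β) * a + (2 * α + β) * b + ((2 * σ + 2) * α + β) * d
      - ((2 * σ + 2) * α) * n = 0) {l : ℝ} (hl : l ≠ 0) :
    Real.exp ((2 * α - β) * l) * a + Real.exp ((2 * α + β) * l) * b
      + Real.exp (((2 * σ + 2) * α + β) * l) * d - Real.exp ((2 * σ + 2) * α * l) * n
      < a + b + d - n := by
  have hα : 0 < α := by linarith
  set f : ℝ → ℝ := fun l => Real.exp ((2 * α - β) * l) * a + Real.exp ((2 * α + β) * l) * b
      + Real.exp (((2 * σ + 2) * α + β) * l) * d - Real.exp ((2 * σ + 2) * α * l) * n with hf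
  -- the derivative of `f`, divided by the exponential in its last term; its sign is that of `-l`
  set g : ℝ → ℝ := fun l => Real.exp (-(2 * σ * α + β) * l) * ((2 * α - β) * a)
      + Real.exp (-(2 * σ * α - β) * l) * ((2 * α + β) * b)
      + ((2 * σ + 2) * α + β) * (Real.exp (β * l) * d) - ((2 * σ + 2) * α) * n with hg
  have hder : ∀ l, HasDerivAt f (Real.exp ((2 * σ + 2) * α * l) * g l) l := by
    intro l
    have h : ∀ a : ℝ, HasDerivAt (fun l => Real.exp (a * l)) (Real.exp (a * l) * a) l :=
      fun a => by simpa using ((hasDerivAt_id l).const_mul a).exp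
    have := ((((h (2 * α - β)).mul_const a).add ((h (2 * α + β)).mul_const b)).add
      ((h ((2 * σ + 2) * α + β)).mul_const d)).sub ((h ((2 * σ + 2) * α)).mul_const n)
    refine this.congr_deriv ?_
    have e1 : Real.exp ((2 * α - β) * l)
        = Real.exp ((2 * σ + 2) * α * l) * Real.exp (-(2 * σ * α + β) * l) := by
      rw [← Real.exp_add]; congr 1; ring
    have e2 : Real.exp ((2 * α + β) * l)
        = Real.exp ((2 * σ + 2) * α * l) * Real.exp (-(2 * σ * α - β) * l) := by
      rw [← Real.exp_add]; congr 1; ring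
    have e3 : Real.exp (((2 * σ + 2) * α + β) * l)
        = Real.exp ((2 * σ + 2) * α * l) * Real.exp (β * l) := by
      rw [← Real.exp_add]; congr 1; ring
    rw [e1, e2, e3, hg]
    ring
  have hσα : α ≤ σ * α := by nlinarith
  have c1 : 0 < 2 * σ * α + β := by nlinarith
  have c2 : 0 < 2 * σ * α - β := by nlinarith
  have c3 : 0 < (2 * σ + 2) * α + β := by nlinarith
  have g0 : g 0 = 0 := by
    simp only [hg, mul_zero, Real.exp_zero]
    linarith
  have hdexp : ∀ l, 0 ≤ l → Real.exp (β * l) * d ≤ d ∧ d ≤ Real.exp (β * (-l)) * d := by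
    intro l hl
    rcases le_total 0 β with hβ | hβ
    · rcases hβ.eq_or_lt with h0 | h0
      · rw [← h0]; simp
      · have hd' : d ≤ 0 := by
          by_contra hcon
          push Not at hcon
          nlinarith
        have e1 : 1 ≤ Real.exp (β * l) := Real.one_le_exp (by positivity)
        have e2 : Real.exp (β * (-l)) ≤ 1 := Real.exp_le_one_iff.2 (by nlinarith)
        constructor <;> nlinarith
    · rcases hβ.eq_or_lt with h0 | h0
      · rw [h0]; simp
      · have hd' : 0 ≤ d := by
          by_contra hcon
          push Not at hcon
          nlinarith
        have e1 : Real.exp (β * l) ≤ 1 := Real.exp_le_one_iff.2 (by nlinarith)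
        have e2 : 1 ≤ Real.exp (β * (-l)) := Real.one_le_exp (by nlinarith)
        constructor <;> nlinarith
  have gneg : ∀ l, 0 < l → g l < 0 := by
    intro l hl
    have e1 : Real.exp (-(2 * σ * α + β) * l) < 1 := Real.exp_lt_one_iff.2 (by nlinarith)
    have e2 : Real.exp (-(2 * σ * α - β) * l) ≤ 1 := Real.exp_le_one_iff.2 (by nlinarith)
    have e3 := mul_le_mul_of_nonneg_left (hdexp l hl.le).1 c3.le
    have e4 : Real.exp (-(2 * σ * α + β) * l) * ((2 * α - β) * a) < 1 * ((2 * α - β) * a) := by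
      gcongr
    have e5 : Real.exp (-(2 * σ * α - β) * l) * ((2 * α + β) * b) ≤ 1 * ((2 * α + β) * b) := by
      gcongr
    simp only [hg]
    linarith
  have gpos : ∀ l, l < 0 → 0 < g l := by
    intro l hl
    have e1 : 1 < Real.exp (-(2 * σ * α + β) * l) := Real.one_lt_exp_iff.2 (by nlinarith)
    have e2 : 1 ≤ Real.exp (-(2 * σ * α - β) * l) := Real.one_le_exp (by nlinarith)
    have e3 := mul_le_mul_of_nonneg_left (hdexp (-l) (by linarith)).2 c3.le
    rw [neg_neg] at e3
    have e4 : 1 * ((2 * α - β) * a) < Real.exp (-(2 * σ * α + β) * l) * ((2 * α - β) * a) := by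
      gcongr
    have e5 : 1 * ((2 * α + β) * b) ≤ Real.exp (-(2 * σ * α - β) * l) * ((2 * α + β) * b) := by
      gcongr
    simp only [hg]
    linarith
  have hcont : Continuous f := continuous_iff_continuousAt.2 fun x => (hder x).continuousAt
  have f0 : f 0 = a + b + d - n := by simp [hf]
  rw [← f0]
  change f l < f 0
  rcases lt_or_gt_of_ne hl with h | h
  · refine strictMonoOn_of_deriv_pos (convex_Iic 0) hcont.continuousOn (fun x hx => ?_)
      (mem_Iic.2 h.le) (mem_Iic.2 le_rfl) h
    rw [interior_Iic] at hx
    rw [(hder x).deriv]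
    exact mul_pos (Real.exp_pos _) (gpos x hx)
  · refine strictAntiOn_of_deriv_neg (convex_Ici 0) hcont.continuousOn (fun x hx => ?_)
      (mem_Ici.2 le_rfl) (mem_Ici.2 h.le) h
    rw [interior_Ici] at hx
    rw [(hder x).deriv]
    exact mul_neg_of_pos_of_neg (Real.exp_pos _) (gneg x hx)

theorem gradI_pos (hσ : 1 ≤ σ) (hψ : ψ ∈ X σ ω c) (h0 : ψ ≠ 0) : 0 < gradI ψ := by
  have hnn : 0 ≤ gradI ψ := integral_nonneg fun x => by positivity
  refine lt_of_le_of_ne hnn fun heq => ?_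
  have hz := (integral_eq_zero_iff_of_nonneg (fun x => by positivity) (X_grad hψ).1).1 heq.symm
  obtain ⟨u, hu⟩ := X_exists_rep hψ
  obtain ⟨x, hx⟩ := hu.exists_ne_zero h0
  have hconst : ∀ y, u y = u x := by
    intro y
    have h1 := hu.sub_eq x y
    rw [intervalIntegral.integral_zero_ae] at h1
    · exact sub_eq_zero.1 h1
    · filter_upwards [hz] with t ht _
      simpa using ht
  have ht := hu.tendsto_zero hσ hψ
  rw [show u = fun _ => u x from funext hconst] at ht
  exact hx (tendsto_nhds_unique tendsto_const_nhds ht)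

theorem massI_nonneg (hωc : Admissible ω c) (ψ : Fn) : 0 ≤ massI ω c ψ := by
  have := hωc.nonneg
  exact integral_nonneg fun x => by positivity

theorem powI_nonneg (ψ : Fn) : 0 ≤ powI σ ψ := integral_nonneg fun x => by positivity

theorem ScalingCondition.all (hωc : Admissible ω c) (hαβ : ScalingCondition ω c α β) :
    0 < 2 * α - β ∧ 0 < 2 * α + β ∧ c * β ≤ 0 := by
  rcases hωc with h | ⟨h, hc⟩
  · obtain ⟨h1, h2, h3⟩ := hαβ.1 h
    exact ⟨h1, h2, by linarith⟩
  · obtain ⟨h1, h2, h3⟩ := hαβ.2 h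
    exact ⟨h1, h2, by nlinarith⟩

/-- If the constraint vanishes, scaling strictly decreases the action. This is the only use of the
conditions on `α` and `β` besides `0 < α`. -/
theorem actionTilde_scale_lt (hσ : 1 ≤ σ) (hωc : Admissible ω c)
    (hαβ : ScalingCondition ω c α β) (hψ : ψ ∈ X σ ω c) (h0 : ψ ≠ 0)
    (hK : constraintTilde σ ω c α β ψ = 0) {l : ℝ} (hl : l ≠ 0) :
    actionTilde σ ω c (scale α β l ψ) < actionTilde σ ω c ψ := by
  obtain ⟨h1, h2, h3⟩ := hαβ.all hωc
  rw [constraintTilde_eq (X_hasWeakDeriv hψ)] at hK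
  rw [actionTilde_scale (X_hasWeakDeriv hψ), actionTilde_eq]
  refine scaling_lt hσ (by have := gradI_pos hσ hψ h0; positivity)
    (by have := massI_nonneg hωc ψ; positivity) ?_ h1 h2 hK hl
  have h4 : 0 ≤ powI σ ψ / (2 * (2 * σ + 2)) := by
    have := powI_nonneg (σ := σ) ψ
    have : 0 < 2 * σ + 2 := by linarith
    positivity
  calc c / (2 * (2 * σ + 2)) * powI σ ψ * β = (c * β) * (powI σ ψ / (2 * (2 * σ + 2))) := by ring
    _ ≤ 0 := mul_nonpos_of_nonpos_of_nonneg h3 h4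

/-- The function `q` such that the potential is `½ |z|² q(|z|²)`. -/
noncomputable def qfun (σ ω c r : ℝ) : ℝ :=
  (ω - c ^ 2 / 4) + c / (2 * σ + 2) * r ^ σ - (1 / (2 * σ + 2)) ^ 2 * r ^ (2 * σ)

/-- The gauge covariant derivative `w + i |z|^{2σ} z / (2σ + 2)`. -/
noncomputable def covD (σ : ℝ) (z w : ℂ) : ℂ :=
  w + Complex.I * ((1 / (2 * σ + 2) * ‖z‖ ^ (2 * σ) : ℝ) : ℂ) * z

/-- The density of the action, as a sum of two squares where `q ≥ 0`. -/
noncomputable def actDens (σ ω c : ℝ) (p : ℂ × ℂ) : ℝ :=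
  1 / 2 * ‖covD σ p.1 p.2‖ ^ 2 + 1 / 2 * (‖p.1‖ ^ 2 * qfun σ ω c (‖p.1‖ ^ 2))

theorem rpow_two_mul_add_two (hσ : 1 ≤ σ) {r : ℝ} (hr : 0 ≤ r) :
    r ^ (2 * σ + 2) = r ^ (2 * σ) * r ^ 2 := by
  rw [Real.rpow_add_of_nonneg hr (by linarith) (by norm_num), Real.rpow_two]

theorem rpow_four_mul (σ : ℝ) {r : ℝ} (hr : 0 ≤ r) : r ^ (4 * σ) = (r ^ (2 * σ)) ^ 2 := by
  rw [← Real.rpow_mul_natCast hr]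
  congr 1
  push_cast
  ring

theorem qfun_sq (σ ω c : ℝ) (z : ℂ) : qfun σ ω c (‖z‖ ^ 2) =
    (ω - c ^ 2 / 4) + c / (2 * σ + 2) * ‖z‖ ^ (2 * σ)
      - (1 / (2 * σ + 2)) ^ 2 * (‖z‖ ^ (2 * σ)) ^ 2 := by
  unfold qfun
  rw [norm_sq_rpow, norm_sq_rpow, ← rpow_four_mul σ (norm_nonneg z)]
  congr 3
  ring

theorem norm_covD_sq (σ : ℝ) (z w : ℂ) : ‖covD σ z w‖ ^ 2 =
    ‖w‖ ^ 2 + 2 / (2 * σ + 2) * nlDens σ z w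
      + (1 / (2 * σ + 2)) ^ 2 * ((‖z‖ ^ (2 * σ)) ^ 2 * ‖z‖ ^ 2) := by
  unfold covD nlDens
  generalize ‖z‖ ^ (2 * σ) = m
  rw [show (2 : ℝ) / (2 * σ + 2) = 2 * (1 / (2 * σ + 2)) by ring]
  generalize 1 / (2 * σ + 2) = k
  simp only [← Complex.normSq_eq_norm_sq, Complex.normSq_apply]
  simp
  ring

theorem actDens_eq (hσ : 1 ≤ σ) (p : ℂ × ℂ) : actDens σ ω c p =
    1 / 2 * ‖p.2‖ ^ 2 + 1 / 2 * ((ω - c ^ 2 / 4) * ‖p.1‖ ^ 2)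
      + c / (2 * (2 * σ + 2)) * ‖p.1‖ ^ (2 * σ + 2) + 1 / (2 * σ + 2) * nlDens σ p.1 p.2 := by
  unfold actDens
  rw [norm_covD_sq, qfun_sq, rpow_two_mul_add_two hσ (norm_nonneg _)]
  have : 2 * σ + 2 ≠ 0 := by linarith
  field_simp
  ring

theorem actionTilde_eq_integral (hσ : 1 ≤ σ) (hωc : Admissible ω c) (hψ : ψ ∈ X σ ω c) :
    Integrable (fun x => actDens σ ω c (jet ψ x)) ∧
      actionTilde σ ω c ψ = ∫ x, actDens σ ω c (jet ψ x) := by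
  have i1 := (X_grad hψ).1.const_mul (1 / 2)
  have i2 := (X_mass hωc hψ).1.const_mul (1 / 2)
  have i3 := (X_rpow hσ hψ le_rfl).1.const_mul (c / (2 * (2 * σ + 2)))
  have hn := X_nlDens hσ hψ
  have i4 := hn.1.const_mul (1 / (2 * σ + 2))
  simp only [actDens_eq hσ, jet]
  refine ⟨((i1.add i2).add i3).add i4, ?_⟩
  rw [integral_add ((i1.fun_add i2).fun_add i3) i4, integral_add (i1.fun_add i2) i3,
    integral_add i1 i2, actionTilde_eq, hn.2]
  unfold gradI massI powI
  simp only [integral_const_mul]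
  ring

theorem continuous_qfun (hσ : 1 ≤ σ) : Continuous (qfun σ ω c) := by
  unfold qfun
  have h1 : Continuous fun r : ℝ => r ^ σ := Real.continuous_rpow_const (by linarith)
  have h2 : Continuous fun r : ℝ => r ^ (2 * σ) := Real.continuous_rpow_const (by linarith)
  fun_prop

/-- The primitive `Θ` whose total variation along a function bounds its action from below. -/
noncomputable def calib (σ ω c r : ℝ) : ℝ := ∫ s in (0:ℝ)..r, 1 / 2 * √(qfun σ ω c s)

theorem hasDerivAt_calib (hσ : 1 ≤ σ) (r : ℝ) :
    HasDerivAt (calib σ ω c) (1 / 2 * √(qfun σ ω c r)) r := by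
  have hc : Continuous fun s => 1 / 2 * √(qfun σ ω c s) :=
    continuous_const.mul (continuous_qfun hσ).sqrt
  exact intervalIntegral.integral_hasDerivAt_right (hc.intervalIntegrable _ _)
    (hc.stronglyMeasurableAtFilter _ _) hc.continuousAt

theorem contDiff_calib (hσ : 1 ≤ σ) : ContDiff ℝ 1 (calib σ ω c) := by
  rw [contDiff_one_iff_deriv]
  refine ⟨fun r => (hasDerivAt_calib hσ r).differentiableAt, ?_⟩
  rw [show deriv (calib σ ω c) = fun r => 1 / 2 * √(qfun σ ω c r) from
    funext fun r => (hasDerivAt_calib hσ r).deriv]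
  exact continuous_const.mul (continuous_qfun hσ).sqrt

theorem calib_zero : calib σ ω c 0 = 0 := by simp [calib]

/-- Composition of an absolutely continuous function with a continuously differentiable one. -/
theorem absolutelyContinuous_comp {Θ r : ℝ → ℝ} (hΘ : ContDiff ℝ 1 Θ) {a b : ℝ}
    (hr : AbsolutelyContinuousOnInterval r a b) :
    AbsolutelyContinuousOnInterval (fun x => Θ (r x)) a b := by
  obtain ⟨C, hC⟩ := hr.exists_bound
  obtain ⟨K, hK⟩ := hΘ.contDiffOn.exists_lipschitzOnWith (by decide) (convex_Icc (-C) C)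
    isCompact_Icc
  unfold AbsolutelyContinuousOnInterval at hr ⊢
  refine squeeze_zero' (Eventually.of_forall fun _ => Finset.sum_nonneg fun i hi => dist_nonneg)
    ?_ (by simpa using hr.const_mul (K : ℝ))
  rw [eventually_inf_principal]
  filter_upwards with E hE
  rw [Finset.mul_sum]
  refine Finset.sum_le_sum fun i hi => ?_
  have h1 := hE.1 i hi
  exact hK.dist_le_mul _ (abs_le.1 (hC _ h1.1)) _ (abs_le.1 (hC _ h1.2))

theorem re_conj_mul_covD (σ : ℝ) (z w : ℂ) :
    ((starRingEnd ℂ) z * covD σ z w).re = ((starRingEnd ℂ) z * w).re := by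
  unfold covD
  generalize (1 / (2 * σ + 2) * ‖z‖ ^ (2 * σ) : ℝ) = m
  simp
  ring

/-- The derivative of `Θ(|ψ|²)` is bounded by the density of the action: the arithmetic-geometric
mean inequality for the two squares in that density. -/
theorem abs_calib_deriv_le {z w : ℂ} (hq : 0 ≤ qfun σ ω c (‖z‖ ^ 2)) :
    |1 / 2 * √(qfun σ ω c (‖z‖ ^ 2)) * (2 * ((starRingEnd ℂ) z * w).re)|
      ≤ actDens σ ω c (z, w) := by
  rw [← re_conj_mul_covD σ]
  unfold actDens
  simp only
  have h1 := abs_re_conj_mul_le z (covD σ z w)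
  have h2 := Real.sqrt_nonneg (qfun σ ω c (‖z‖ ^ 2))
  have h3 := Real.sq_sqrt hq
  set s := √(qfun σ ω c (‖z‖ ^ 2))
  rw [← h3, abs_mul, abs_mul, abs_mul, abs_of_nonneg h2, abs_of_pos (by norm_num : (0:ℝ) < 1 / 2),
    abs_two]
  have h4 : s * |((starRingEnd ℂ) z * covD σ z w).re| ≤ s * (‖z‖ * ‖covD σ z w‖) := by gcongr
  nlinarith [sq_nonneg (s * ‖z‖ - ‖covD σ z w‖)]

theorem actDens_nonneg {z w : ℂ} (hq : 0 ≤ qfun σ ω c (‖z‖ ^ 2)) : 0 ≤ actDens σ ω c (z, w) :=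
  (abs_nonneg _).trans (abs_calib_deriv_le hq)

theorem abs_calib_sub_le (hσ : 1 ≤ σ) (hωc : Admissible ω c) (hψ : ψ ∈ X σ ω c) (hu : IsRep ψ u)
    (hq : ∀ x, 0 ≤ qfun σ ω c (‖u x‖ ^ 2)) {a b : ℝ} (hab : a ≤ b) :
    |calib σ ω c (‖u b‖ ^ 2) - calib σ ω c (‖u a‖ ^ 2)|
      ≤ ∫ x in a..b, actDens σ ω c (jet ψ x) := by
  set G : ℝ → ℝ := fun x => calib σ ω c (‖u x‖ ^ 2) with hG
  have hac : AbsolutelyContinuousOnInterval G a b := by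
    obtain ⟨h1, h2⟩ := absolutelyContinuous_of_primitive hu.loc hu.primitive a b
    have h3 := absolutelyContinuous_comp (contDiff_calib (ω := ω) (c := c) hσ)
      ((h1.fun_mul h1).fun_add (h2.fun_mul h2))
    convert h3 using 2 with x
    simp only [hG, ← Complex.normSq_eq_norm_sq, Complex.normSq_apply]
  have hder : ∀ᵐ x, HasDerivAt G (1 / 2 * √(qfun σ ω c (‖u x‖ ^ 2)) *
      (2 * ((starRingEnd ℂ) (u x) * weakDeriv ψ x).re)) x := by
    filter_upwards [ae_hasDerivAt_of_primitive hu.loc hu.primitive] with x hx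
    have h1 := hx.norm_sq
    have h2 : HasDerivAt (fun x => ‖u x‖ ^ 2)
        (2 * ((starRingEnd ℂ) (u x) * weakDeriv ψ x).re) x := by
      refine h1.congr_deriv ?_
      rw [Complex.inner, mul_comm (weakDeriv ψ x)]
    exact (hasDerivAt_calib hσ _).comp x h2
  have hI := (actionTilde_eq_integral hσ hωc hψ).1
  rw [← hac.integral_deriv_eq_sub, ← Real.norm_eq_abs]
  refine intervalIntegral.norm_integral_le_of_norm_le hab ?_ hI.intervalIntegrable
  filter_upwards [hder, hu.ae_eq] with x h1 h2 _
  rw [h1.deriv, jet, h2, Real.norm_eq_abs]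
  exact abs_calib_deriv_le (hq x)

/-- Lower bound on the action of a function that stays in the region where the potential is
nonnegative: on either side of a point, the action is at least the variation of `Θ`. -/
theorem two_mul_calib_le (hσ : 1 ≤ σ) (hωc : Admissible ω c) (hψ : ψ ∈ X σ ω c) (hu : IsRep ψ u)
    (hq : ∀ x, 0 ≤ qfun σ ω c (‖u x‖ ^ 2)) (x₀ : ℝ) :
    2 * calib σ ω c (‖u x₀‖ ^ 2) ≤ actionTilde σ ω c ψ := by
  obtain ⟨hI, he⟩ := actionTilde_eq_integral hσ hωc hψ
  have hnn : ∀ᵐ x, 0 ≤ actDens σ ω c (jet ψ x) := by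
    filter_upwards [hu.ae_eq] with x hx
    rw [jet, hx]
    exact actDens_nonneg (hq x)
  have hlim : Tendsto (fun x => calib σ ω c (‖u x‖ ^ 2)) (cocompact ℝ) (𝓝 0) := by
    have h1 := ((hu.tendsto_zero hσ hψ).norm).pow 2
    have h2 := (hasDerivAt_calib (ω := ω) (c := c) hσ 0).continuousAt.tendsto
    rw [calib_zero] at h2
    exact h2.comp (by simpa using h1)
  rw [cocompact_eq_atBot_atTop, tendsto_sup] at hlim
  have key : ∀ᶠ R : ℝ in atTop, 2 * calib σ ω c (‖u x₀‖ ^ 2) - calib σ ω c (‖u (-R)‖ ^ 2)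
      - calib σ ω c (‖u R‖ ^ 2) ≤ actionTilde σ ω c ψ := by
    filter_upwards [eventually_ge_atTop |x₀|] with R hR
    have h1 := le_trans (le_abs_self _) (abs_calib_sub_le hσ hωc hψ hu hq
      (neg_le_of_abs_le hR))
    have h2 := le_trans (neg_le_abs _) (abs_calib_sub_le hσ hωc hψ hu hq
      (le_of_abs_le hR))
    have h3 := intervalIntegral.integral_add_adjacent_intervals
      (hI.intervalIntegrable (a := -R) (b := x₀)) (hI.intervalIntegrable (a := x₀) (b := R))
    have h4 : ∫ x in (-R)..R, actDens σ ω c (jet ψ x) ≤ ∫ x, actDens σ ω c (jet ψ x) := by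
      rw [intervalIntegral.integral_of_le (by linarith [abs_nonneg x₀])]
      exact setIntegral_le_integral hI hnn
    rw [he]
    linarith
  have hlim2 : Tendsto (fun R : ℝ => 2 * calib σ ω c (‖u x₀‖ ^ 2) - calib σ ω c (‖u (-R)‖ ^ 2)
      - calib σ ω c (‖u R‖ ^ 2)) atTop (𝓝 (2 * calib σ ω c (‖u x₀‖ ^ 2) - 0 - 0)) :=
    (tendsto_const_nhds.sub (hlim.1.comp tendsto_neg_atTop_atBot)).sub hlim.2
  simpa using le_of_tendsto hlim2 key

end Bogomolny

/-! ### The first variation, and minimizers as critical points -/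

section Variation

open Filter Set

variable {σ ω c α β r₀ : ℝ} {ψ φ h : Fn} {u : ℝ → ℂ}

theorem HasExpansion.add {A : ℝ} {F G : ℂ × ℂ → ℝ} {L M : ℂ × ℂ → ℂ × ℂ → ℝ}
    (hF : HasExpansion A σ F L) (hG : HasExpansion A σ G M) :
    HasExpansion A σ (fun p => F p + G p) (fun p v => L p v + M p v) where
  cont := hF.cont.add hG.cont
  contL := hF.contL.add hG.contL
  bound := by
    obtain ⟨C, hC, h1⟩ := hF.bound
    obtain ⟨D, hD, h2⟩ := hG.bound
    refine ⟨C + D, by positivity, fun p => (abs_add_le _ _).trans ?_⟩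
    linarith [h1 p, h2 p]
  exp := by
    obtain ⟨C, hC, h1⟩ := hF.exp
    obtain ⟨D, hD, h2⟩ := hG.exp
    refine ⟨C + D, by positivity, fun p v => ⟨(abs_add_le _ _).trans ?_, fun t ht => ?_⟩⟩
    · linarith [(h1 p v).1, (h2 p v).1]
    · have e : F (p + t • v) + G (p + t • v) - (F p + G p) - t * (L p v + M p v)
          = (F (p + t • v) - F p - t * L p v) + (G (p + t • v) - G p - t * M p v) := by ring
      rw [e]
      refine (abs_add_le _ _).trans ?_
      linarith [(h1 p v).2 t ht, (h2 p v).2 t ht]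

theorem HasExpansion.const_mul {A : ℝ} {F : ℂ × ℂ → ℝ} {L : ℂ × ℂ → ℂ × ℂ → ℝ}
    (hF : HasExpansion A σ F L) (a : ℝ) :
    HasExpansion A σ (fun p => a * F p) (fun p v => a * L p v) where
  cont := hF.cont.const_mul a
  contL := hF.contL.const_mul a
  bound := by
    obtain ⟨C, hC, h1⟩ := hF.bound
    refine ⟨|a| * C, by positivity, fun p => ?_⟩
    rw [abs_mul, mul_assoc]
    exact mul_le_mul_of_nonneg_left (h1 p) (abs_nonneg a)
  exp := by
    obtain ⟨C, hC, h1⟩ := hF.exp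
    refine ⟨|a| * C, by positivity, fun p v => ⟨?_, fun t ht => ?_⟩⟩
    · rw [abs_mul, mul_assoc]
      exact mul_le_mul_of_nonneg_left (h1 p v).1 (abs_nonneg a)
    · have e : a * F (p + t • v) - a * F p - t * (a * L p v)
          = a * (F (p + t • v) - F p - t * L p v) := by ring
      rw [e, abs_mul, mul_assoc]
      exact mul_le_mul_of_nonneg_left ((h1 p v).2 t ht) (abs_nonneg a)

/-- The density of the first variation of the action. -/
noncomputable def firstVar (σ ω c : ℝ) (p v : ℂ × ℂ) : ℝ :=
  1 / 2 * (2 * ((starRingEnd ℂ) p.2 * v.2).re)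
    + 1 / 2 * ((ω - c ^ 2 / 4) * (2 * ((starRingEnd ℂ) p.1 * v.1).re))
    + c / (2 * (2 * σ + 2)) *
      ((2 * σ + 2) * (‖p.1‖ ^ (2 * σ) * ((starRingEnd ℂ) p.1 * v.1).re))
    + 1 / (2 * σ + 2) * (‖p.1‖ ^ (2 * σ) * (((starRingEnd ℂ) v.1 * p.2).im
          + ((starRingEnd ℂ) p.1 * v.2).im)
        + 2 * σ * ‖p.1‖ ^ (2 * σ - 2) * ((starRingEnd ℂ) p.1 * v.1).re *
          ((starRingEnd ℂ) p.1 * p.2).im)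

theorem hasExpansion_actDens (hσ : 1 ≤ σ) (hωc : Admissible ω c) :
    HasExpansion (ω - c ^ 2 / 4) σ (actDens σ ω c) (firstVar σ ω c) := by
  have hA := hωc.nonneg
  have h := ((((hasExpansion_grad hA σ).const_mul (1 / 2)).add
    ((hasExpansion_mass hA σ).const_mul (1 / 2))).add
    ((hasExpansion_pow hA hσ).const_mul (c / (2 * (2 * σ + 2))))).add
    ((hasExpansion_nl hA hσ).const_mul (1 / (2 * σ + 2)))
  rw [show actDens σ ω c = _ from funext (actDens_eq hσ)]
  exact h

/-- The four terms of the action; under scaling, each is multiplied by an exponential. -/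
noncomputable def term (σ ω c : ℝ) : Fin 4 → Fn → ℝ :=
  ![fun ψ => 1 / 2 * gradI ψ, fun ψ => 1 / 2 * massI ω c ψ,
    fun ψ => c / (2 * (2 * σ + 2)) * powI σ ψ, fun ψ => -(1 / (2 * σ + 2) * nonlin σ ψ)]

/-- The rates of the exponentials by which the terms of the action scale. -/
noncomputable def rate (σ α β : ℝ) : Fin 4 → ℝ :=
  ![2 * α - β, 2 * α + β, (2 * σ + 2) * α + β, (2 * σ + 2) * α]

theorem actionTilde_eq_sum (ψ : Fn) : actionTilde σ ω c ψ = ∑ i, term σ ω c i ψ := by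
  rw [actionTilde_eq]
  simp [Fin.sum_univ_four, term]
  ring

theorem actionTilde_scale_eq_sum (hψ : ψ ∈ X σ ω c) (l : ℝ) :
    actionTilde σ ω c (scale α β l ψ) = ∑ i, Real.exp (rate σ α β i * l) * term σ ω c i ψ := by
  rw [actionTilde_scale (X_hasWeakDeriv hψ)]
  simp [Fin.sum_univ_four, term, rate]
  ring

theorem constraintTilde_eq_sum (hψ : ψ ∈ X σ ω c) :
    constraintTilde σ ω c α β ψ = ∑ i, rate σ α β i * term σ ω c i ψ := by
  rw [constraintTilde_eq (X_hasWeakDeriv hψ)]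
  simp [Fin.sum_univ_four, term, rate]
  ring

/-- The terms of the action are Lipschitz at a given function. -/
theorem term_lipschitz (hσ : 1 ≤ σ) (hωc : Admissible ω c) (hψ : ψ ∈ X σ ω c) :
    ∃ C, 0 ≤ C ∧ ∀ i, ∀ h ∈ X σ ω c, normX σ ω c h ≤ 1 → ∀ t : ℝ, |t| ≤ 1 →
      |term σ ω c i (ψ + t • h) - term σ ω c i ψ| ≤ C * |t| := by
  have hA := hωc.nonneg
  have key : ∀ {F : ℂ × ℂ → ℝ} {L : ℂ × ℂ → ℂ × ℂ → ℝ}, HasExpansion (ω - c ^ 2 / 4) σ F L →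
      ∃ C, 0 ≤ C ∧ ∀ h ∈ X σ ω c, normX σ ω c h ≤ 1 → ∀ t : ℝ, |t| ≤ 1 →
      |(∫ x, F (jet (ψ + t • h) x)) - ∫ x, F (jet ψ x)| ≤ C * |t| := by
    intro F L hF
    obtain ⟨C, hC, hb⟩ := hF.integral hσ hωc hψ
    refine ⟨2 * C, by positivity, fun h hh hn t ht => ?_⟩
    obtain ⟨h1, h2⟩ := hb h hh hn
    have h3 := h2 t ht
    have h4 : |t * ∫ x, L (jet ψ x) (jet h x)| ≤ |t| * C := by
      rw [abs_mul]; gcongr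
    have h5 : t ^ 2 ≤ |t| := by
      rw [← sq_abs]; nlinarith [abs_nonneg t]
    have h6 := abs_sub_abs_le_abs_sub ((∫ x, F (jet (ψ + t • h) x)) - ∫ x, F (jet ψ x))
      (t * ∫ x, L (jet ψ x) (jet h x))
    have h7 : C * t ^ 2 ≤ C * |t| := by gcongr
    linarith
  obtain ⟨C0, h0, b0⟩ := key ((hasExpansion_grad hA σ).const_mul (1 / 2))
  obtain ⟨C1, h1, b1⟩ := key ((hasExpansion_mass hA σ).const_mul (1 / 2))
  obtain ⟨C2, h2, b2⟩ := key ((hasExpansion_pow hA hσ).const_mul (c / (2 * (2 * σ + 2))))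
  obtain ⟨C3, h3, b3⟩ := key ((hasExpansion_nl hA hσ).const_mul (1 / (2 * σ + 2)))
  refine ⟨C0 + C1 + C2 + C3, by positivity, fun i h hh hn t ht => ?_⟩
  have ht0 := abs_nonneg t
  have m0 := mul_nonneg h0 ht0
  have m1 := mul_nonneg h1 ht0
  have m2 := mul_nonneg h2 ht0
  have m3 := mul_nonneg h3 ht0
  have b0' := b0 h hh hn t ht
  have b1' := b1 h hh hn t ht
  have b2' := b2 h hh hn t ht
  have b3' := b3 h hh hn t ht
  simp only [integral_const_mul] at b0' b1' b2' b3'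
  have hadd := (X_add hψ (X_smul hh t).1).1
  fin_cases i
  · change |1 / 2 * gradI (ψ + t • h) - 1 / 2 * gradI ψ| ≤ _
    refine b0'.trans ?_
    linarith
  · change |1 / 2 * massI ω c (ψ + t • h) - 1 / 2 * massI ω c ψ| ≤ _
    unfold massI
    simp only [integral_const_mul]
    refine b1'.trans ?_
    linarith
  · change |c / (2 * (2 * σ + 2)) * powI σ (ψ + t • h) - c / (2 * (2 * σ + 2)) * powI σ ψ| ≤ _
    refine b2'.trans ?_
    linarith
  · change |-(1 / (2 * σ + 2) * nonlin σ (ψ + t • h)) - -(1 / (2 * σ + 2) * nonlin σ ψ)| ≤ _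
    rw [(X_nlDens hσ hadd).2, (X_nlDens hσ hψ).2, mul_neg, mul_neg, neg_neg, neg_neg]
    refine b3'.trans ?_
    linarith

/-- A positive zero of `q`; there is exactly one, the square of the maximum of the soliton. -/
structure IsPeak (σ ω c r₀ : ℝ) : Prop where
  pos : 0 < r₀
  zero : qfun σ ω c r₀ = 0

theorem IsPeak.qfun_nonneg (hσ : 1 ≤ σ) (hωc : Admissible ω c) (h : IsPeak σ ω c r₀) {r : ℝ}
    (hr : 0 ≤ r) (hr' : r ≤ r₀) : 0 ≤ qfun σ ω c r := by
  have hA := hωc.nonneg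
  have hz := h.zero
  unfold qfun at hz ⊢
  have e : ∀ s : ℝ, 0 ≤ s → s ^ (2 * σ) = (s ^ σ) ^ 2 := fun s hs => by
    rw [← Real.rpow_mul_natCast hs]; congr 1; push_cast; ring
  rw [e r₀ h.pos.le] at hz
  rw [e r hr]
  have h1 : r ^ σ ≤ r₀ ^ σ := Real.rpow_le_rpow hr hr' (by linarith)
  have h2 : 0 ≤ r ^ σ := by positivity
  have h3 : 0 < r₀ ^ σ := Real.rpow_pos_of_pos h.pos _
  set m := r ^ σ
  set m₀ := r₀ ^ σ
  have h5 : 0 < 2 * σ + 2 := by linarith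
  set k := 1 / (2 * σ + 2) with hk
  have hck : c / (2 * σ + 2) = c * k := by rw [hk]; ring
  rw [hck] at hz ⊢
  -- concavity in `m`: multiply by `m₀` and subtract `m` times the equation at `m₀`
  have h4 : 0 ≤ m₀ * (ω - c ^ 2 / 4 + c * k * m - k ^ 2 * m ^ 2) := by
    have e2 : m₀ * (ω - c ^ 2 / 4 + c * k * m - k ^ 2 * m ^ 2)
        = (m₀ - m) * (ω - c ^ 2 / 4 + k ^ 2 * m * m₀)
          + m * (ω - c ^ 2 / 4 + c * k * m₀ - k ^ 2 * m₀ ^ 2) := by ring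
    rw [e2, hz]
    have : 0 ≤ (m₀ - m) * (ω - c ^ 2 / 4 + k ^ 2 * m * m₀) := by
      apply mul_nonneg
      · linarith
      · positivity
    linarith
  exact nonneg_of_mul_nonneg_right h4 h3

theorem IsPeak.eq_of_qfun (hσ : 1 ≤ σ) (hωc : Admissible ω c) (h : IsPeak σ ω c r₀) {r : ℝ}
    (hr : 0 < r) (hq : qfun σ ω c r = 0) : r = r₀ := by
  have hA := hωc.nonneg
  have hz := h.zero
  unfold qfun at hz hq
  have e : ∀ s : ℝ, 0 ≤ s → s ^ (2 * σ) = (s ^ σ) ^ 2 := fun s hs => by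
    rw [← Real.rpow_mul_natCast hs]; congr 1; push_cast; ring
  rw [e r₀ h.pos.le] at hz
  rw [e r hr.le] at hq
  have h2 : 0 < r ^ σ := Real.rpow_pos_of_pos hr _
  have h3 : 0 < r₀ ^ σ := Real.rpow_pos_of_pos h.pos _
  have hm : r ^ σ = r₀ ^ σ := by
    generalize r ^ σ = m at *
    generalize r₀ ^ σ = m₀ at *
    have h5 : 0 < 1 / (2 * σ + 2) := by
      have : 0 < 2 * σ + 2 := by linarith
      positivity
    have hck : c / (2 * σ + 2) = c * (1 / (2 * σ + 2)) := by ring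
    rw [hck] at hz hq
    generalize 1 / (2 * σ + 2) = k at *
    by_contra hne
    have h6 : (m - m₀) * (c * k - k ^ 2 * (m + m₀)) = 0 := by linear_combination hq - hz
    rcases mul_eq_zero.1 h6 with h7 | h7
    · exact hne (by linarith)
    · have h8 : ω - c ^ 2 / 4 = -(k ^ 2 * m * m₀) := by linear_combination hz - m₀ * h7
      have : 0 < k ^ 2 * m * m₀ := by positivity
      linarith
  exact (Real.rpow_left_inj hr.le h.pos.le (by linarith)).1 hm

/-- If the scaled function has the same maximum as the soliton, its action is at least that of
the soliton. -/
theorem calib_le_actionTilde_scale (hσ : 1 ≤ σ) (hωc : Admissible ω c) (hr : IsPeak σ ω c r₀)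
    (hψ : ψ ∈ X σ ω c) (hu : IsRep ψ u) {x₀ l : ℝ} (hmax : ∀ x, ‖u x‖ ≤ ‖u x₀‖)
    (hl : Real.exp (α * l) * ‖u x₀‖ = √r₀) :
    2 * calib σ ω c r₀ ≤ actionTilde σ ω c (scale α β l ψ) := by
  obtain ⟨v, hv, hvu⟩ := hu.scale (α := α) (β := β) (l := l) hψ
  have hn : ∀ x, ‖v x‖ = Real.exp (α * l) * ‖u (Real.exp (-(β * l)) * x)‖ := fun x => by
    rw [hvu, norm_mul, Complex.norm_real, Real.norm_eq_abs, Real.abs_exp]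
  have hle : ∀ x, ‖v x‖ ^ 2 ≤ r₀ := fun x => by
    have h1 : ‖v x‖ ≤ √r₀ := by
      rw [hn, ← hl]
      gcongr
      exact hmax _
    calc ‖v x‖ ^ 2 ≤ (√r₀) ^ 2 := by gcongr
      _ = r₀ := Real.sq_sqrt hr.pos.le
  have h := two_mul_calib_le hσ hωc (scale_mem_X hψ) hv
    (fun x => hr.qfun_nonneg hσ hωc (by positivity) (hle x)) (Real.exp (β * l) * x₀)
  have e : ‖v (Real.exp (β * l) * x₀)‖ ^ 2 = r₀ := by
    rw [hn, ← mul_assoc, ← Real.exp_add, neg_add_cancel, Real.exp_zero, one_mul, hl,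
      Real.sq_sqrt hr.pos.le]
  rwa [e] at h

/-- The lower bound on the action under the constraint. In the case of equality the maximum of the
modulus is that of the soliton, since otherwise a proper scaling has smaller action. -/
theorem calib_le_actionTilde (hσ : 1 ≤ σ) (hωc : Admissible ω c)
    (hαβ : ScalingCondition ω c α β) (hr : IsPeak σ ω c r₀) (hψ : ψ ∈ X σ ω c) (h0 : ψ ≠ 0)
    (hK : constraintTilde σ ω c α β ψ = 0) :
    2 * calib σ ω c r₀ ≤ actionTilde σ ω c ψ ∧
      (actionTilde σ ω c ψ = 2 * calib σ ω c r₀ → ∀ u, IsRep ψ u → ∃ x₀, ‖u x₀‖ = √r₀ ∧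
        ∀ x, ‖u x‖ ≤ ‖u x₀‖) := by
  obtain ⟨h1, h2, -⟩ := hαβ.all hωc
  have hα : 0 < α := by linarith
  have key : ∀ u, IsRep ψ u → ∃ x₀ l, 0 < ‖u x₀‖ ∧ (∀ x, ‖u x‖ ≤ ‖u x₀‖) ∧
      Real.exp (α * l) * ‖u x₀‖ = √r₀ ∧
      2 * calib σ ω c r₀ ≤ actionTilde σ ω c (scale α β l ψ) := by
    intro u hu
    obtain ⟨x₀, hpos, hmax⟩ := hu.exists_max hσ hψ h0
    have hl : Real.exp (α * (Real.log (√r₀ / ‖u x₀‖) / α)) * ‖u x₀‖ = √r₀ := by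
      have : 0 < √r₀ := Real.sqrt_pos.2 hr.pos
      rw [mul_div_cancel₀ _ hα.ne', Real.exp_log (by positivity)]
      field_simp
    exact ⟨x₀, _, hpos, hmax, hl, calib_le_actionTilde_scale hσ hωc hr hψ hu hmax hl⟩
  have hself : ∀ l, l = 0 → actionTilde σ ω c (scale α β l ψ) = actionTilde σ ω c ψ := by
    rintro l rfl
    rw [actionTilde_scale_eq_sum hψ, actionTilde_eq_sum]
    simp
  constructor
  · obtain ⟨u, hu⟩ := X_exists_rep hψ
    obtain ⟨x₀, l, -, -, -, hle⟩ := key u hu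
    rcases eq_or_ne l 0 with hl | hl
    · rwa [hself l hl] at hle
    · exact hle.trans (actionTilde_scale_lt hσ hωc hαβ hψ h0 hK hl).le
  · intro heq u hu
    obtain ⟨x₀, l, hpos, hmax, hexp, hle⟩ := key u hu
    have hl : l = 0 := by
      by_contra hl
      have := actionTilde_scale_lt hσ hωc hαβ hψ h0 hK hl
      linarith
    rw [hl] at hexp
    exact ⟨x₀, by simpa using hexp, hmax⟩

theorem abs_log_le_two_mul {x : ℝ} (hx : 1 / 2 ≤ x) : |Real.log x| ≤ 2 * |x - 1| := by
  have hx0 : 0 < x := by linarith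
  have h1 := Real.log_le_sub_one_of_pos hx0
  have h2 := Real.one_sub_inv_le_log_of_pos hx0
  have h3 : |x - 1| = x * |1 - x⁻¹| := by
    rw [← abs_of_pos hx0, ← abs_mul, abs_of_pos hx0]
    congr 1
    field_simp
  rw [abs_le]
  constructor
  · have h4 := neg_abs_le (1 - x⁻¹)
    have h5 : |1 - x⁻¹| ≤ 2 * |x - 1| := by
      rw [h3]
      nlinarith [abs_nonneg (1 - x⁻¹)]
    linarith
  · linarith [le_abs_self (x - 1), abs_nonneg (x - 1)]

/-- Near a function of least action satisfying the constraint, the action does not drop faster than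
quadratically: every neighbour can be rescaled, by an amount comparable to its distance, to have
the maximum of the soliton, and the rescaling changes the action to second order only because the
scaling derivative vanishes at the given function. -/
theorem actionTilde_ge_near (hσ : 1 ≤ σ) (hωc : Admissible ω c)
    (hαβ : ScalingCondition ω c α β) (hr : IsPeak σ ω c r₀) (hψ : ψ ∈ X σ ω c) (h0 : ψ ≠ 0)
    (hK : constraintTilde σ ω c α β ψ = 0) (hS : actionTilde σ ω c ψ = 2 * calib σ ω c r₀) :
    ∃ C δ, 0 ≤ C ∧ 0 < δ ∧ δ ≤ 1 ∧ ∀ h ∈ X σ ω c, normX σ ω c h ≤ 1 → ∀ t : ℝ, |t| ≤ δ →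
      actionTilde σ ω c ψ - C * t ^ 2 ≤ actionTilde σ ω c (ψ + t • h) := by
  obtain ⟨h1, h2, -⟩ := hαβ.all hωc
  have hα : 0 < α := by linarith
  obtain ⟨u, hu⟩ := X_exists_rep hψ
  obtain ⟨x₀, hx₀, hmax⟩ := (calib_le_actionTilde hσ hωc hαβ hr hψ h0 hK).2 hS u hu
  obtain ⟨C, hC, hLip⟩ := term_lipschitz hσ hωc hψ
  set s₀ := √r₀ with hs₀
  have hs₀pos : 0 < s₀ := Real.sqrt_pos.2 hr.pos
  -- `R` bounds the rates, `T` bounds the terms, `B` is the ratio of `l` and `t`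
  obtain ⟨R, hR0, hR⟩ : ∃ R, 0 < R ∧ ∀ i, |rate σ α β i| ≤ R := by
    refine ⟨1 + ∑ i, |rate σ α β i|, by positivity, fun i => ?_⟩
    have := Finset.single_le_sum (f := fun i => |rate σ α β i|) (fun i _ => abs_nonneg _)
      (Finset.mem_univ i)
    linarith
  obtain ⟨T, hT0, hT⟩ : ∃ T, 0 ≤ T ∧ ∀ i, |term σ ω c i ψ| ≤ T := by
    refine ⟨∑ i, |term σ ω c i ψ|, by positivity, fun i => ?_⟩
    exact Finset.single_le_sum (f := fun i => |term σ ω c i ψ|) (fun i _ => abs_nonneg _)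
      (Finset.mem_univ i)
  set B := 2 / (s₀ * α) with hB
  have hB0 : 0 < B := by positivity
  refine ⟨4 * (R ^ 2 * B ^ 2 * (T + C) + R * B * C), min (min 1 (s₀ / 2)) (1 / (R * B)),
    by positivity, by positivity, (min_le_left _ _).trans (min_le_left _ _), ?_⟩
  intro h hh hn t ht
  have ht1 : |t| ≤ 1 := ht.trans ((min_le_left _ _).trans (min_le_left _ _))
  have ht2 : |t| ≤ s₀ / 2 := ht.trans ((min_le_left _ _).trans (min_le_right _ _))
  have ht3 : |t| ≤ 1 / (R * B) := ht.trans (min_le_right _ _)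
  set χ := ψ + t • h with hχ
  have hχX : χ ∈ X σ ω c := (X_add hψ (X_smul hh t).1).1
  obtain ⟨v, hv⟩ := X_exists_rep hχX
  obtain ⟨w, hw⟩ := X_exists_rep hh
  have hvw : ∀ x, v x = u x + t • w x := by
    intro x
    refine congrFun (Measure.eq_of_ae_eq (μ := volume) (f := v) (g := fun x => u x + t • w x) ?_
      hv.continuous (hu.continuous.add (hw.continuous.const_smul t))) x
    filter_upwards [hv.ae_eq, hu.ae_eq, hw.ae_eq, AEEqFun.coeFn_add ψ (t • h),
      AEEqFun.coeFn_smul t h] with x e1 e2 e3 e4 e5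
    rw [← e1, ← e2, ← e3, hχ, e4, Pi.add_apply, e5, Pi.smul_apply]
  have hclose : ∀ x, ‖v x - u x‖ ≤ |t| := by
    intro x
    rw [hvw, add_sub_cancel_left, norm_smul, Real.norm_eq_abs]
    exact mul_le_of_le_one_right (abs_nonneg t) ((norm_le_normX hσ hh hw x).trans hn)
  have hχ0 : χ ≠ 0 := by
    intro hzero
    have hv0 : v = fun _ => 0 := Measure.eq_of_ae_eq (μ := volume) (by
      filter_upwards [hv.ae_eq, AEEqFun.coeFn_zero (α := ℝ) (β := ℂ) (μ := volume)] with x e1 e2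
      rw [← e1, hzero, e2]; rfl) hv.continuous continuous_const
    have := hclose x₀
    rw [hv0, zero_sub, norm_neg, hx₀] at this
    linarith
  obtain ⟨y, hypos, hymax⟩ := hv.exists_max hσ hχX hχ0
  have hMs : |‖v y‖ - s₀| ≤ |t| := by
    rw [abs_le]
    constructor
    · have e1 : ‖u x₀‖ ≤ ‖v x₀‖ + ‖v x₀ - u x₀‖ := by
        have := norm_sub_le (v x₀) (v x₀ - u x₀)
        rwa [sub_sub_cancel] at this
      linarith [hclose x₀, hymax x₀]
    · have e1 : ‖v y‖ ≤ ‖u y‖ + ‖v y - u y‖ := by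
        have := norm_add_le (u y) (v y - u y)
        rwa [add_sub_cancel] at this
      linarith [hclose y, hmax y]
  set l := -Real.log (‖v y‖ / s₀) / α with hl
  have hlB : |l| ≤ B * |t| := by
    rw [hl, abs_div, abs_neg, abs_of_pos hα, div_le_iff₀ hα]
    have e0 : ‖v y‖ / s₀ - 1 = (‖v y‖ - s₀) / s₀ := by field_simp
    have e1 : 1 / 2 ≤ ‖v y‖ / s₀ := by
      rw [le_div_iff₀ hs₀pos]
      linarith [(abs_le.1 hMs).1]
    refine (abs_log_le_two_mul e1).trans ?_
    rw [e0, abs_div, abs_of_pos hs₀pos, hB]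
    calc 2 * (|‖v y‖ - s₀| / s₀) ≤ 2 * (|t| / s₀) := by gcongr
      _ = _ := by field_simp
  have hexp : Real.exp (α * l) * ‖v y‖ = s₀ := by
    rw [hl, mul_div_cancel₀ _ hα.ne', ← Real.log_inv, Real.exp_log (by positivity)]
    field_simp
  have hlow := calib_le_actionTilde_scale (β := β) hσ hωc hr hχX hv hymax hexp
  rw [← hS, actionTilde_scale_eq_sum hχX] at hlow
  rw [constraintTilde_eq_sum hψ] at hK
  rw [actionTilde_eq_sum χ]
  have hdiff : ∑ i, Real.exp (rate σ α β i * l) * term σ ω c i χ - ∑ i, term σ ω c i χ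
      = ∑ i, ((Real.exp (rate σ α β i * l) - 1 - rate σ α β i * l) * term σ ω c i χ
        + l * rate σ α β i * (term σ ω c i χ - term σ ω c i ψ)) := by
    have e : ∑ i, ((Real.exp (rate σ α β i * l) - 1 - rate σ α β i * l) * term σ ω c i χ
        + l * rate σ α β i * (term σ ω c i χ - term σ ω c i ψ))
        = ∑ i, Real.exp (rate σ α β i * l) * term σ ω c i χ - ∑ i, term σ ω c i χ
          - l * ∑ i, rate σ α β i * term σ ω c i ψ := by
      rw [Finset.mul_sum, ← Finset.sum_sub_distrib, ← Finset.sum_sub_distrib]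
      refine Finset.sum_congr rfl fun i _ => ?_
      ring
    rw [e, hK]
    ring
  have hbound : ∀ i, (Real.exp (rate σ α β i * l) - 1 - rate σ α β i * l) * term σ ω c i χ
        + l * rate σ α β i * (term σ ω c i χ - term σ ω c i ψ)
        ≤ (R ^ 2 * B ^ 2 * (T + C) + R * B * C) * t ^ 2 := by
    intro i
    have l1 := hLip i h hh hn t ht1
    have l2 : |term σ ω c i χ| ≤ T + C := by
      have e1 := abs_sub_abs_le_abs_sub (term σ ω c i χ) (term σ ω c i ψ)
      have e2 : C * |t| ≤ C * 1 := by gcongr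
      linarith [hT i]
    have hrl : |rate σ α β i * l| ≤ R * (B * |t|) := by
      rw [abs_mul]
      exact mul_le_mul (hR i) hlB (abs_nonneg _) hR0.le
    have hrl1 : |rate σ α β i * l| ≤ 1 := by
      refine hrl.trans ?_
      rw [← mul_assoc]
      calc R * B * |t| ≤ R * B * (1 / (R * B)) := by gcongr
        _ = 1 := by field_simp
    have l3 := Real.abs_exp_sub_one_sub_id_le hrl1
    have l4 : (rate σ α β i * l) ^ 2 ≤ R ^ 2 * B ^ 2 * t ^ 2 := by
      rw [← sq_abs]
      calc _ ≤ (R * (B * |t|)) ^ 2 := by gcongr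
        _ = R ^ 2 * B ^ 2 * |t| ^ 2 := by ring
        _ = _ := by rw [sq_abs]
    have p1 : (Real.exp (rate σ α β i * l) - 1 - rate σ α β i * l) * term σ ω c i χ
        ≤ (R ^ 2 * B ^ 2 * t ^ 2) * (T + C) := by
      refine (le_abs_self _).trans ?_
      rw [abs_mul]
      exact mul_le_mul (l3.trans l4) l2 (abs_nonneg _) (by positivity)
    have p2 : l * rate σ α β i * (term σ ω c i χ - term σ ω c i ψ)
        ≤ (R * (B * |t|)) * (C * |t|) := by
      refine (le_abs_self _).trans ?_
      rw [abs_mul, mul_comm l]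
      exact mul_le_mul hrl l1 (abs_nonneg _) (by positivity)
    have p3 : (R * (B * |t|)) * (C * |t|) = R * B * C * t ^ 2 := by
      rw [← sq_abs t]; ring
    linarith
  have hsum := Finset.sum_le_sum fun i (_ : i ∈ (Finset.univ : Finset (Fin 4))) => hbound i
  rw [← hdiff, Finset.sum_const, Finset.card_univ, Fintype.card_fin, nsmul_eq_mul] at hsum
  push_cast at hsum
  linarith

/-- The first variation of the action. -/
noncomputable def firstVariation (σ ω c : ℝ) (ψ h : Fn) : ℝ :=
  ∫ x, firstVar σ ω c (jet ψ x) (jet h x)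

/-- The action is differentiable at every function in `X`, with a quadratic remainder that is
uniform in the unit ball. -/
theorem actionTilde_expansion (hσ : 1 ≤ σ) (hωc : Admissible ω c) (hψ : ψ ∈ X σ ω c) :
    ∃ C, 0 ≤ C ∧ ∀ h ∈ X σ ω c, normX σ ω c h ≤ 1 → ∀ t : ℝ, |t| ≤ 1 →
      |actionTilde σ ω c (ψ + t • h) - actionTilde σ ω c ψ - t * firstVariation σ ω c ψ h|
        ≤ C * t ^ 2 := by
  obtain ⟨C, hC, hb⟩ := (hasExpansion_actDens hσ hωc).integral hσ hωc hψ
  refine ⟨C, hC, fun h hh hn t ht => ?_⟩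
  rw [(actionTilde_eq_integral hσ hωc (X_add hψ (X_smul hh t).1).1).2,
    (actionTilde_eq_integral hσ hωc hψ).2]
  exact (hb h hh hn).2 t ht

theorem actionDerivVanishes_of_minimal (hσ : 1 ≤ σ) (hωc : Admissible ω c)
    (hαβ : ScalingCondition ω c α β) (hr : IsPeak σ ω c r₀) (hψ : gauge c φ ∈ X σ ω c)
    (h0 : gauge c φ ≠ 0) (hK : constraintTilde σ ω c α β (gauge c φ) = 0)
    (hS : actionTilde σ ω c (gauge c φ) = 2 * calib σ ω c r₀) :
    ActionDerivVanishes σ ω c φ := by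
  obtain ⟨C, δ, hC, hδ, hδ1, hlow⟩ := actionTilde_ge_near hσ hωc hαβ hr hψ h0 hK hS
  obtain ⟨D, hD, hexp⟩ := actionTilde_expansion hσ hωc hψ
  set ψ := gauge c φ
  -- the linear term changes sign with `t`, so that it has to vanish
  have hfirst : ∀ h ∈ X σ ω c, normX σ ω c h ≤ 1 → firstVariation σ ω c ψ h = 0 := by
    intro h hh hn
    have hb : ∀ t : ℝ, |t| ≤ δ → -(C + D) * t ^ 2 ≤ t * firstVariation σ ω c ψ h := by
      intro t ht
      have h1 := hlow h hh hn t ht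
      have h2 := (abs_le.1 (hexp h hh hn t (ht.trans hδ1))).2
      linarith
    set m := firstVariation σ ω c ψ h
    by_contra hne
    have hm : 0 < |m| := abs_pos.2 hne
    set s := min δ (|m| / (2 * (C + D + 1))) with hs
    have hs0 : 0 < s := by positivity
    have hsδ : s ≤ δ := min_le_left _ _
    have hsm : s * (2 * (C + D + 1)) ≤ |m| := by
      rw [← le_div_iff₀ (by positivity)]
      exact min_le_right _ _
    have h1 := hb s (by rwa [abs_of_pos hs0])
    have h2 := hb (-s) (by rwa [abs_neg, abs_of_pos hs0])
    have h3 : s * |m| ≤ (C + D) * s ^ 2 := by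
      rcases abs_cases m with ⟨h4, -⟩ | ⟨h4, -⟩ <;> rw [h4] <;> nlinarith
    nlinarith
  intro ε hε
  refine ⟨min 1 (ε / (D + 1)), by positivity, fun h hh hn => ?_⟩
  set η := gauge c h
  have hadd : gauge c (φ + h) = ψ + η := gauge_add c φ h
  rw [action_eq hσ (by rw [hadd]; exact (X_add hψ hh).1), action_eq hσ hψ, hadd]
  set n := normX σ ω c η with hndef
  have hn0 : 0 ≤ n := normX_nonneg
  rcases hn0.eq_or_lt with hz | hpos
  · have : η = 0 := eq_zero_of_normX hσ hh hz.symm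
    rw [this, ← hz, add_zero, sub_self, abs_zero, mul_zero]
  · have h1 : normX σ ω c (n⁻¹ • η) = 1 := by
      rw [normX_smul hh, abs_of_pos (by positivity), ← hndef, inv_mul_cancel₀ hpos.ne']
    have h2 : η = n • (n⁻¹ • η) := by rw [smul_smul, mul_inv_cancel₀ hpos.ne', one_smul]
    have hn1 : |n| ≤ 1 := by
      rw [abs_of_pos hpos]; exact hn.le.trans (min_le_left _ _)
    have h3 := hexp _ (X_smul hh n⁻¹).1 h1.le n hn1
    rw [hfirst _ (X_smul hh n⁻¹).1 h1.le, ← h2, mul_zero, sub_zero] at h3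
    refine h3.trans ?_
    have h4 : n * (D + 1) ≤ ε := by
      rw [← le_div_iff₀ (by positivity)]
      exact hn.le.trans (min_le_right _ _)
    nlinarith

/-- The Fréchet condition of `ActionDerivVanishes` forces the first variation to vanish. -/
theorem firstVariation_eq_zero (hσ : 1 ≤ σ) (hωc : Admissible ω c) (hψ : gauge c φ ∈ X σ ω c)
    (hcrit : ActionDerivVanishes σ ω c φ) (hh : h ∈ X σ ω c) (hn : normX σ ω c h ≤ 1) :
    firstVariation σ ω c (gauge c φ) h = 0 := by
  obtain ⟨D, hD, hexp⟩ := actionTilde_expansion hσ hωc hψ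
  set ψ := gauge c φ with hψdef
  set m := firstVariation σ ω c ψ h
  by_contra hne
  have hm : 0 < |m| := abs_pos.2 hne
  obtain ⟨δ, hδ, hb⟩ := hcrit (|m| / 2) (by positivity)
  set s := min (min 1 (δ / 2)) (|m| / (4 * (D + 1))) with hs
  have hs0 : 0 < s := by positivity
  have hs1 : s ≤ 1 := (min_le_left _ _).trans (min_le_left _ _)
  have hsδ : s ≤ δ / 2 := (min_le_left _ _).trans (min_le_right _ _)
  have hsm : s * (4 * (D + 1)) ≤ |m| := by
    rw [← le_div_iff₀ (by positivity)]
    exact min_le_right _ _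
  obtain ⟨h', hh'⟩ := gauge_surjective c (s • h)
  have hX := (X_smul hh s).1
  have hns : normX σ ω c (s • h) ≤ s := by
    rw [normX_smul hh, abs_of_pos hs0]
    exact mul_le_of_le_one_right hs0.le hn
  have h1 := hb h' (by rwa [hh']) (by rw [hh']; linarith)
  have hadd : gauge c (φ + h') = ψ + s • h := by rw [gauge_add, hh']
  rw [action_eq hσ (by rw [hadd]; exact (X_add hψ hX).1), action_eq hσ hψ, hadd, hh'] at h1
  have h2 := hexp h hh hn s (by rwa [abs_of_pos hs0])
  have h3 : |s * m| ≤ |m| / 2 * s + D * s ^ 2 := by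
    have e : s * m = (actionTilde σ ω c (ψ + s • h) - actionTilde σ ω c ψ)
        - (actionTilde σ ω c (ψ + s • h) - actionTilde σ ω c ψ - s * m) := by ring
    rw [e]
    refine (abs_sub _ _).trans (add_le_add (h1.trans ?_) h2)
    gcongr
  rw [abs_mul, abs_of_pos hs0] at h3
  nlinarith

end Variation

/-! ### Regularity of critical points -/

section EulerLagrange

open Filter Set

variable {σ ω c : ℝ} {ψ h : Fn} {u : ℝ → ℂ}

/-- The right hand side of the Euler-Lagrange equation `∂ₓ p = force`, where `p` is the covariant
derivative of `z` and `w` is the derivative of `z`. -/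
noncomputable def force (σ ω c : ℝ) (z w : ℂ) : ℂ :=
  (((ω - c ^ 2 / 4) + c / 2 * ‖z‖ ^ (2 * σ)
      + 1 / (2 * σ + 2) * (2 * σ * ‖z‖ ^ (2 * σ - 2) * ((starRingEnd ℂ) z * w).im) : ℝ) : ℂ) * z
    - Complex.I * ((1 / (2 * σ + 2) * ‖z‖ ^ (2 * σ) : ℝ) : ℂ) * w

/-- The first variation is the real pairing with the covariant derivative and the force. -/
theorem firstVar_eq (hσ : 1 ≤ σ) (z w a b : ℂ) : firstVar σ ω c (z, w) (a, b) =
    ((starRingEnd ℂ) (covD σ z w) * b).re + ((starRingEnd ℂ) (force σ ω c z w) * a).re := by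
  have hne : 2 * σ + 2 ≠ 0 := by linarith
  unfold firstVar covD force
  have e : c / (2 * (2 * σ + 2)) * (2 * σ + 2) = c / 2 := by field_simp
  simp only
  rw [← mul_assoc (c / (2 * (2 * σ + 2))), e]
  generalize ‖z‖ ^ (2 * σ) = m
  generalize ‖z‖ ^ (2 * σ - 2) = n
  generalize 1 / (2 * σ + 2) = k
  generalize ω - c ^ 2 / 4 = A
  generalize c / 2 = d
  simp
  ring

theorem firstVariation_smul (hσ : 1 ≤ σ) (hh : h ∈ X σ ω c) (t : ℝ) :
    firstVariation σ ω c ψ (t • h) = t * firstVariation σ ω c ψ h := by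
  unfold firstVariation
  rw [← integral_const_mul]
  refine integral_congr_ae ?_
  filter_upwards [AEEqFun.coeFn_smul t h, AEEqFun.coeFn_smul t (weakDeriv h)] with x h1 h2
  rw [jet, jet, jet, (X_smul hh t).2, h1, h2, firstVar_eq hσ, firstVar_eq hσ]
  simp
  ring

theorem firstVariation_eq_zero_of_unitBall (hσ : 1 ≤ σ)
    (hcrit : ∀ h ∈ X σ ω c, normX σ ω c h ≤ 1 → firstVariation σ ω c ψ h = 0)
    (hh : h ∈ X σ ω c) : firstVariation σ ω c ψ h = 0 := by
  have hn : 0 ≤ normX σ ω c h := normX_nonneg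
  have hpos : 0 < (normX σ ω c h + 1)⁻¹ := by positivity
  have h1 := hcrit _ (X_smul hh (normX σ ω c h + 1)⁻¹).1 (by
    rw [normX_smul hh, abs_of_pos hpos, inv_mul_le_iff₀ (by positivity)]
    linarith)
  rw [firstVariation_smul hσ hh] at h1
  exact (mul_eq_zero.1 h1).resolve_left hpos.ne'

/-- Smooth compactly supported functions with a complex direction `ζ` belong to `X`. -/
theorem exists_testFunction {η : ℝ → ℝ} (hη : ContDiff ℝ ((⊤ : ℕ∞) : WithTop ℕ∞) η)
    (hc : HasCompactSupport η) (ζ : ℂ) :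
    ∃ h ∈ X σ ω c, h =ᵐ[volume] (fun x => ζ * (η x : ℂ)) ∧
      weakDeriv h =ᵐ[volume] fun x => ζ * ((deriv η x : ℝ) : ℂ) := by
  have c0 : Continuous fun x => ζ * (η x : ℂ) :=
    continuous_const.mul (Complex.continuous_ofReal.comp hη.continuous)
  have c1 : Continuous fun x => ζ * ((deriv η x : ℝ) : ℂ) :=
    continuous_const.mul (Complex.continuous_ofReal.comp (hη.continuous_deriv (by simp)))
  have s0 : HasCompactSupport fun x => ζ * (η x : ℂ) :=
    (hc.comp_left (g := Complex.ofReal) rfl).mul_left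
  have s1 : HasCompactSupport fun x => ζ * ((deriv η x : ℝ) : ℂ) :=
    (hc.deriv.comp_left (g := Complex.ofReal) rfl).mul_left
  have hw : HasWeakDeriv (fun x => ζ * (η x : ℂ)) fun x => ζ * ((deriv η x : ℝ) : ℂ) :=
    HasWeakDeriv.of_hasDerivAt (fun x =>
      ((hη.differentiable (by simp)).differentiableAt.hasDerivAt.ofReal_comp).const_mul ζ) c1
  have e0 := AEEqFun.coeFn_mk (μ := volume) _ c0.aestronglyMeasurable
  have e1 := AEEqFun.coeFn_mk (μ := volume) _ c1.aestronglyMeasurable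
  have hW : IsWeakDeriv (AEEqFun.mk _ c0.aestronglyMeasurable)
      (AEEqFun.mk _ c1.aestronglyMeasurable) := hw.congr e0.symm e1.symm
  refine ⟨AEEqFun.mk _ c0.aestronglyMeasurable, ⟨?_, _, hW, ?_⟩, e0, ?_⟩
  · exact (c0.memLp_of_hasCompactSupport s0).ae_eq e0.symm
  · exact (c1.memLp_of_hasCompactSupport s1).ae_eq e1.symm
  · rw [hW.weakDeriv_eq]
    exact e1

theorem continuous_norm_rpow (hu : Continuous u) {s : ℝ} (hs : 0 ≤ s) :
    Continuous fun x => ‖u x‖ ^ s :=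
  (Real.continuous_rpow_const hs).comp hu.norm

theorem locallyIntegrable_conj {f : ℝ → ℂ} (hf : LocallyIntegrable f volume) :
    LocallyIntegrable (fun x => (starRingEnd ℂ) (f x)) volume :=
  hf.mono (Complex.continuous_conj.comp_aestronglyMeasurable hf.aestronglyMeasurable)
    (Eventually.of_forall fun x => by simp)

theorem locallyIntegrable_covD (hσ : 1 ≤ σ) {w : ℝ → ℂ} (hu : Continuous u)
    (hw : LocallyIntegrable w volume) :
    LocallyIntegrable (fun x => covD σ (u x) (w x)) volume := by
  unfold covD
  refine hw.add (Continuous.locallyIntegrable ?_)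
  have := continuous_norm_rpow hu (s := 2 * σ) (by linarith)
  fun_prop

theorem locallyIntegrable_force (hσ : 1 ≤ σ) {w : ℝ → ℂ} (hu : Continuous u)
    (hw : LocallyIntegrable w volume) :
    LocallyIntegrable (fun x => force σ ω c (u x) (w x)) volume := by
  have c1 := continuous_norm_rpow hu (s := 2 * σ) (by linarith)
  have c2 := continuous_norm_rpow hu (s := 2 * σ - 2) (by linarith)
  have i1 : LocallyIntegrable (fun x => (((ω - c ^ 2 / 4) + c / 2 * ‖u x‖ ^ (2 * σ) : ℝ) : ℂ) * u x)
      volume := Continuous.locallyIntegrable (by fun_prop)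
  have i2 := locallyIntegrable_continuous_mul (e := fun x =>
    ((1 / (2 * σ + 2) * (2 * σ * ‖u x‖ ^ (2 * σ - 2)) / 2 : ℝ) : ℂ) * u x *
      (-Complex.I * (starRingEnd ℂ) (u x))
      - Complex.I * ((1 / (2 * σ + 2) * ‖u x‖ ^ (2 * σ) : ℝ) : ℂ)) (by fun_prop) hw
  have i3 := locallyIntegrable_continuous_mul (e := fun x =>
    ((1 / (2 * σ + 2) * (2 * σ * ‖u x‖ ^ (2 * σ - 2)) / 2 : ℝ) : ℂ) * u x *
      (Complex.I * u x)) (by fun_prop) (locallyIntegrable_conj hw)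
  refine (locallyIntegrable_congr (Eventually.of_forall fun x => ?_)).1 ((i1.add i2).add i3)
  simp only [Pi.add_apply, force]
  generalize ‖u x‖ ^ (2 * σ) = m
  generalize ‖u x‖ ^ (2 * σ - 2) = n
  generalize 1 / (2 * σ + 2) = k
  generalize ω - c ^ 2 / 4 = A
  generalize c / 2 = d
  apply Complex.ext <;> simp <;> ring

/-- The Euler-Lagrange equation in the sense of distributions. -/
theorem hasWeakDeriv_covD (hσ : 1 ≤ σ) (hu : IsRep ψ u)
    (hcrit : ∀ h ∈ X σ ω c, normX σ ω c h ≤ 1 → firstVariation σ ω c ψ h = 0) :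
    HasWeakDeriv (fun x => covD σ (u x) (weakDeriv ψ x))
      (fun x => force σ ω c (u x) (weakDeriv ψ x)) := by
  have l1 := locallyIntegrable_covD hσ hu.continuous hu.loc
  have l2 := locallyIntegrable_force (ω := ω) (c := c) hσ hu.continuous hu.loc
  refine ⟨l1, l2, fun η hη hc => ?_⟩
  set p := fun x => covD σ (u x) (weakDeriv ψ x) with hp
  set g := fun x => force σ ω c (u x) (weakDeriv ψ x) with hg
  have i1 : Integrable fun x => deriv η x • p x :=
    l1.integrable_smul_left_of_hasCompactSupport (hη.continuous_deriv (by simp)) hc.deriv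
  have i2 : Integrable fun x => η x • g x :=
    l2.integrable_smul_left_of_hasCompactSupport hη.continuous hc
  -- the first variation is only real linear: test real and imaginary directions separately
  have key : ∀ ζ : ℂ, ((starRingEnd ℂ) ζ * ∫ x, (deriv η x • p x + η x • g x)).re = 0 := by
    intro ζ
    obtain ⟨h, hh, e0, e1⟩ := exists_testFunction (σ := σ) (ω := ω) (c := c) hη hc ζ
    have h1 := firstVariation_eq_zero_of_unitBall hσ hcrit hh
    have i3 : Integrable fun x => (starRingEnd ℂ) ζ * (deriv η x • p x + η x • g x) :=
      (i1.add i2).const_mul _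
    rw [← integral_const_mul]
    have h2 := integral_re i3
    simp only [RCLike.re_eq_complex_re] at h2
    rw [← h2, ← h1]
    refine integral_congr_ae ?_
    filter_upwards [e0, e1, hu.ae_eq] with x h3 h4 h5
    rw [jet, jet, h3, h4, h5, firstVar_eq hσ]
    simp [hp, hg]
    ring
  have hz : ∫ x, (deriv η x • p x + η x • g x) = 0 := by
    apply Complex.ext
    · simpa using key 1
    · simpa using key Complex.I
  rw [integral_add i1 i2] at hz
  exact eq_neg_of_add_eq_zero_left hz

theorem continuous_force (hσ : 1 ≤ σ) {w : ℝ → ℂ} (hu : Continuous u) (hw : Continuous w) :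
    Continuous fun x => force σ ω c (u x) (w x) := by
  have c1 := continuous_norm_rpow hu (s := 2 * σ) (by linarith)
  have c2 := continuous_norm_rpow hu (s := 2 * σ - 2) (by linarith)
  unfold force
  fun_prop

theorem hasDerivAt_of_primitive {g u : ℝ → ℂ} (hg : Continuous g)
    (hu : ∀ x, u x = u 0 + ∫ t in (0:ℝ)..x, g t) (x : ℝ) : HasDerivAt u (g x) x := by
  rw [show u = fun x => u 0 + ∫ t in (0:ℝ)..x, g t from funext hu]
  exact (intervalIntegral.integral_hasDerivAt_right (hg.intervalIntegrable _ _)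
    (hg.stronglyMeasurableAtFilter _ _) hg.continuousAt).const_add _

/-- A critical point is twice differentiable: its representative and covariant derivative solve the
Euler-Lagrange equation in the classical sense. -/
theorem classical_eulerLagrange (hσ : 1 ≤ σ) (hu : IsRep ψ u)
    (hcrit : ∀ h ∈ X σ ω c, normX σ ω c h ≤ 1 → firstVariation σ ω c ψ h = 0) :
    ∃ p : ℝ → ℂ, (fun x => covD σ (u x) (weakDeriv ψ x)) =ᵐ[volume] p ∧
      (∀ x, HasDerivAt u
        (p x - Complex.I * ((1 / (2 * σ + 2) * ‖u x‖ ^ (2 * σ) : ℝ) : ℂ) * u x) x) ∧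
      ∀ x, HasDerivAt p (force σ ω c (u x)
        (p x - Complex.I * ((1 / (2 * σ + 2) * ‖u x‖ ^ (2 * σ) : ℝ) : ℂ) * u x)) x := by
  have hw := hasWeakDeriv_covD hσ hu hcrit
  obtain ⟨p, hpe, hpp⟩ := hw.exists_primitive
  have hpc := continuous_of_primitive hw.2.1 hpp
  have huc := hu.continuous
  have c1 := continuous_norm_rpow huc (s := 2 * σ) (by linarith)
  set W : ℝ → ℂ := fun x =>
    p x - Complex.I * ((1 / (2 * σ + 2) * ‖u x‖ ^ (2 * σ) : ℝ) : ℂ) * u x with hW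
  have hWc : Continuous W := by fun_prop
  have hwW : weakDeriv ψ =ᵐ[volume] W := by
    filter_upwards [hpe] with x hx
    rw [hW]
    simp only
    rw [← hx, covD]
    ring
  refine ⟨p, hpe, fun x => ?_, fun x => ?_⟩
  · refine hasDerivAt_of_primitive hWc (fun x => ?_) x
    rw [hu.primitive x]
    congr 1
    exact intervalIntegral.integral_congr_ae (by filter_upwards [hwW] with t ht _; exact ht)
  · refine hasDerivAt_of_primitive (g := fun x => force σ ω c (u x) (W x))
      (continuous_force hσ huc hWc) (fun x => ?_) x
    rw [hpp x]
    congr 1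
    exact intervalIntegral.integral_congr_ae
      (by filter_upwards [hwW] with t ht _; rw [ht])

end EulerLagrange

/-! ### Conserved quantities of the Euler-Lagrange equation -/

section Integration

open Filter Set

variable {σ ω c : ℝ} {ψ : Fn} {u p : ℝ → ℂ}

theorem hasDerivAt_re {u' : ℂ} {x : ℝ} (h : HasDerivAt u u' x) :
    HasDerivAt (fun x => (u x).re) u'.re x :=
  Complex.reCLM.hasFDerivAt.comp_hasDerivAt x h

theorem hasDerivAt_im {u' : ℂ} {x : ℝ} (h : HasDerivAt u u' x) :
    HasDerivAt (fun x => (u x).im) u'.im x :=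
  Complex.imCLM.hasFDerivAt.comp_hasDerivAt x h

theorem hasDerivAt_re_conj_mul {u' p' : ℂ} {x : ℝ} (hu : HasDerivAt u u' x)
    (hp : HasDerivAt p p' x) : HasDerivAt (fun x => ((starRingEnd ℂ) (u x) * p x).re)
      (((starRingEnd ℂ) u' * p x).re + ((starRingEnd ℂ) (u x) * p').re) x := by
  have h := ((hasDerivAt_re hu).mul (hasDerivAt_re hp)).add
    ((hasDerivAt_im hu).mul (hasDerivAt_im hp))
  refine (h.congr_of_eventuallyEq (Eventually.of_forall fun y => ?_)).congr_deriv ?_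
  · simp
  · simp; ring

theorem hasDerivAt_im_conj_mul {u' p' : ℂ} {x : ℝ} (hu : HasDerivAt u u' x)
    (hp : HasDerivAt p p' x) : HasDerivAt (fun x => ((starRingEnd ℂ) (u x) * p x).im)
      (((starRingEnd ℂ) u' * p x).im + ((starRingEnd ℂ) (u x) * p').im) x := by
  have h := ((hasDerivAt_re hu).mul (hasDerivAt_im hp)).sub
    ((hasDerivAt_im hu).mul (hasDerivAt_re hp))
  refine (h.congr_of_eventuallyEq (Eventually.of_forall fun y => ?_)).congr_deriv ?_
  · simp; ring
  · simp; ring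

theorem hasDerivAt_normSq {u' : ℂ} {x : ℝ} (hu : HasDerivAt u u' x) :
    HasDerivAt (fun x => ‖u x‖ ^ 2) (2 * ((starRingEnd ℂ) (u x) * u').re) x := by
  refine hu.norm_sq.congr_deriv ?_
  rw [Complex.inner, mul_comm u']

/-- The coefficient of the Euler-Lagrange equation for functions without momentum. -/
noncomputable def coeffU (σ ω c r : ℝ) : ℝ :=
  (ω - c ^ 2 / 4) + c / 2 * r ^ σ - (2 * σ + 1) * (1 / (2 * σ + 2)) ^ 2 * (r ^ σ) ^ 2

/-- The force in terms of the covariant derivative `q`: a real multiple of `z` plus the phase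
rotation of `q`. The last summand of the real coefficient contains the momentum density. -/
theorem force_eq (hσ : 1 ≤ σ) (z q : ℂ) : force σ ω c z
      (q - Complex.I * ((1 / (2 * σ + 2) * ‖z‖ ^ (2 * σ) : ℝ) : ℂ) * z) =
    ((coeffU σ ω c (‖z‖ ^ 2) + 1 / (2 * σ + 2) * (2 * σ * ‖z‖ ^ (2 * σ - 2))
        * ((starRingEnd ℂ) z * q).im : ℝ) : ℂ) * z
      - Complex.I * ((1 / (2 * σ + 2) * ‖z‖ ^ (2 * σ) : ℝ) : ℂ) * q := by
  have e : ‖z‖ ^ (2 * σ) = ‖z‖ ^ (2 * σ - 2) * (z.re * z.re + z.im * z.im) := by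
    rw [← Complex.normSq_apply, Complex.normSq_eq_norm_sq, ← Real.rpow_two ‖z‖,
      ← Real.rpow_add_of_nonneg (norm_nonneg z) (by linarith) (by norm_num)]
    congr 1
    ring
  unfold force coeffU
  rw [norm_sq_rpow, e]
  generalize ‖z‖ ^ (2 * σ - 2) = n
  generalize 1 / (2 * σ + 2) = k
  generalize ω - c ^ 2 / 4 = A
  generalize c / 2 = d
  simp only [sq]
  apply Complex.ext <;> simp <;> ring

theorem rpow_two_mul (σ : ℝ) {r : ℝ} (hr : 0 ≤ r) : r ^ (2 * σ) = (r ^ σ) ^ 2 := by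
  rw [← Real.rpow_mul_natCast hr]
  congr 1
  push_cast
  ring

/-- The coefficient `coeffU` is the derivative of the potential `r q(r)`, `r = |z|²`. -/
theorem hasDerivAt_potential (hσ : 1 ≤ σ) {r : ℝ} (hr : 0 ≤ r) :
    HasDerivAt (fun r => r * qfun σ ω c r) (coeffU σ ω c r) r := by
  have h1 := Real.hasDerivAt_rpow_const (x := r) (p := σ) (Or.inr hσ)
  have h2 := Real.hasDerivAt_rpow_const (x := r) (p := 2 * σ) (Or.inr (by linarith))
  have h := (hasDerivAt_id r).mul
    (((h1.const_mul (c / (2 * σ + 2))).const_add (ω - c ^ 2 / 4)).sub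
      (h2.const_mul ((1 / (2 * σ + 2)) ^ 2)))
  refine h.congr_deriv ?_
  have e1 : r ^ σ = r * r ^ (σ - 1) := by
    conv_lhs => rw [show σ = 1 + (σ - 1) by ring,
      Real.rpow_add_of_nonneg hr (by norm_num) (by linarith), Real.rpow_one]
  have e2 : r * r ^ (2 * σ - 1) = (r ^ σ) ^ 2 := by
    rw [← rpow_two_mul σ hr]
    conv_rhs => rw [show 2 * σ = 1 + (2 * σ - 1) by ring,
      Real.rpow_add_of_nonneg hr (by norm_num) (by linarith), Real.rpow_one]
  have e3 : c / 2 = c / (2 * σ + 2) * (σ + 1) := by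
    have : 2 * σ + 2 ≠ 0 := by linarith
    field_simp
  simp only [id, Pi.sub_apply]
  unfold coeffU
  rw [rpow_two_mul σ hr, e3, ← e2]
  generalize r ^ (2 * σ - 1) = b at *
  rw [e1]
  ring

/-- The Euler-Lagrange equation as a first order system for a function and its covariant
derivative. -/
structure IsSolution (σ ω c : ℝ) (u p : ℝ → ℂ) : Prop where
  deriv_u : ∀ x, HasDerivAt u
    (p x - Complex.I * ((1 / (2 * σ + 2) * ‖u x‖ ^ (2 * σ) : ℝ) : ℂ) * u x) x
  deriv_p : ∀ x, HasDerivAt p (force σ ω c (u x)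
    (p x - Complex.I * ((1 / (2 * σ + 2) * ‖u x‖ ^ (2 * σ) : ℝ) : ℂ) * u x)) x

theorem IsSolution.momentum_const (hσ : 1 ≤ σ) (h : IsSolution σ ω c u p) (x y : ℝ) :
    ((starRingEnd ℂ) (u x) * p x).im = ((starRingEnd ℂ) (u y) * p y).im := by
  have hd : ∀ x, HasDerivAt (fun x => ((starRingEnd ℂ) (u x) * p x).im) 0 x := by
    intro x
    refine (hasDerivAt_im_conj_mul (h.deriv_u x) (h.deriv_p x)).congr_deriv ?_
    rw [force_eq hσ]
    generalize coeffU σ ω c (‖u x‖ ^ 2) + 1 / (2 * σ + 2) * (2 * σ * ‖u x‖ ^ (2 * σ - 2))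
        * ((starRingEnd ℂ) (u x) * p x).im = a
    generalize 1 / (2 * σ + 2) * ‖u x‖ ^ (2 * σ) = m
    simp
    ring
  exact is_const_of_deriv_eq_zero (fun x => (hd x).differentiableAt) (fun x => (hd x).deriv) x y

theorem eq_zero_of_integrable_const {a : ℝ} (h : Integrable fun _ : ℝ => a) : a = 0 := by
  rcases integrable_const_iff.1 h with h | h
  · exact h
  · exact absurd h.measure_univ_lt_top (by simp)

theorem integrable_norm_sq_covD (hσ : 1 ≤ σ) (hψ : ψ ∈ X σ ω c) :
    Integrable fun x => ‖covD σ (ψ x) (weakDeriv ψ x)‖ ^ 2 := by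
  simp only [norm_covD_sq]
  refine ((X_grad hψ).1.add ((X_nlDens hσ hψ).1.const_mul _)).add (Integrable.const_mul ?_ _)
  refine (X_rpow hσ hψ (s := 4 * σ + 2) (by linarith)).1.congr (Eventually.of_forall fun x => ?_)
  simp only
  rw [Real.rpow_add_of_nonneg (norm_nonneg _) (by linarith) (by norm_num), Real.rpow_two,
    rpow_four_mul _ (norm_nonneg _)]

theorem integrable_potential (hσ : 1 ≤ σ) (hωc : Admissible ω c) (hψ : ψ ∈ X σ ω c) :
    Integrable fun x => ‖ψ x‖ ^ 2 * qfun σ ω c (‖ψ x‖ ^ 2) := by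
  have h1 := (actionTilde_eq_integral hσ hωc hψ).1.const_mul 2
  have h2 : Integrable fun x => 2 * actDens σ ω c (jet ψ x)
      - ‖covD σ (ψ x) (weakDeriv ψ x)‖ ^ 2 := h1.sub (integrable_norm_sq_covD hσ hψ)
  refine h2.congr (Eventually.of_forall fun x => ?_)
  simp only [actDens, jet]
  ring

/-- The square of the constant momentum density is at most `sup |u|² |p|²`, which is integrable. -/
theorem IsSolution.momentum_eq_zero (hσ : 1 ≤ σ) (hψ : ψ ∈ X σ ω c) (hu : IsRep ψ u)
    (h : IsSolution σ ω c u p) (hp : (fun x => covD σ (u x) (weakDeriv ψ x)) =ᵐ[volume] p)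
    (x : ℝ) : ((starRingEnd ℂ) (u x) * p x).im = 0 := by
  have hi : Integrable fun _ : ℝ => (((starRingEnd ℂ) (u x) * p x).im) ^ 2 := by
    refine ((integrable_norm_sq_covD hσ hψ).const_mul (normX σ ω c ψ ^ 2)).mono'
      aestronglyMeasurable_const ?_
    filter_upwards [hp, hu.ae_eq] with y h1 h2
    rw [h2, h1, h.momentum_const hσ x y, Real.norm_eq_abs, abs_of_nonneg (sq_nonneg _), ← mul_pow,
      ← sq_abs]
    gcongr
    refine (abs_im_conj_mul_le _ _).trans ?_
    gcongr
    exact norm_le_normX hσ hψ hu y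
  exact pow_eq_zero_iff two_ne_zero |>.1 (eq_zero_of_integrable_const hi)

theorem IsSolution.energy_const (hσ : 1 ≤ σ) (h : IsSolution σ ω c u p)
    (hJ : ∀ x, ((starRingEnd ℂ) (u x) * p x).im = 0) (x y : ℝ) :
    ‖p x‖ ^ 2 - ‖u x‖ ^ 2 * qfun σ ω c (‖u x‖ ^ 2)
      = ‖p y‖ ^ 2 - ‖u y‖ ^ 2 * qfun σ ω c (‖u y‖ ^ 2) := by
  have hd : ∀ x, HasDerivAt (fun x => ‖p x‖ ^ 2 - ‖u x‖ ^ 2 * qfun σ ω c (‖u x‖ ^ 2)) 0 x := by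
    intro x
    have h1 := (hasDerivAt_potential (ω := ω) (c := c) hσ (sq_nonneg ‖u x‖)).comp x
      (hasDerivAt_normSq (h.deriv_u x))
    refine ((hasDerivAt_normSq (h.deriv_p x)).sub h1).congr_deriv ?_
    rw [force_eq hσ, hJ x, mul_zero, add_zero]
    generalize coeffU σ ω c (‖u x‖ ^ 2) = a
    generalize 1 / (2 * σ + 2) * ‖u x‖ ^ (2 * σ) = m
    simp
    ring
  exact is_const_of_deriv_eq_zero (fun x => (hd x).differentiableAt) (fun x => (hd x).deriv) x y

/-- The constant `|p|² - |u|² q(|u|²)` is a difference of integrable functions. -/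
theorem IsSolution.energy_eq_zero (hσ : 1 ≤ σ) (hωc : Admissible ω c) (hψ : ψ ∈ X σ ω c)
    (hu : IsRep ψ u) (h : IsSolution σ ω c u p)
    (hp : (fun x => covD σ (u x) (weakDeriv ψ x)) =ᵐ[volume] p) (x : ℝ) :
    ‖p x‖ ^ 2 = ‖u x‖ ^ 2 * qfun σ ω c (‖u x‖ ^ 2) := by
  have hi : Integrable fun _ : ℝ => ‖p x‖ ^ 2 - ‖u x‖ ^ 2 * qfun σ ω c (‖u x‖ ^ 2) := by
    have h1 : Integrable fun x => ‖covD σ (ψ x) (weakDeriv ψ x)‖ ^ 2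
        - ‖ψ x‖ ^ 2 * qfun σ ω c (‖ψ x‖ ^ 2) :=
      (integrable_norm_sq_covD hσ hψ).sub (integrable_potential hσ hωc hψ)
    refine h1.congr ?_
    filter_upwards [hp, hu.ae_eq] with y h1 h2
    rw [h2, h1]
    exact h.energy_const hσ (h.momentum_eq_zero hσ hψ hu hp) y x
  exact sub_eq_zero.1 (eq_zero_of_integrable_const hi)

/-- A differentiable function with `|r'| ≤ C r` that is positive somewhere is positive. -/
theorem pos_of_abs_deriv_le {r r' : ℝ → ℝ} {C : ℝ} (hr : ∀ x, HasDerivAt r (r' x) x)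
    (hC : ∀ x, |r' x| ≤ C * r x) {x₁ : ℝ} (h1 : 0 < r x₁) (x : ℝ) : 0 < r x := by
  have he : ∀ (a x : ℝ), HasDerivAt (fun x => r x * Real.exp (a * x))
      ((r' x + a * r x) * Real.exp (a * x)) x := by
    intro a x
    have h2 : HasDerivAt (fun x => Real.exp (a * x)) (Real.exp (a * x) * a) x := by
      simpa using ((hasDerivAt_id x).const_mul a).exp
    exact ((hr x).mul h2).congr_deriv (by ring)
  have hmono : Monotone fun x => r x * Real.exp (C * x) :=
    monotone_of_hasDerivAt_nonneg (he C) fun x =>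
      mul_nonneg (by linarith [neg_le_of_abs_le (hC x)]) (Real.exp_pos _).le
  have hanti : Antitone fun x => r x * Real.exp (-C * x) :=
    antitone_of_hasDerivAt_nonpos (he (-C)) fun x =>
      mul_nonpos_of_nonpos_of_nonneg (by linarith [le_of_abs_le (hC x)]) (Real.exp_pos _).le
  rcases le_total x₁ x with hx | hx
  · exact pos_of_mul_pos_left ((mul_pos h1 (Real.exp_pos _)).trans_le (hmono hx))
      (Real.exp_pos _).le
  · exact pos_of_mul_pos_left ((mul_pos h1 (Real.exp_pos _)).trans_le (hanti hx))
      (Real.exp_pos _).le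

end Integration

/-! ### The profile -/

section Profile

open Filter Set

variable {σ ω c : ℝ}

open Classical in
/-- The function `Φ ^ (-2σ)`, which solves a linear second order equation. -/
noncomputable def invProfile (σ ω c x : ℝ) : ℝ :=
  if c ^ 2 / 4 < ω then
    (2 * √ω * Real.cosh (σ * √(4 * ω - c ^ 2) * x) - c) / ((σ + 1) * (4 * ω - c ^ 2))
  else (σ ^ 2 * (c * x) ^ 2 + 1) / (2 * (σ + 1) * c)

open Classical in
/-- The derivative of `invProfile`. -/
noncomputable def invProfileDeriv (σ ω c x : ℝ) : ℝ :=
  if c ^ 2 / 4 < ω then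
    2 * √ω * (Real.sinh (σ * √(4 * ω - c ^ 2) * x) * (σ * √(4 * ω - c ^ 2)))
      / ((σ + 1) * (4 * ω - c ^ 2))
  else σ ^ 2 * (2 * (c * x) * c) / (2 * (σ + 1) * c)

theorem profile_eq (σ ω c x : ℝ) :
    profile σ ω c x = (invProfile σ ω c x)⁻¹ ^ (1 / (2 * σ)) := by
  unfold profile invProfile
  split_ifs <;> rw [inv_div]

theorem abs_lt_two_sqrt (h : c ^ 2 / 4 < ω) : |c| < 2 * √ω := by
  have h0 : 0 ≤ c ^ 2 / 4 := by positivity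
  have h1 := Real.sq_sqrt (h0.trans h.le)
  refine abs_lt_of_sq_lt_sq (by nlinarith) (by positivity)

theorem invProfile_ge (hσ : 1 ≤ σ) (h : c ^ 2 / 4 < ω) (x : ℝ) :
    (2 * √ω - |c|) / ((σ + 1) * (4 * ω - c ^ 2)) * Real.cosh (σ * √(4 * ω - c ^ 2) * x)
      ≤ invProfile σ ω c x := by
  have h1 := Real.one_le_cosh (σ * √(4 * ω - c ^ 2) * x)
  have h2 : 0 < (σ + 1) * (4 * ω - c ^ 2) := mul_pos (by linarith) (by linarith)
  rw [invProfile, if_pos h, div_mul_eq_mul_div]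
  gcongr
  nlinarith [le_abs_self c, abs_nonneg c]

theorem invProfile_pos (hσ : 1 ≤ σ) (hωc : Admissible ω c) (x : ℝ) : 0 < invProfile σ ω c x := by
  rcases hωc with h | ⟨h, hc⟩
  · refine lt_of_lt_of_le ?_ (invProfile_ge hσ h x)
    have h1 := Real.cosh_pos (σ * √(4 * ω - c ^ 2) * x)
    have h2 : 0 < (σ + 1) * (4 * ω - c ^ 2) := mul_pos (by linarith) (by linarith)
    have h3 := abs_lt_two_sqrt h
    have h4 : 0 < 2 * √ω - |c| := by linarith
    positivity
  · rw [invProfile, if_neg (by linarith)]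
    positivity

theorem hasDerivAt_invProfile (σ ω c x : ℝ) :
    HasDerivAt (invProfile σ ω c) (invProfileDeriv σ ω c x) x := by
  unfold invProfile invProfileDeriv
  split_ifs with h
  · have h1 : HasDerivAt (fun x => σ * √(4 * ω - c ^ 2) * x) (σ * √(4 * ω - c ^ 2)) x := by
      simpa using (hasDerivAt_id x).const_mul (σ * √(4 * ω - c ^ 2))
    exact ((h1.cosh.const_mul (2 * √ω)).sub_const c).div_const _
  · have h1 : HasDerivAt (fun x => c * x) c x := by
      simpa using (hasDerivAt_id x).const_mul c
    have := (((h1.pow 2).const_mul (σ ^ 2)).add_const 1).div_const (2 * (σ + 1) * c)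
    simpa using this

theorem hasDerivAt_invProfileDeriv (hσ : 1 ≤ σ) (hωc : Admissible ω c) (x : ℝ) :
    HasDerivAt (invProfileDeriv σ ω c) (4 * σ ^ 2 * ((ω - c ^ 2 / 4) * invProfile σ ω c x
      + c / (4 * (σ + 1)))) x := by
  unfold invProfile invProfileDeriv
  have hσ1 : σ + 1 ≠ 0 := by linarith
  rcases hωc with h | ⟨h, hc⟩
  · simp only [if_pos h]
    have h1 : HasDerivAt (fun x => σ * √(4 * ω - c ^ 2) * x) (σ * √(4 * ω - c ^ 2)) x := by
      simpa using (hasDerivAt_id x).const_mul (σ * √(4 * ω - c ^ 2))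
    refine (((h1.sinh.mul_const _).const_mul (2 * √ω)).div_const _).congr_deriv ?_
    have h2 : 4 * ω - c ^ 2 ≠ 0 := by linarith
    have h3 : √(4 * ω - c ^ 2) ^ 2 = 4 * ω - c ^ 2 := Real.sq_sqrt (by linarith)
    have e : Real.cosh (σ * √(4 * ω - c ^ 2) * x) * (σ * √(4 * ω - c ^ 2)) * (σ * √(4 * ω - c ^ 2))
        = Real.cosh (σ * √(4 * ω - c ^ 2) * x) * (σ ^ 2 * (4 * ω - c ^ 2)) := by
      generalize Real.cosh (σ * √(4 * ω - c ^ 2) * x) = C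
      rw [show σ ^ 2 * (4 * ω - c ^ 2) = σ ^ 2 * √(4 * ω - c ^ 2) ^ 2 by rw [h3]]
      ring
    rw [e]
    generalize Real.cosh (σ * √(4 * ω - c ^ 2) * x) = C
    rw [show ω - c ^ 2 / 4 = (4 * ω - c ^ 2) / 4 by ring]
    generalize 4 * ω - c ^ 2 = D at *
    field_simp
    ring
  · simp only [if_neg (show ¬ c ^ 2 / 4 < ω by linarith)]
    have h1 : HasDerivAt (fun x => c * x) c x := by
      simpa using (hasDerivAt_id x).const_mul c
    refine ((((h1.const_mul 2).mul_const c).const_mul (σ ^ 2)).div_const _).congr_deriv ?_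
    rw [h]
    field_simp
    ring

/-- The first integral of the linear equation for `Φ ^ (-2σ)`. -/
theorem invProfileDeriv_sq (hσ : 1 ≤ σ) (hωc : Admissible ω c) (x : ℝ) :
    invProfileDeriv σ ω c x ^ 2 = 4 * σ ^ 2 * ((ω - c ^ 2 / 4) * invProfile σ ω c x ^ 2
      + c / (2 * σ + 2) * invProfile σ ω c x - (1 / (2 * σ + 2)) ^ 2) := by
  unfold invProfile invProfileDeriv
  have hσ1 : σ + 1 ≠ 0 := by linarith
  rw [show 2 * σ + 2 = 2 * (σ + 1) by ring]
  rcases hωc with h | ⟨h, hc⟩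
  · simp only [if_pos h]
    have h2 : 4 * ω - c ^ 2 ≠ 0 := by linarith
    have h3 : √(4 * ω - c ^ 2) ^ 2 = 4 * ω - c ^ 2 := Real.sq_sqrt (by linarith)
    have h4 : √ω ^ 2 = ω := Real.sq_sqrt (by nlinarith [sq_nonneg c])
    have h5 := Real.cosh_sq (σ * √(4 * ω - c ^ 2) * x)
    generalize Real.cosh (σ * √(4 * ω - c ^ 2) * x) = C at *
    generalize Real.sinh (σ * √(4 * ω - c ^ 2) * x) = S at *
    have h6 : S ^ 2 = C ^ 2 - 1 := by linarith
    have e : (2 * √ω * (S * (σ * √(4 * ω - c ^ 2))) / ((σ + 1) * (4 * ω - c ^ 2))) ^ 2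
        = 4 * √ω ^ 2 * (S ^ 2 * (σ ^ 2 * √(4 * ω - c ^ 2) ^ 2))
          / ((σ + 1) * (4 * ω - c ^ 2)) ^ 2 := by
      rw [div_pow]
      congr 1
      ring
    rw [e, h6, h3]
    have h7 : √ω ^ 2 = (4 * ω - c ^ 2 + c ^ 2) / 4 := by rw [h4]; ring
    rw [show ω - c ^ 2 / 4 = (4 * ω - c ^ 2) / 4 by ring]
    generalize 4 * ω - c ^ 2 = D at *
    generalize √ω = R at *
    field_simp
    have h8 : D = 4 * R ^ 2 - c ^ 2 := by linarith
    rw [h8]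
    ring
  · simp only [if_neg (show ¬ c ^ 2 / 4 < ω by linarith)]
    rw [h]
    field_simp
    ring

theorem invProfileDeriv_zero (σ ω c : ℝ) : invProfileDeriv σ ω c 0 = 0 := by
  unfold invProfileDeriv
  split_ifs <;> simp

theorem mul_invProfileDeriv_nonneg (hσ : 1 ≤ σ) (hωc : Admissible ω c) (x : ℝ) :
    0 ≤ x * invProfileDeriv σ ω c x := by
  unfold invProfileDeriv
  rcases hωc with h | ⟨h, hc⟩
  · rw [if_pos h]
    have h2 : 0 < 4 * ω - c ^ 2 := by linarith
    have h3 : 0 < σ * √(4 * ω - c ^ 2) := mul_pos (by linarith) (Real.sqrt_pos.2 h2)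
    have h4 : 0 < σ + 1 := by linarith
    set K := σ * √(4 * ω - c ^ 2)
    have h5 : 0 ≤ x * Real.sinh (K * x) := by
      rcases le_total 0 x with hx | hx
      · exact mul_nonneg hx (Real.sinh_nonneg_iff.2 (by positivity))
      · exact mul_nonneg_of_nonpos_of_nonpos hx
          (Real.sinh_nonpos_iff.2 (mul_nonpos_of_nonneg_of_nonpos h3.le hx))
    calc (0:ℝ) ≤ 2 * √ω * K / ((σ + 1) * (4 * ω - c ^ 2)) * (x * Real.sinh (K * x)) := by positivity
      _ = _ := by ring
  · rw [if_neg (show ¬ c ^ 2 / 4 < ω by linarith)]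
    have h4 : 0 < σ + 1 := by linarith
    calc (0:ℝ) ≤ σ ^ 2 * (2 * c * c) / (2 * (σ + 1) * c) * x ^ 2 := by positivity
      _ = _ := by ring

theorem profile_pos (hσ : 1 ≤ σ) (hωc : Admissible ω c) (x : ℝ) : 0 < profile σ ω c x := by
  rw [profile_eq]
  have := invProfile_pos hσ hωc x
  positivity

theorem profile_rpow (hσ : 1 ≤ σ) (hωc : Admissible ω c) (x s : ℝ) :
    profile σ ω c x ^ s = (invProfile σ ω c x) ^ (-(s / (2 * σ))) := by
  have h := invProfile_pos hσ hωc x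
  rw [profile_eq, ← Real.rpow_mul (by positivity), Real.inv_rpow h.le, ← Real.rpow_neg h.le]
  congr 2
  ring

theorem profile_rpow_two_mul (hσ : 1 ≤ σ) (hωc : Admissible ω c) (x : ℝ) :
    profile σ ω c x ^ (2 * σ) = (invProfile σ ω c x)⁻¹ := by
  have h := invProfile_pos hσ hωc x
  rw [profile_rpow hσ hωc, div_self (by linarith), Real.rpow_neg_one]

/-- The logarithmic derivative of the profile. -/
noncomputable def logDeriv (σ ω c x : ℝ) : ℝ :=
  -invProfileDeriv σ ω c x / (2 * σ * invProfile σ ω c x)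

theorem hasDerivAt_profile (hσ : 1 ≤ σ) (hωc : Admissible ω c) (x : ℝ) :
    HasDerivAt (profile σ ω c) (logDeriv σ ω c x * profile σ ω c x) x := by
  have h := invProfile_pos hσ hωc x
  have e : profile σ ω c = fun x => invProfile σ ω c x ^ (-(1 / (2 * σ))) := by
    funext x
    rw [← profile_rpow hσ hωc, Real.rpow_one]
  have hσ0 : σ ≠ 0 := by linarith
  rw [congrFun e x, e]
  refine ((hasDerivAt_invProfile σ ω c x).rpow_const (Or.inl h.ne')).congr_deriv ?_
  rw [Real.rpow_sub_one h.ne', logDeriv]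
  field_simp

/-- The profile has zero energy. -/
theorem logDeriv_sq (hσ : 1 ≤ σ) (hωc : Admissible ω c) (x : ℝ) :
    logDeriv σ ω c x ^ 2 = qfun σ ω c (profile σ ω c x ^ 2) := by
  have h := invProfile_pos hσ hωc x
  have h0 := profile_pos hσ hωc x
  have hσ0 : σ ≠ 0 := by linarith
  have e1 : (profile σ ω c x ^ 2) ^ σ = (invProfile σ ω c x)⁻¹ := by
    rw [← profile_rpow_two_mul hσ hωc, ← Real.rpow_natCast, ← Real.rpow_mul h0.le]
    norm_num
  have e2 : logDeriv σ ω c x ^ 2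
      = invProfileDeriv σ ω c x ^ 2 / (4 * σ ^ 2 * invProfile σ ω c x ^ 2) := by
    unfold logDeriv
    ring
  rw [qfun, rpow_two_mul σ (by positivity), e1, e2, invProfileDeriv_sq hσ hωc]
  generalize 1 / (2 * σ + 2) = k
  generalize c / (2 * σ + 2) = l
  field_simp

theorem hasDerivAt_logDeriv (hσ : 1 ≤ σ) (hωc : Admissible ω c) (x : ℝ) :
    HasDerivAt (logDeriv σ ω c) (2 * σ * (logDeriv σ ω c x ^ 2 - (ω - c ^ 2 / 4)
      - c / (4 * (σ + 1)) * profile σ ω c x ^ (2 * σ))) x := by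
  have h := invProfile_pos hσ hωc x
  have hσ0 : σ ≠ 0 := by linarith
  refine ((hasDerivAt_invProfileDeriv hσ hωc x).neg.div
    ((hasDerivAt_invProfile σ ω c x).const_mul (2 * σ)) (by positivity)).congr_deriv ?_
  rw [profile_rpow_two_mul hσ hωc, logDeriv]
  generalize c / (4 * (σ + 1)) = l
  simp only [Pi.neg_apply]
  field_simp
  ring

theorem logDeriv_sign (hσ : 1 ≤ σ) (hωc : Admissible ω c) (x : ℝ) :
    x * logDeriv σ ω c x ≤ 0 := by
  have h := invProfile_pos hσ hωc x
  have h1 := mul_invProfileDeriv_nonneg hσ hωc x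
  have h2 : 0 ≤ (x * invProfileDeriv σ ω c x) / (2 * σ * invProfile σ ω c x) := by positivity
  have h3 : x * logDeriv σ ω c x
      = -((x * invProfileDeriv σ ω c x) / (2 * σ * invProfile σ ω c x)) := by
    unfold logDeriv; ring
  linarith

theorem logDeriv_zero (σ ω c : ℝ) : logDeriv σ ω c 0 = 0 := by
  simp [logDeriv, invProfileDeriv_zero]

theorem isPeak_profile (hσ : 1 ≤ σ) (hωc : Admissible ω c) :
    IsPeak σ ω c (profile σ ω c 0 ^ 2) where
  pos := pow_pos (profile_pos hσ hωc 0) 2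
  zero := by rw [← logDeriv_sq hσ hωc, logDeriv_zero]; norm_num

theorem continuous_profile (hσ : 1 ≤ σ) (hωc : Admissible ω c) : Continuous (profile σ ω c) :=
  continuous_iff_continuousAt.2 fun x => (hasDerivAt_profile hσ hωc x).continuousAt

theorem profile_le (hσ : 1 ≤ σ) (hωc : Admissible ω c) (x : ℝ) :
    profile σ ω c x ≤ profile σ ω c 0 := by
  have hd := hasDerivAt_profile hσ hωc
  have hc := continuous_profile hσ hωc
  have hs := logDeriv_sign hσ hωc
  rcases le_total 0 x with hx | hx
  · refine antitoneOn_of_deriv_nonpos (convex_Ici 0) hc.continuousOn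
      (fun y _ => (hd y).differentiableAt.differentiableWithinAt) (fun y hy => ?_)
      (mem_Ici.2 le_rfl) (mem_Ici.2 hx) hx
    rw [interior_Ici] at hy
    rw [(hd y).deriv]
    exact mul_nonpos_of_nonpos_of_nonneg (nonpos_of_mul_nonpos_right (hs y) hy)
      (profile_pos hσ hωc y).le
  · refine monotoneOn_of_deriv_nonneg (convex_Iic 0) hc.continuousOn
      (fun y _ => (hd y).differentiableAt.differentiableWithinAt) (fun y hy => ?_)
      (mem_Iic.2 hx) (mem_Iic.2 le_rfl) hx
    rw [interior_Iic] at hy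
    rw [(hd y).deriv]
    have : 0 ≤ logDeriv σ ω c y := by
      by_contra hcon
      push Not at hcon
      have := mul_pos_of_neg_of_neg hy hcon
      linarith [hs y]
    exact mul_nonneg this (profile_pos hσ hωc y).le

end Profile

/-! ### Classification of critical points -/

section Classification

open Filter Set

variable {σ ω c : ℝ} {ψ : Fn} {u p : ℝ → ℂ}

/-- Two solutions of a linear second order equation with constant coefficients and the same data
at one point agree. -/
theorem linear_ode_unique {a b x₀ : ℝ} {y z Y Z : ℝ → ℝ} (hy : ∀ x, HasDerivAt y (z x) x)
    (hz : ∀ x, HasDerivAt z (a * y x + b) x) (hY : ∀ x, HasDerivAt Y (Z x) x)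
    (hZ : ∀ x, HasDerivAt Z (a * Y x + b) x) (h0 : y x₀ = Y x₀) (h1 : z x₀ = Z x₀) : y = Y := by
  let L : ℝ × ℝ →L[ℝ] ℝ × ℝ :=
    (ContinuousLinearMap.snd ℝ ℝ ℝ).prod (a • ContinuousLinearMap.fst ℝ ℝ ℝ)
  have h := ODE_solution_unique_univ (v := fun _ => L) (s := fun _ => univ) (K := ‖L‖₊)
    (f := fun x => (y x - Y x, z x - Z x)) (g := fun _ => 0) (t₀ := x₀)
    (fun t => L.lipschitz.lipschitzOnWith) (fun t => ⟨?_, mem_univ _⟩)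
    (fun t => ⟨by simpa using hasDerivAt_const t (0 : ℝ × ℝ), mem_univ _⟩) (by simp [h0, h1])
  · funext x
    have := congrArg Prod.fst (congrFun h x)
    simpa [sub_eq_zero] using this
  · refine (((hy t).sub (hY t)).prodMk ((hz t).sub (hZ t))).congr_deriv ?_
    simp only [L, ContinuousLinearMap.prod_apply, ContinuousLinearMap.coe_snd',
      _root_.smul_apply, ContinuousLinearMap.coe_fst', smul_eq_mul, Prod.mk.injEq,
      true_and]
    ring

theorem IsSolution.hasDerivAt_normSq (h : IsSolution σ ω c u p) (x : ℝ) :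
    HasDerivAt (fun x => ‖u x‖ ^ 2) (2 * ((starRingEnd ℂ) (u x) * p x).re) x := by
  refine (GDNLS.hasDerivAt_normSq (h.deriv_u x)).congr_deriv ?_
  generalize 1 / (2 * σ + 2) * ‖u x‖ ^ (2 * σ) = m
  simp
  ring

theorem IsSolution.hasDerivAt_re (hσ : 1 ≤ σ) (h : IsSolution σ ω c u p)
    (hJ : ∀ x, ((starRingEnd ℂ) (u x) * p x).im = 0) (x : ℝ) :
    HasDerivAt (fun x => ((starRingEnd ℂ) (u x) * p x).re)
      (‖p x‖ ^ 2 + coeffU σ ω c (‖u x‖ ^ 2) * ‖u x‖ ^ 2) x := by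
  refine (hasDerivAt_re_conj_mul (h.deriv_u x) (h.deriv_p x)).congr_deriv ?_
  rw [force_eq hσ, hJ x, mul_zero, add_zero]
  generalize coeffU σ ω c (‖u x‖ ^ 2) = a
  generalize 1 / (2 * σ + 2) * ‖u x‖ ^ (2 * σ) = m
  simp only [← Complex.normSq_eq_norm_sq, Complex.normSq_apply]
  simp
  ring

/-- A solution of zero momentum and energy vanishes nowhere, unless it is zero. -/
theorem IsSolution.ne_zero (hσ : 1 ≤ σ) (h : IsSolution σ ω c u p)
    (hH : ∀ x, ‖p x‖ ^ 2 = ‖u x‖ ^ 2 * qfun σ ω c (‖u x‖ ^ 2)) {x₀ : ℝ} (h0 : 0 < ‖u x₀‖)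
    (hmax : ∀ x, ‖u x‖ ≤ ‖u x₀‖) (x : ℝ) : 0 < ‖u x‖ ^ 2 := by
  obtain ⟨C, hC⟩ := (isCompact_Icc (a := 0) (b := ‖u x₀‖ ^ 2)).exists_bound_of_continuousOn
    (continuous_qfun (ω := ω) (c := c) hσ).continuousOn
  refine pos_of_abs_deriv_le (C := 2 * (1 + |C|)) h.hasDerivAt_normSq (fun y => ?_)
    (x₁ := x₀) (by positivity) x
  have h1 : qfun σ ω c (‖u y‖ ^ 2) ≤ C :=
    (le_abs_self _).trans (hC _ ⟨by positivity, by gcongr; exact hmax y⟩)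
  have h2 : (‖u y‖ * ‖p y‖) ^ 2 ≤ ((1 + |C|) * ‖u y‖ ^ 2) ^ 2 := by
    rw [mul_pow, hH y, mul_pow]
    have h3 : qfun σ ω c (‖u y‖ ^ 2) ≤ (1 + |C|) ^ 2 := by
      nlinarith [le_abs_self C, abs_nonneg C]
    calc ‖u y‖ ^ 2 * (‖u y‖ ^ 2 * qfun σ ω c (‖u y‖ ^ 2))
        = qfun σ ω c (‖u y‖ ^ 2) * (‖u y‖ ^ 2) ^ 2 := by ring
      _ ≤ _ := by gcongr
  have h4 := (abs_re_conj_mul_le (u y) (p y)).trans (abs_le_of_sq_le_sq' h2 (by positivity)).2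
  rw [abs_mul, abs_two]
  linarith

/-- The power `|u| ^ (-2σ)` of the modulus solves a linear equation. -/
theorem IsSolution.invPower (hσ : 1 ≤ σ) (h : IsSolution σ ω c u p)
    (hJ : ∀ x, ((starRingEnd ℂ) (u x) * p x).im = 0)
    (hH : ∀ x, ‖p x‖ ^ 2 = ‖u x‖ ^ 2 * qfun σ ω c (‖u x‖ ^ 2)) (hpos : ∀ x, 0 < ‖u x‖ ^ 2) (x : ℝ) :
    HasDerivAt (fun x => (‖u x‖ ^ 2) ^ (-σ))
      (-2 * σ * (((starRingEnd ℂ) (u x) * p x).re * (‖u x‖ ^ 2) ^ (-σ - 1))) x ∧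
    HasDerivAt (fun x => -2 * σ * (((starRingEnd ℂ) (u x) * p x).re * (‖u x‖ ^ 2) ^ (-σ - 1)))
      (4 * σ ^ 2 * (ω - c ^ 2 / 4) * (‖u x‖ ^ 2) ^ (-σ) + 4 * σ ^ 2 * (c / (4 * (σ + 1)))) x := by
  have hr := h.hasDerivAt_normSq x
  have hs := h.hasDerivAt_re hσ hJ x
  have h0 := hpos x
  constructor
  · refine (hr.rpow_const (p := -σ) (Or.inl h0.ne')).congr_deriv ?_
    ring
  · refine ((hs.mul (hr.rpow_const (p := -σ - 1)
      (Or.inl h0.ne'))).const_mul (-2 * σ)).congr_deriv ?_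
    have e1 : ((starRingEnd ℂ) (u x) * p x).re ^ 2
        = ‖u x‖ ^ 2 * (‖u x‖ ^ 2 * qfun σ ω c (‖u x‖ ^ 2)) := by
      rw [← hH x, ← mul_pow, ← Complex.norm_conj (u x), ← norm_mul, ← Complex.normSq_eq_norm_sq,
        Complex.normSq_apply, hJ x]
      ring
    rw [hH x]
    generalize ((starRingEnd ℂ) (u x) * p x).re = s at *
    generalize ‖u x‖ ^ 2 = r at *
    have e2 : r ^ (-σ - 1 - 1) = r ^ (-σ) / r ^ 2 := by
      rw [Real.rpow_sub_one h0.ne', Real.rpow_sub_one h0.ne']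
      field_simp
    have e3 : r ^ (-σ - 1) = r ^ (-σ) / r := Real.rpow_sub_one h0.ne' _
    have e4 : r ^ (-σ) = (r ^ σ)⁻¹ := Real.rpow_neg h0.le σ
    have hm : 0 < r ^ σ := Real.rpow_pos_of_pos h0 σ
    have hσ1 : σ + 1 ≠ 0 := by linarith
    rw [e2, e3, e4]
    unfold qfun at e1 ⊢
    unfold coeffU
    rw [rpow_two_mul σ h0.le] at *
    generalize r ^ σ = m at *
    generalize ω - c ^ 2 / 4 = A at *
    rw [show 2 * σ + 2 = 2 * (σ + 1) by ring] at *
    have e5 : s * (2 * s * (-σ - 1) * (m⁻¹ / r ^ 2)) = s ^ 2 * (2 * (-σ - 1) * (m⁻¹ / r ^ 2)) := by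
      ring
    rw [e5, e1]
    field_simp
    ring

/-- The solitary wave without the factor `exp (i c x / 2)`. -/
noncomputable def wave (σ ω c x : ℝ) : ℂ :=
  (profile σ ω c x : ℂ) * Complex.exp (-(Complex.I *
    ((1 / (2 * σ + 2) * ∫ y in (0 : ℝ)..x, profile σ ω c y ^ (2 * σ) : ℝ) : ℂ)))

theorem norm_wave (hσ : 1 ≤ σ) (hωc : Admissible ω c) (x : ℝ) :
    ‖wave σ ω c x‖ = profile σ ω c x := by
  rw [wave, norm_mul, Complex.norm_real, Real.norm_of_nonneg (profile_pos hσ hωc x).le,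
    Complex.norm_exp]
  simp

theorem hasDerivAt_phase (hσ : 1 ≤ σ) (hωc : Admissible ω c) (x : ℝ) :
    HasDerivAt (fun x => 1 / (2 * σ + 2) * ∫ y in (0 : ℝ)..x, profile σ ω c y ^ (2 * σ))
      (1 / (2 * σ + 2) * profile σ ω c x ^ (2 * σ)) x := by
  have hc : Continuous fun y => profile σ ω c y ^ (2 * σ) :=
    (continuous_profile hσ hωc).rpow_const fun y => Or.inl (profile_pos hσ hωc y).ne'
  exact (intervalIntegral.integral_hasDerivAt_right (hc.intervalIntegrable _ _)
    (hc.stronglyMeasurableAtFilter _ _) hc.continuousAt).const_mul _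

theorem hasDerivAt_wave (hσ : 1 ≤ σ) (hωc : Admissible ω c) (x : ℝ) :
    HasDerivAt (wave σ ω c) (((logDeriv σ ω c x : ℝ) - Complex.I *
      ((1 / (2 * σ + 2) * profile σ ω c x ^ (2 * σ) : ℝ) : ℂ)) * wave σ ω c x) x := by
  have h1 := (hasDerivAt_profile hσ hωc x).ofReal_comp
  have h2 := (((hasDerivAt_phase hσ hωc x).ofReal_comp).const_mul Complex.I).neg.cexp
  refine (h1.mul h2).congr_deriv ?_
  simp only [wave, Pi.neg_apply]
  push_cast
  ring

/-- A solution of zero momentum and energy whose modulus attains a positive maximum at `x₀` is the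
wave centred at `x₀`, up to a phase. -/
theorem IsSolution.eq_wave (hσ : 1 ≤ σ) (hωc : Admissible ω c) (h : IsSolution σ ω c u p)
    (hJ : ∀ x, ((starRingEnd ℂ) (u x) * p x).im = 0)
    (hH : ∀ x, ‖p x‖ ^ 2 = ‖u x‖ ^ 2 * qfun σ ω c (‖u x‖ ^ 2)) {x₀ : ℝ} (h0 : 0 < ‖u x₀‖)
    (hmax : ∀ x, ‖u x‖ ≤ ‖u x₀‖) :
    ∃ z₀ : ℂ, ‖z₀‖ = 1 ∧ ∀ x, u x = z₀ * wave σ ω c (x - x₀) := by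
  have hpos := h.ne_zero hσ hH h0 hmax
  -- at the maximum the derivative of the modulus, hence also the potential, vanishes
  have hs0 : ((starRingEnd ℂ) (u x₀) * p x₀).re = 0 := by
    have hloc : IsLocalMax (fun x => ‖u x‖ ^ 2) x₀ :=
      Eventually.of_forall fun x => pow_le_pow_left₀ (norm_nonneg _) (hmax x) 2
    have := hloc.hasDerivAt_eq_zero (h.hasDerivAt_normSq x₀)
    linarith
  have hp0 : (starRingEnd ℂ) (u x₀) * p x₀ = 0 := Complex.ext hs0 (hJ x₀)
  have hpz : p x₀ = 0 := by
    rcases mul_eq_zero.1 hp0 with h1 | h1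
    · rw [map_eq_zero] at h1
      simp [h1] at h0
    · exact h1
  have hq : qfun σ ω c (‖u x₀‖ ^ 2) = 0 := by
    have h1 := hH x₀
    rw [hpz, norm_zero, zero_pow two_ne_zero] at h1
    exact (mul_eq_zero.1 h1.symm).resolve_left (hpos x₀).ne'
  have hpeak := (isPeak_profile hσ hωc).eq_of_qfun hσ hωc (hpos x₀) hq
  have hprof2 : ∀ x, (profile σ ω c x ^ 2) ^ (-σ) = invProfile σ ω c x := by
    intro x
    have h1 := profile_pos hσ hωc x
    rw [Real.rpow_neg (by positivity), ← inv_inj, inv_inv, ← profile_rpow_two_mul hσ hωc,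
      ← Real.rpow_natCast, ← Real.rpow_mul h1.le]
    norm_num
  have hshift : ∀ x, HasDerivAt (fun x => x - x₀) 1 x := fun x => (hasDerivAt_id x).sub_const x₀
  have hy : (fun x => (‖u x‖ ^ 2) ^ (-σ)) = fun x => invProfile σ ω c (x - x₀) := by
    refine linear_ode_unique (x₀ := x₀) (Z := fun x => invProfileDeriv σ ω c (x - x₀))
      (fun x => (h.invPower hσ hJ hH hpos x).1) (fun x => (h.invPower hσ hJ hH hpos x).2)
      (fun x => ?_) (fun x => ?_) ?_ ?_
    · exact (hasDerivAt_invProfile σ ω c (x - x₀)).comp_sub_const x x₀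
    · refine ((hasDerivAt_invProfileDeriv hσ hωc (x - x₀)).comp x (hshift x)).congr_deriv ?_
      ring
    · simp only [hpeak, sub_self, hprof2]
    · simp [hs0, invProfileDeriv_zero]
  have hnorm : ∀ x, ‖u x‖ = profile σ ω c (x - x₀) := by
    intro x
    have h1 := congrFun hy x
    rw [← hprof2] at h1
    have h2 := profile_pos hσ hωc (x - x₀)
    have h3 := (Real.rpow_left_inj (hpos x).le (by positivity) (by linarith : -σ ≠ 0)).1 h1
    exact (pow_left_inj₀ (norm_nonneg _) h2.le two_ne_zero).1 h3
  -- the quotient of the solution and the wave is constant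
  have hv : ∀ x, HasDerivAt (fun x => wave σ ω c (x - x₀)) (((logDeriv σ ω c (x - x₀) : ℝ)
      - Complex.I * ((1 / (2 * σ + 2) * ‖u x‖ ^ (2 * σ) : ℝ) : ℂ)) * wave σ ω c (x - x₀)) x := by
    intro x
    rw [hnorm]
    exact (hasDerivAt_wave hσ hωc (x - x₀)).comp_sub_const x x₀
  have hv0 : ∀ x, wave σ ω c x ≠ 0 := fun x => by
    rw [← norm_pos_iff, norm_wave hσ hωc]
    exact profile_pos hσ hωc x
  have hpu : ∀ x, p x = (logDeriv σ ω c (x - x₀) : ℂ) * u x := by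
    intro x
    have hne : u x ≠ 0 := fun hz => by simpa [hz] using hpos x
    have h1 : ((starRingEnd ℂ) (u x) * p x).re = logDeriv σ ω c (x - x₀) * ‖u x‖ ^ 2 := by
      have h2 := h.hasDerivAt_normSq x
      have h3 : HasDerivAt (fun x => ‖u x‖ ^ 2) (2 * (logDeriv σ ω c (x - x₀) * ‖u x‖ ^ 2)) x := by
        simp only [hnorm]
        refine (((hasDerivAt_profile hσ hωc (x - x₀)).comp x (hshift x)).pow 2).congr_deriv ?_
        simp
        ring
      have := h2.unique h3
      linarith
    have h2 : (starRingEnd ℂ) (u x) * p x = (starRingEnd ℂ) (u x) *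
        ((logDeriv σ ω c (x - x₀) : ℂ) * u x) := by
      rw [mul_left_comm, mul_comm _ (u x), Complex.mul_conj, Complex.normSq_eq_norm_sq,
        ← Complex.ofReal_mul, ← h1]
      exact Complex.ext (by simp) (by simpa using hJ x)
    exact mul_left_cancel₀ ((map_ne_zero _).2 hne) h2
  have hquot : ∀ x, HasDerivAt (fun x => u x / wave σ ω c (x - x₀)) 0 x := by
    intro x
    refine ((h.deriv_u x).div (hv x) (hv0 _)).congr_deriv ?_
    rw [hpu x]
    ring
  refine ⟨u x₀ / wave σ ω c (x₀ - x₀), ?_, fun x => ?_⟩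
  · rw [norm_div, norm_wave hσ hωc, hnorm, div_self (profile_pos hσ hωc _).ne']
  · rw [is_const_of_deriv_eq_zero (fun x => (hquot x).differentiableAt) (fun x => (hquot x).deriv)
      x₀ x, div_mul_cancel₀ _ (hv0 _)]

/-- Nontrivial critical points of the gauged action are translates and rotations of the wave. -/
theorem eq_wave_of_critical (hσ : 1 ≤ σ) (hωc : Admissible ω c) (hψ : ψ ∈ X σ ω c) (hne : ψ ≠ 0)
    (hcrit : ∀ h ∈ X σ ω c, normX σ ω c h ≤ 1 → firstVariation σ ω c ψ h = 0) :
    ∃ (z₀ : ℂ) (x₀ : ℝ), ‖z₀‖ = 1 ∧ ψ =ᵐ[volume] fun x => z₀ * wave σ ω c (x - x₀) := by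
  obtain ⟨u, hu⟩ := X_exists_rep hψ
  obtain ⟨p, hp, h1, h2⟩ := classical_eulerLagrange hσ hu hcrit
  have h : IsSolution σ ω c u p := ⟨h1, h2⟩
  obtain ⟨x₀, h0, hmax⟩ := hu.exists_max hσ hψ hne
  obtain ⟨z₀, hz, hw⟩ := h.eq_wave hσ hωc (h.momentum_eq_zero hσ hψ hu hp)
    (h.energy_eq_zero hσ hωc hψ hu hp) h0 hmax
  exact ⟨z₀, x₀, hz, hu.ae_eq.trans (Eventually.of_forall hw)⟩

end Classification

/-! ### Action and constraint of the solitary wave -/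

section SolitaryWave

open Filter Set

variable {σ ω c α β : ℝ} {ψ : Fn}

/-- The power of the profile that has to be integrable for membership in `X` decays like `x⁻²`
(exponentially in the massive case, where the stated rate is not optimal). -/
theorem profile_decay (hσ : 1 ≤ σ) (hωc : Admissible ω c) :
    ∃ C, ∀ x, profile σ ω c x ^ (exponent σ ω c).toReal ≤ C * (1 + x ^ 2)⁻¹ := by
  have hσ0 : 0 < σ := by linarith
  rcases hωc with h | ⟨h, hc⟩
  · have h2 : 0 < (σ + 1) * (4 * ω - c ^ 2) := mul_pos (by linarith) (by linarith)
    have h3 : 0 < 2 * √ω - |c| := by linarith [abs_lt_two_sqrt h]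
    set κ := σ * √(4 * ω - c ^ 2) with hκ
    have hκ0 : 0 < κ := mul_pos hσ0 (Real.sqrt_pos.2 (by linarith))
    set δ := (2 * √ω - |c|) / ((σ + 1) * (4 * ω - c ^ 2)) / 2 with hδ
    have hδ0 : 0 < δ := by positivity
    set b := min 1 ((κ / σ) ^ 2 / 2) with hb
    have hb0 : 0 < b := by positivity
    refine ⟨δ ^ (-(1 / σ)) * b⁻¹, fun x => ?_⟩
    have e : (exponent σ ω c).toReal = 2 := by rw [exponent, if_pos h]; norm_num
    have hY : δ * Real.exp (κ * |x|) ≤ invProfile σ ω c x := by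
      refine le_trans ?_ (invProfile_ge hσ h x)
      rw [← Real.cosh_abs, abs_mul, abs_of_pos hκ0, Real.cosh_eq, hδ]
      have := Real.exp_pos (-(κ * |x|))
      calc _ ≤ (2 * √ω - |c|) / ((σ + 1) * (4 * ω - c ^ 2)) / 2 *
            (Real.exp (κ * |x|) + Real.exp (-(κ * |x|))) := by gcongr; linarith
        _ = _ := by ring
    have h4 : b * (1 + x ^ 2) ≤ Real.exp (κ / σ * |x|) := by
      refine le_trans ?_ (Real.quadratic_le_exp_of_nonneg (by positivity))
      have h5 : b ≤ 1 := min_le_left _ _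
      have h6 : b * x ^ 2 ≤ (κ / σ) ^ 2 / 2 * x ^ 2 := by
        gcongr
        exact min_le_right _ _
      have h7 : 0 ≤ κ / σ * |x| := by positivity
      rw [mul_pow, sq_abs]
      linarith
    rw [e, profile_rpow hσ (Or.inl h), show (2:ℝ) / (2 * σ) = 1 / σ by field_simp]
    calc invProfile σ ω c x ^ (-(1 / σ)) ≤ (δ * Real.exp (κ * |x|)) ^ (-(1 / σ)) :=
          Real.rpow_le_rpow_of_nonpos (by positivity) hY (by
            rw [neg_nonpos]; positivity)
      _ = δ ^ (-(1 / σ)) * (Real.exp (κ / σ * |x|))⁻¹ := by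
          rw [Real.mul_rpow hδ0.le (Real.exp_pos _).le, ← Real.exp_mul, ← Real.exp_neg]
          congr 2
          ring
      _ ≤ δ ^ (-(1 / σ)) * (b * (1 + x ^ 2))⁻¹ := by gcongr
      _ = _ := by rw [mul_inv, mul_assoc]
  · have h4 : 0 < σ + 1 := by linarith
    set b := min 1 ((σ * c) ^ 2) with hb
    have hb0 : 0 < b := by positivity
    set δ := b / (2 * (σ + 1) * c) with hδ
    have hδ0 : 0 < δ := by positivity
    have hn : ¬ c ^ 2 / 4 < ω := by linarith
    refine ⟨δ ^ (-((2 * σ + 2) / (2 * σ))), fun x => ?_⟩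
    have e : (exponent σ ω c).toReal = 2 * σ + 2 := by
      rw [exponent, if_neg hn, ENNReal.toReal_ofReal (by linarith)]
    have hY : δ * (1 + x ^ 2) ≤ invProfile σ ω c x := by
      rw [invProfile, if_neg hn, hδ, div_mul_eq_mul_div]
      gcongr
      have h5 : b ≤ 1 := min_le_left _ _
      have h6 : b * x ^ 2 ≤ (σ * c) ^ 2 * x ^ 2 := by
        gcongr
        exact min_le_right _ _
      nlinarith
    have h1 : (1:ℝ) ≤ 1 + x ^ 2 := by nlinarith [sq_nonneg x]
    have h7 : -((2 * σ + 2) / (2 * σ)) ≤ -1 := by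
      rw [neg_le_neg_iff, le_div_iff₀ (by positivity)]
      linarith
    rw [e, profile_rpow hσ (Or.inr ⟨h, hc⟩)]
    calc invProfile σ ω c x ^ (-((2 * σ + 2) / (2 * σ)))
        ≤ (δ * (1 + x ^ 2)) ^ (-((2 * σ + 2) / (2 * σ))) :=
          Real.rpow_le_rpow_of_nonpos (by positivity) hY (by linarith)
      _ = δ ^ (-((2 * σ + 2) / (2 * σ))) * (1 + x ^ 2) ^ (-((2 * σ + 2) / (2 * σ))) :=
          Real.mul_rpow hδ0.le (by positivity)
      _ ≤ δ ^ (-((2 * σ + 2) / (2 * σ))) * (1 + x ^ 2) ^ (-1:ℝ) := by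
          gcongr
      _ = _ := by rw [Real.rpow_neg_one]

theorem tendsto_profile (hσ : 1 ≤ σ) (hωc : Admissible ω c) :
    Tendsto (profile σ ω c) (cocompact ℝ) (𝓝 0) := by
  obtain ⟨C, hC⟩ := profile_decay hσ hωc
  have hq := exponent_toReal_pos (ω := ω) (c := c) hσ
  set q := (exponent σ ω c).toReal
  have h1 : Tendsto (fun x : ℝ => 1 + x ^ 2) (cocompact ℝ) atTop := by
    refine tendsto_atTop_add_const_left _ 1 ?_
    have := (tendsto_pow_atTop (α := ℝ) two_ne_zero).comp (tendsto_norm_cocompact_atTop (E := ℝ))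
    refine this.congr fun x => ?_
    simp
  have h2 : Tendsto (fun x => profile σ ω c x ^ q) (cocompact ℝ) (𝓝 0) := by
    refine squeeze_zero (fun x => (Real.rpow_pos_of_pos (profile_pos hσ hωc x) q).le) hC ?_
    simpa using (tendsto_inv_atTop_zero.comp h1).const_mul C
  have h3 := h2.rpow_const (p := q⁻¹) (Or.inr (by positivity))
  rw [Real.zero_rpow (by positivity)] at h3
  refine h3.congr fun x => ?_
  rw [← Real.rpow_mul (profile_pos hσ hωc x).le, mul_inv_cancel₀ hq.ne', Real.rpow_one]

theorem integrable_profile (hσ : 1 ≤ σ) (hωc : Admissible ω c) :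
    Integrable fun x => profile σ ω c x ^ (exponent σ ω c).toReal := by
  obtain ⟨C, hC⟩ := profile_decay hσ hωc
  refine (integrable_inv_one_add_sq.const_mul C).mono' ?_ (Eventually.of_forall fun x => ?_)
  · exact ((continuous_profile hσ hωc).rpow_const
      fun y => Or.inl (profile_pos hσ hωc y).ne').aestronglyMeasurable
  · rw [Real.norm_of_nonneg (Real.rpow_pos_of_pos (profile_pos hσ hωc x) _).le]
    exact hC x

theorem continuous_logDeriv (hσ : 1 ≤ σ) (hωc : Admissible ω c) : Continuous (logDeriv σ ω c) :=
  continuous_iff_continuousAt.2 fun x => (hasDerivAt_logDeriv hσ hωc x).continuousAt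

theorem continuous_wave (hσ : 1 ≤ σ) (hωc : Admissible ω c) : Continuous (wave σ ω c) :=
  continuous_iff_continuousAt.2 fun x => (hasDerivAt_wave hσ hωc x).continuousAt

/-- The derivative of `wave`. -/
noncomputable def waveDeriv (σ ω c x : ℝ) : ℂ :=
  ((logDeriv σ ω c x : ℝ) - Complex.I *
      ((1 / (2 * σ + 2) * profile σ ω c x ^ (2 * σ) : ℝ) : ℂ)) * wave σ ω c x

theorem continuous_waveDeriv (hσ : 1 ≤ σ) (hωc : Admissible ω c) :
    Continuous (waveDeriv σ ω c) := by
  have h1 := continuous_logDeriv hσ hωc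
  have h2 := continuous_wave hσ hωc
  have h3 : Continuous fun y => profile σ ω c y ^ (2 * σ) :=
    (continuous_profile hσ hωc).rpow_const fun y => Or.inl (profile_pos hσ hωc y).ne'
  unfold waveDeriv
  fun_prop

theorem logDeriv_sq_eq (hσ : 1 ≤ σ) (hωc : Admissible ω c) (x : ℝ) :
    logDeriv σ ω c x ^ 2 = (ω - c ^ 2 / 4) + c / (2 * σ + 2) * profile σ ω c x ^ (2 * σ)
      - (1 / (2 * σ + 2)) ^ 2 * (profile σ ω c x ^ (2 * σ)) ^ 2 := by
  have h := qfun_sq σ ω c (wave σ ω c x)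
  rwa [norm_wave hσ hωc, ← logDeriv_sq hσ hωc] at h

/-- The pointwise form of the Pohozaev identity. -/
theorem norm_waveDeriv_sq (hσ : 1 ≤ σ) (hωc : Admissible ω c) (x : ℝ) :
    ‖waveDeriv σ ω c x‖ ^ 2 = (ω - c ^ 2 / 4) * profile σ ω c x ^ 2
      + c / (2 * σ + 2) * profile σ ω c x ^ (2 * σ + 2) := by
  rw [waveDeriv, norm_mul, norm_wave hσ hωc, mul_pow, rpow_two_mul_add_two hσ
    (profile_pos hσ hωc x).le]
  have h : ∀ a b : ℝ, ‖(a : ℂ) - Complex.I * (b : ℂ)‖ ^ 2 = a ^ 2 + b ^ 2 := by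
    intro a b
    rw [← Complex.normSq_eq_norm_sq, Complex.normSq_apply]
    simp
    ring
  rw [h, logDeriv_sq_eq hσ hωc]
  ring

theorem nlDens_wave (hσ : 1 ≤ σ) (hωc : Admissible ω c) (x : ℝ) :
    nlDens σ (wave σ ω c x) (waveDeriv σ ω c x)
      = -(1 / (2 * σ + 2) * ((profile σ ω c x ^ (2 * σ)) ^ 2 * profile σ ω c x ^ 2)) := by
  rw [nlDens, waveDeriv, mul_left_comm, mul_comm _ (wave σ ω c x), Complex.mul_conj,
    Complex.normSq_eq_norm_sq, norm_wave hσ hωc, Complex.im_mul_ofReal]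
  generalize profile σ ω c x ^ (2 * σ) = m
  generalize 1 / (2 * σ + 2) = k
  simp
  ring

theorem nlDens_mul {z : ℂ} (hz : ‖z‖ = 1) (a b : ℂ) : nlDens σ (z * a) (z * b) = nlDens σ a b := by
  have h : (starRingEnd ℂ) (z * a) * (z * b) = (starRingEnd ℂ) a * b := by
    have h1 : z * (starRingEnd ℂ) z = 1 := by
      rw [Complex.mul_conj, Complex.normSq_eq_norm_sq, hz]
      norm_num
    rw [map_mul]
    linear_combination ((starRingEnd ℂ) a * b) * h1
  rw [nlDens, nlDens, h, norm_mul, hz, one_mul]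

/-- `ψ` is a translate and rotation of the wave. -/
def IsWave (σ ω c : ℝ) (ψ : Fn) : Prop :=
  ∃ (z₀ : ℂ) (x₀ : ℝ), ‖z₀‖ = 1 ∧ ψ =ᵐ[volume] fun x => z₀ * wave σ ω c (x - x₀)

/-- The solitary wave belongs to `X \ {0}`; the densities of the functionals along it are
expressed by the profile. -/
theorem IsWave.mem_X (hσ : 1 ≤ σ) (hωc : Admissible ω c) (hψ : IsWave σ ω c ψ) :
    ψ ∈ X σ ω c ∧ ψ ≠ 0 ∧ ∃ x₀, ∀ᵐ x, ‖ψ x‖ = profile σ ω c (x - x₀) ∧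
      ‖weakDeriv ψ x‖ ^ 2 = (ω - c ^ 2 / 4) * profile σ ω c (x - x₀) ^ 2
        + c / (2 * σ + 2) * profile σ ω c (x - x₀) ^ (2 * σ + 2) ∧
      nlDens σ (ψ x) (weakDeriv ψ x) = -(1 / (2 * σ + 2) *
        ((profile σ ω c (x - x₀) ^ (2 * σ)) ^ 2 * profile σ ω c (x - x₀) ^ 2)) := by
  obtain ⟨z₀, x₀, hz, he⟩ := hψ
  set g : ℝ → ℂ := fun x => z₀ * waveDeriv σ ω c (x - x₀) with hg
  have hgc : Continuous g :=
    continuous_const.mul ((continuous_waveDeriv hσ hωc).comp (continuous_sub_right x₀))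
  have hw : HasWeakDeriv ψ g :=
    (HasWeakDeriv.of_hasDerivAt (u := fun x => z₀ * wave σ ω c (x - x₀)) (fun x =>
      ((hasDerivAt_wave hσ hωc (x - x₀)).comp_sub_const x x₀).const_mul z₀) hgc).congr he.symm
      EventuallyEq.rfl
  have hmk := AEEqFun.coeFn_mk (μ := volume) g hgc.aestronglyMeasurable
  have hD : weakDeriv ψ =ᵐ[volume] g := by
    rw [eq_of_weakDeriv hw hmk]
    exact hmk
  have hpq := integrable_profile hσ hωc
  have hpos := profile_pos hσ hωc
  have hq := exponent_toReal_le (ω := ω) (c := c) hσ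
  set q := (exponent σ ω c).toReal with hqdef
  have hm1 : MemLp ψ (exponent σ ω c) volume := by
    rw [← integrable_norm_rpow_iff ψ.aestronglyMeasurable (exponent_ne_zero hσ) exponent_ne_top]
    refine (hpq.comp_sub_right x₀).congr ?_
    filter_upwards [he] with x hx
    rw [hx, norm_mul, hz, one_mul, norm_wave hσ hωc]
  have hnl : ∀ x, ‖g x‖ ^ 2 = (ω - c ^ 2 / 4) * profile σ ω c (x - x₀) ^ 2
        + c / (2 * σ + 2) * profile σ ω c (x - x₀) ^ (2 * σ + 2) := fun x => by
    rw [hg, ← norm_waveDeriv_sq hσ hωc]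
    simp only
    rw [norm_mul, hz, one_mul]
  have hm2 : MemLp g 2 volume := by
    rw [← integrable_norm_rpow_iff hgc.aestronglyMeasurable two_ne_zero (by simp)]
    have i1 : Integrable fun x => (ω - c ^ 2 / 4) * profile σ ω c x ^ 2 := by
      rcases hωc with h | ⟨h, -⟩
      · have : q = 2 := by rw [hqdef, exponent, if_pos h]; norm_num
        rw [this] at hpq
        simpa using hpq.const_mul (ω - c ^ 2 / 4)
      · simp [h]
    have i2 : Integrable fun x => profile σ ω c x ^ (2 * σ + 2) := by
      refine (hpq.const_mul (profile σ ω c 0 ^ (2 * σ + 2 - q))).mono' ?_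
        (Eventually.of_forall fun x => ?_)
      · exact ((continuous_profile hσ hωc).rpow_const
          fun y => Or.inl (hpos y).ne').aestronglyMeasurable
      · rw [Real.norm_of_nonneg (Real.rpow_pos_of_pos (hpos x) _).le]
        calc profile σ ω c x ^ (2 * σ + 2)
            = profile σ ω c x ^ (2 * σ + 2 - q) * profile σ ω c x ^ q := by
              rw [← Real.rpow_add (hpos x)]; congr 1; ring
          _ ≤ _ := by
              have h1 := hpos x
              have h2 := profile_le hσ hωc x
              have h3 : 0 ≤ 2 * σ + 2 - q := by linarith
              gcongr
    have i3 := (i1.add (i2.const_mul (c / (2 * σ + 2)))).comp_sub_right x₀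
    refine i3.congr (Eventually.of_forall fun x => ?_)
    simp [hnl]
  refine ⟨⟨hm1, _, isWeakDeriv_iff.2 (hw.congr EventuallyEq.rfl hD.symm),
    hm2.ae_eq hD.symm⟩, ?_, x₀, ?_⟩
  · rintro rfl
    have h0 : ∀ᵐ x : ℝ, False := by
      filter_upwards [he, AEEqFun.coeFn_zero (α := ℝ) (β := ℂ) (μ := volume)] with x h1 h2
      have h3 : ‖z₀ * wave σ ω c (x - x₀)‖ = 0 := by
        rw [← h1, h2]; simp
      rw [norm_mul, hz, one_mul, norm_wave hσ hωc] at h3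
      exact (hpos _).ne' h3
    exact h0.exists.choose_spec
  · filter_upwards [he, hD] with x h1 h2
    refine ⟨?_, by rw [h2, hnl], ?_⟩
    · rw [h1, norm_mul, hz, one_mul, norm_wave hσ hωc]
    · rw [h1, h2, hg]
      simp only
      rw [nlDens_mul hz, nlDens_wave hσ hωc]

/-- The density of the action along the profile is `∓ ∂ₓ Θ(Φ²)` for `±x ≥ 0`. -/
theorem integral_logDeriv_sq (hσ : 1 ≤ σ) (hωc : Admissible ω c)
    (hi : Integrable fun x => logDeriv σ ω c x ^ 2 * profile σ ω c x ^ 2) :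
    ∫ x, logDeriv σ ω c x ^ 2 * profile σ ω c x ^ 2 = 2 * calib σ ω c (profile σ ω c 0 ^ 2) := by
  have hd : ∀ x, HasDerivAt (fun x => calib σ ω c (profile σ ω c x ^ 2))
      (|logDeriv σ ω c x| * logDeriv σ ω c x * profile σ ω c x ^ 2) x := by
    intro x
    refine ((hasDerivAt_calib hσ _).comp x ((hasDerivAt_profile hσ hωc x).pow 2)).congr_deriv ?_
    rw [Pi.pow_apply, ← logDeriv_sq hσ hωc, Real.sqrt_sq_eq_abs]
    simp
    ring
  have ht : Tendsto (fun x => calib σ ω c (profile σ ω c x ^ 2)) (cocompact ℝ) (𝓝 0) := by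
    have h1 := (tendsto_profile hσ hωc).pow 2
    have h2 := (hasDerivAt_calib (ω := ω) (c := c) hσ 0).continuousAt.tendsto
    rw [calib_zero] at h2
    exact h2.comp (by simpa using h1)
  rw [cocompact_eq_atBot_atTop, tendsto_sup] at ht
  have hs := logDeriv_sign hσ hωc
  have h1 : ∫ x in Ioi 0, logDeriv σ ω c x ^ 2 * profile σ ω c x ^ 2
      = -0 - -calib σ ω c (profile σ ω c 0 ^ 2) := by
    refine integral_Ioi_of_hasDerivAt_of_tendsto (f := fun x => -calib σ ω c (profile σ ω c x ^ 2))
      (hd 0).neg.continuousAt.continuousWithinAt (fun x hx => ?_) hi.integrableOn ht.2.neg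
    refine (hd x).neg.congr_deriv ?_
    rw [abs_of_nonpos (nonpos_of_mul_nonpos_right (hs x) hx)]
    ring
  have h2 : ∫ x in Iic 0, logDeriv σ ω c x ^ 2 * profile σ ω c x ^ 2
      = calib σ ω c (profile σ ω c 0 ^ 2) - 0 := by
    refine integral_Iic_of_hasDerivAt_of_tendsto (hd 0).continuousAt.continuousWithinAt
      (fun x hx => ?_) hi.integrableOn ht.1
    refine (hd x).congr_deriv ?_
    have hx' : x < 0 := hx
    have : 0 ≤ logDeriv σ ω c x := by
      by_contra hcon
      push Not at hcon
      have := mul_pos_of_neg_of_neg hx' hcon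
      linarith [hs x]
    rw [abs_of_nonneg this]
    ring
  rw [← integral_add_compl (measurableSet_Iic (a := (0:ℝ))) hi, compl_Iic, h1, h2]
  ring

/-- The density of the Nehari functional along the profile is a derivative. -/
theorem integral_nehari (hσ : 1 ≤ σ) (hωc : Admissible ω c)
    (hi : Integrable fun x => (2 * (ω - c ^ 2 / 4)
      + (c / (2 * σ + 2) + c / 2) * profile σ ω c x ^ (2 * σ)
      - 1 / (2 * σ + 2) * (profile σ ω c x ^ (2 * σ)) ^ 2) * profile σ ω c x ^ 2) :
    ∫ x, (2 * (ω - c ^ 2 / 4) + (c / (2 * σ + 2) + c / 2) * profile σ ω c x ^ (2 * σ)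
      - 1 / (2 * σ + 2) * (profile σ ω c x ^ (2 * σ)) ^ 2) * profile σ ω c x ^ 2 = 0 := by
  have hd : ∀ x, HasDerivAt (fun x => logDeriv σ ω c x * profile σ ω c x ^ 2)
      ((2 * (ω - c ^ 2 / 4) + (c / (2 * σ + 2) + c / 2) * profile σ ω c x ^ (2 * σ)
      - 1 / (2 * σ + 2) * (profile σ ω c x ^ (2 * σ)) ^ 2) * profile σ ω c x ^ 2) x := by
    intro x
    refine ((hasDerivAt_logDeriv hσ hωc x).mul
      ((hasDerivAt_profile hσ hωc x).pow 2)).congr_deriv ?_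
    have e : logDeriv σ ω c x * ((2:ℕ) * profile σ ω c x ^ (2 - 1) *
        (logDeriv σ ω c x * profile σ ω c x))
        = 2 * logDeriv σ ω c x ^ 2 * profile σ ω c x ^ 2 := by
      norm_num
      ring
    simp only [Pi.pow_apply]
    rw [e, logDeriv_sq_eq hσ hωc]
    have : σ + 1 ≠ 0 := by linarith
    rw [show 2 * σ + 2 = 2 * (σ + 1) by ring]
    field_simp
    ring
  have ht : Tendsto (fun x => logDeriv σ ω c x * profile σ ω c x ^ 2) (cocompact ℝ) (𝓝 0) := by
    rw [tendsto_zero_iff_norm_tendsto_zero]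
    have h1 := (tendsto_profile hσ hωc).pow 2
    have h2 := ((continuous_qfun (ω := ω) (c := c) hσ).sqrt.tendsto 0).comp
      (by simpa using h1 : Tendsto (fun x => profile σ ω c x ^ 2) (cocompact ℝ) (𝓝 0))
    have h3 := h2.mul h1
    rw [zero_pow two_ne_zero, mul_zero] at h3
    refine h3.congr fun x => ?_
    simp only [Function.comp_apply]
    rw [← logDeriv_sq hσ hωc, Real.sqrt_sq_eq_abs, norm_mul, Real.norm_eq_abs, Real.norm_eq_abs,
      abs_of_nonneg (sq_nonneg (profile σ ω c x))]
  rw [cocompact_eq_atBot_atTop, tendsto_sup] at ht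
  rw [integral_of_hasDerivAt_of_tendsto hd hi ht.1 ht.2, sub_zero]

/-- The value of the action is the lower bound `2 Θ(Φ(0)²)`. The constraint is `α` times the Nehari
functional minus `β / 2` times the Pohozaev functional, and both vanish. -/
theorem IsWave.action_constraint (hσ : 1 ≤ σ) (hωc : Admissible ω c) (hψ : IsWave σ ω c ψ) :
    actionTilde σ ω c ψ = 2 * calib σ ω c (profile σ ω c 0 ^ 2) ∧
      constraintTilde σ ω c α β ψ = 0 := by
  obtain ⟨hX, -, x₀, hae⟩ := hψ.mem_X hσ hωc
  have hpos := profile_pos hσ hωc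
  have hσ2 : 2 * σ + 2 ≠ 0 := by linarith
  constructor
  · obtain ⟨hi, he⟩ := actionTilde_eq_integral hσ hωc hX
    have hae' : (fun x => actDens σ ω c (jet ψ x)) =ᵐ[volume] fun x =>
        logDeriv σ ω c (x - x₀) ^ 2 * profile σ ω c (x - x₀) ^ 2 := by
      filter_upwards [hae] with x ⟨h1, h2, h3⟩
      rw [actDens_eq hσ, jet]
      simp only
      rw [h1, h2, h3, rpow_two_mul_add_two hσ (hpos _).le, logDeriv_sq_eq hσ hωc]
      field_simp
      ring
    rw [he, integral_congr_ae hae', integral_sub_right_eq_self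
      (fun x => logDeriv σ ω c x ^ 2 * profile σ ω c x ^ 2)]
    refine integral_logDeriv_sq hσ hωc ?_
    simpa using (hi.congr hae').comp_add_right x₀
  · have i1 := (X_grad hX).1
    have i2 := (X_mass hωc hX).1
    have i3 := (X_rpow hσ hX (s := 2 * σ + 2) le_rfl).1
    have i4 := (X_nlDens hσ hX).1
    -- the Pohozaev identity
    have hP : gradI ψ = massI ω c ψ + c / (2 * σ + 2) * powI σ ψ := by
      unfold gradI massI powI
      rw [← integral_const_mul, ← integral_add i2 (i3.const_mul _)]
      refine integral_congr_ae ?_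
      filter_upwards [hae] with x ⟨h1, h2, _⟩
      rw [h1, h2]
    -- the Nehari identity
    have hN : gradI ψ + massI ω c ψ + c / 2 * powI σ ψ - nonlin σ ψ = 0 := by
      have hae' : (fun x => ‖weakDeriv ψ x‖ ^ 2 + (ω - c ^ 2 / 4) * ‖ψ x‖ ^ 2
          + c / 2 * ‖ψ x‖ ^ (2 * σ + 2) + nlDens σ (ψ x) (weakDeriv ψ x)) =ᵐ[volume] fun x =>
          (2 * (ω - c ^ 2 / 4) + (c / (2 * σ + 2) + c / 2) * profile σ ω c (x - x₀) ^ (2 * σ)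
          - 1 / (2 * σ + 2) * (profile σ ω c (x - x₀) ^ (2 * σ)) ^ 2)
            * profile σ ω c (x - x₀) ^ 2 := by
        filter_upwards [hae] with x ⟨h1, h2, h3⟩
        rw [h1, h2, h3, rpow_two_mul_add_two hσ (hpos _).le]
        ring
      have i5 := ((i1.fun_add i2).fun_add (i3.const_mul (c / 2))).fun_add i4
      rw [(X_nlDens hσ hX).2, sub_neg_eq_add]
      unfold gradI massI powI
      rw [← integral_const_mul (c / 2), ← integral_add i1 i2, ← integral_add (i1.fun_add i2)
        (i3.const_mul _), ← integral_add ((i1.fun_add i2).fun_add (i3.const_mul _)) i4,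
        integral_congr_ae hae', integral_sub_right_eq_self (fun x =>
          (2 * (ω - c ^ 2 / 4) + (c / (2 * σ + 2) + c / 2) * profile σ ω c x ^ (2 * σ)
          - 1 / (2 * σ + 2) * (profile σ ω c x ^ (2 * σ)) ^ 2) * profile σ ω c x ^ 2)]
      refine integral_nehari hσ hωc ?_
      simpa using (i5.congr hae').comp_add_right x₀
    rw [constraintTilde_eq (X_hasWeakDeriv hX)]
    have hN' : nonlin σ ψ = gradI ψ + massI ω c ψ + c / 2 * powI σ ψ := by linarith
    rw [hN', hP]
    field_simp
    ring

end SolitaryWave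

/-! ### The orbit and the minimal value -/

section Orbit

open Filter Set

variable {σ ω c α β : ℝ} {φ : Fn}

theorem solitaryWave_eq (σ ω c x : ℝ) :
    solitaryWave σ ω c x = Complex.exp (Complex.I * c * x / 2) * wave σ ω c x := by
  unfold solitaryWave wave
  rw [mul_left_comm, ← Complex.exp_add]
  congr 2
  push_cast
  ring

theorem mem_orbit_iff : φ ∈ orbit σ ω c ↔ IsWave σ ω c (gauge c φ) := by
  constructor
  · rintro ⟨θ, -, x₀, h⟩
    refine ⟨Complex.exp (((θ - c * x₀ / 2 : ℝ) : ℂ) * Complex.I), x₀,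
      Complex.norm_exp_ofReal_mul_I _, ?_⟩
    filter_upwards [h, coeFn_gauge c φ] with x h1 h2
    rw [h2, h1, solitaryWave_eq, ← mul_assoc, ← mul_assoc, ← Complex.exp_add, ← Complex.exp_add]
    congr 2
    push_cast
    ring
  · rintro ⟨z₀, x₀, hz, h⟩
    have h2π := Real.two_pi_pos
    refine ⟨toIcoMod h2π 0 (Complex.arg z₀ + c * x₀ / 2),
      by simpa using toIcoMod_mem_Ico h2π 0 (Complex.arg z₀ + c * x₀ / 2), x₀, ?_⟩
    have he : Complex.exp (Complex.I * (toIcoMod h2π 0 (Complex.arg z₀ + c * x₀ / 2) : ℝ))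
        = z₀ * Complex.exp (Complex.I * c * x₀ / 2) := by
      have h1 := Complex.norm_mul_exp_arg_mul_I z₀
      rw [hz, Complex.ofReal_one, one_mul] at h1
      conv_rhs => rw [← h1]
      rw [← Complex.exp_add, toIcoMod, Complex.exp_eq_exp_iff_exists_int]
      refine ⟨-toIcoDiv h2π 0 (Complex.arg z₀ + c * x₀ / 2), ?_⟩
      rw [zsmul_eq_mul]
      push_cast
      ring
    filter_upwards [h, coeFn_eq_of_gauge c φ] with x h1 h2
    rw [h2, h1, he, solitaryWave_eq]
    have e : Complex.exp (Complex.I * c * x / 2) = Complex.exp (Complex.I * c * x₀ / 2) *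
        Complex.exp (Complex.I * c * (x - x₀ : ℝ) / 2) := by
      rw [← Complex.exp_add]
      congr 1
      push_cast
      ring
    rw [e]
    ring

theorem exists_isWave (hσ : 1 ≤ σ) (hωc : Admissible ω c) : ∃ φ, IsWave σ ω c (gauge c φ) := by
  have hc := continuous_wave hσ hωc
  obtain ⟨φ, hφ⟩ := gauge_surjective c (AEEqFun.mk _ hc.aestronglyMeasurable)
  refine ⟨φ, 1, 0, by simp, ?_⟩
  rw [hφ]
  filter_upwards [AEEqFun.coeFn_mk (μ := volume) _ hc.aestronglyMeasurable] with x hx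
  rw [hx]
  simp

/-- The infimum is attained by the solitary wave. -/
theorem minValue_eq (hσ : 1 ≤ σ) (hωc : Admissible ω c) (hαβ : ScalingCondition ω c α β) :
    minValue σ ω c α β = ((2 * calib σ ω c (profile σ ω c 0 ^ 2) : ℝ) : EReal) := by
  apply le_antisymm
  · obtain ⟨φ, hφ⟩ := exists_isWave hσ hωc
    obtain ⟨hX, h0, -⟩ := hφ.mem_X hσ hωc
    obtain ⟨hS, hK⟩ := hφ.action_constraint (α := α) (β := β) hσ hωc
    refine sInf_le ⟨φ, ⟨⟨hX, h0⟩, hK⟩, ?_⟩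
    simp only
    rw [action_eq hσ hX, hS]
  · refine le_sInf ?_
    rintro _ ⟨φ, ⟨⟨hX, h0⟩, hK⟩, rfl⟩
    simp only
    rw [action_eq hσ hX, EReal.coe_le_coe_iff]
    exact (calib_le_actionTilde hσ hωc hαβ (isPeak_profile hσ hωc) hX h0 hK).1

theorem minimizers_subset_criticalPoints (hσ : 1 ≤ σ) (hωc : Admissible ω c)
    (hαβ : ScalingCondition ω c α β) : minimizers σ ω c α β ⊆ criticalPoints σ ω c := by
  rintro φ ⟨⟨hX, h0⟩, hS, hK⟩
  rw [minValue_eq hσ hωc hαβ, action_eq hσ hX, EReal.coe_eq_coe_iff] at hS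
  exact ⟨⟨hX, h0⟩, actionDerivVanishes_of_minimal hσ hωc hαβ (isPeak_profile hσ hωc) hX h0 hK hS⟩

theorem criticalPoints_subset_orbit (hσ : 1 ≤ σ) (hωc : Admissible ω c) :
    criticalPoints σ ω c ⊆ orbit σ ω c := by
  rintro φ ⟨⟨hX, h0⟩, hcrit⟩
  exact mem_orbit_iff.2 (eq_wave_of_critical hσ hωc hX h0 fun h hh hn =>
    firstVariation_eq_zero hσ hωc hX hcrit hh hn)

theorem orbit_subset_minimizers (hσ : 1 ≤ σ) (hωc : Admissible ω c)
    (hαβ : ScalingCondition ω c α β) : orbit σ ω c ⊆ minimizers σ ω c α β := by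
  intro φ hφ
  have hw := mem_orbit_iff.1 hφ
  obtain ⟨hX, h0, -⟩ := hw.mem_X hσ hωc
  obtain ⟨hS, hK⟩ := hw.action_constraint (α := α) (β := β) hσ hωc
  refine ⟨⟨hX, h0⟩, ?_, hK⟩
  rw [minValue_eq hσ hωc hαβ, action_eq hσ hX, hS]

end Orbit

end GDNLS

theorem theorem1p1 (σ ω c α β : ℝ) (hσ : 1 ≤ σ) (hωc : GDNLS.Admissible ω c)
    (hαβ : GDNLS.ScalingCondition ω c α β) :
    GDNLS.minimizers σ ω c α β = GDNLS.criticalPoints σ ω c ∧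
      GDNLS.criticalPoints σ ω c = GDNLS.orbit σ ω c := by
  have h1 := GDNLS.minimizers_subset_criticalPoints hσ hωc hαβ
  have h2 := GDNLS.criticalPoints_subset_orbit hσ hωc
  have h3 := GDNLS.orbit_subset_minimizers hσ hωc hαβ
  exact ⟨h1.antisymm (h2.trans h3), h2.antisymm (h3.trans h1)⟩
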